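/- Let $G$ be a locally compact second countable group and let $\mu$ be a Borel probability measure on $G$ which is nondegenerate ($\mathrm{supp}\,\mu$ generates $G$ as a semigroup) and satisfies the tail assumption (T): there are $n\in\mathbb N$ and $\epsilon>0$ with $d_{TV}(\mu^{(n)},\mu^{(n+1)})<1-\epsilon$, where $\mu^{(n)}$ is the $n$-th convolution power and $d_{TV}(\alpha,\beta)=\sup_A|\alpha(A)-\beta(A)|$. Let $\mathbb P_\mu$ be the law on $G^{\mathbb N}$ of the trajectory $\omega=(\omega_1,\omega_2,\dots)$ of the $\mu$-random walk started at $e$. For a standard Borel $G$-space $X$ and a quasi-invariant probability measure $\eta$ on $X$ with $\mu*\eta=\eta$ (a stationary system), let $\eta_\omega=\lim_n\omega_n.\eta$ be the $\mathbb P_\mu$-almost sure limit and put $\eta\curlyvee\mathbb P_\mu=\int\eta_\omega\times\delta_\omega\,d\mathbb P_\mu(\omega)$ on $X\times G^{\mathbb N}$. For a probability measure $\eta$ on a $G$-space, the Furstenberg entropy is $$h_\mu(X,\eta)=-\int_G\int_X\log\frac{dg^{-1}\eta}{d\eta}\,d\eta\,d\mu(g)=\int_G D(\eta\,\|\,g^{-1}\eta)\,d\mu(g)\in[0,\infty],$$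 where $D$ is the Kullback–Leibler divergence. Let $(X,\eta)$ be a standard system with structure $\pi:(X,\eta)\to(Y,\nu)$: $(X,\eta)$ is a stationary system, $\pi$ is a $G$-equivariant Borel map with $\pi_*\eta=\nu$, the disintegration $\eta=\int_Y\eta^y\,d\nu(y)$ satisfies $g.\eta^y=\eta^{g.y}$ for every $g\in G$ and $\nu$-a.e. $y$, and $(Y,\nu)$ is a $\mu$-boundary, i.e. $\nu_\omega=\delta_{\boldsymbol\beta_Y(\omega)}$ for $\mathbb P_\mu$-a.e. $\omega$, for some measurable $\boldsymbol\beta_Y:G^{\mathbb N}\to Y$. Let $x\mapsto L_x$ be a measurable map from $X$ to the space of closed subgroups of $G$ (with the Chabauty topology), $G$-equivariant ($L_{g.x}=gL_xg^{-1}$), and such that (S) $L_x\le\mathrm{Stab}_G(\pi(x))$ for every $x\in X$. Let $W_\Omega=\bigsqcup_{x\in X}\{x\}\times(L_x\backslash G)^{\mathbb N}$ with the action $g.(x,(L_x\omega_n)_n)=(g.x,(L_{g.x}g\omega_n)_n)$, let $\vartheta(x,\omega)=(x,(L_x\omega_n)_{n\ge1})$ and $\overline{\mathbb P}_\mu=\vartheta_*(\eta\curlyvee\mathbb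 P_\mu)$, and let $\mathcal I$ be the $\sigma$-field of Borel subsets of $W_\Omega$ invariant under the time shift $(x,(L_x\omega_n)_n)\mapsto(x,(L_x\omega_{n+1})_n)$. Let $(Z,\lambda)$ be the Poisson bundle over $(X,\eta)$, i.e. a point realisation, as a standard Borel $G$-space, of $\mathcal I$ with the measure $\overline{\mathbb P}_\mu$. For $y\in Y$ let $\mathbb P_\mu^y$ be the conditional law of $\omega$ under $\mathbb P_\mu$ given $\boldsymbol\beta_Y(\omega)=y$ (the law of the Doob transformed random walk). For $x\in X$ let $\xi_n^x=L_x\omega_n\in L_x\backslash G$, $n\ge1$, where $\omega$ has law $\mathbb P_\mu^{\pi(x)}$, let $\mathcal T_x=\bigcap_n\sigma(\xi_n^x,\xi_{n+1}^x,\dots)$ be its tail $\sigma$-field, and let $$\mathrm I(\xi_1^x,\mathcal T_x)=\int D\big(\mathbb P_\mu^{\pi(x)}(\xi_1^x\in\cdot\mid\mathcal T_x)\,\big\|\,\mathbb P_\mu^{\pi(x)}(\xi_1^x\in\cdot)\big)\,d\mathbb P_\mu^{\pi(x)}$$ be the mutual information of $\xi_1^x$ and $\mathcal T_x$. Then, in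 $[0,\infty]$, $$h_\mu(Z,\lambda)=h_\mu(Y,\nu)+\int_X\mathrm I(\xi_1^x,\mathcal T_x)\,d\eta(x).$$ -/

import Mathlib

open MeasureTheory ProbabilityTheory Filter Topology
open scoped ENNReal

noncomputable section

namespace PoissonBundle

/-! ### Closed subgroups, random walks -/

section ClosedSubgroups

variable (G : Type*) [Group G] [TopologicalSpace G]

/-- The Chabauty topology on the space `Sub(G)` of closed subgroups of `G`. -/
instance chabautyTopology : TopologicalSpace (ClosedSubgroup G) :=
  TopologicalSpace.generateFrom
    ({s | ∃ U : Set G, IsOpen U ∧ s = {H : ClosedSubgroup G | ((H : Set G) ∩ U).Nonempty}} ∪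
      {s | ∃ K : Set G, IsCompact K ∧ s = {H : ClosedSubgroup G | (H : Set G) ∩ K = ∅}})

/-- The Borel `σ`-algebra of the Chabauty topology. -/
instance chabautyMeasurableSpace : MeasurableSpace (ClosedSubgroup G) :=
  borel (ClosedSubgroup G)

end ClosedSubgroups

section Walk

variable {G : Type*} [Group G]

/-- The trajectory with increments `s 0, s 1, …` started at the identity.  Trajectories
`(ω₁, ω₂, …)` are indexed from `0` throughout: `ω n` is the position at time `n + 1`. -/
def trajectory (s : ℕ → G) : ℕ → G
  | 0 => s 0
  | n + 1 => trajectory s n * s (n + 1)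

variable [TopologicalSpace G] [IsTopologicalGroup G] [SecondCountableTopology G]
  [MeasurableSpace G] [BorelSpace G]

theorem measurable_trajectory : Measurable (trajectory : (ℕ → G) → ℕ → G) := by
  refine measurable_pi_lambda _ fun n => ?_
  induction n with
  | zero => exact measurable_pi_apply 0
  | succ n ih => exact ih.mul (measurable_pi_apply (n + 1))

/-- The law `ℙ_μ` on `G^ℕ` of the trajectory of the `μ`-random walk started at the identity. -/
def walkLaw (μ : Measure G) [IsProbabilityMeasure μ] : Measure (ℕ → G) :=
  (Measure.infinitePi fun _ : ℕ => μ).map trajectory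

instance (μ : Measure G) [IsProbabilityMeasure μ] : IsProbabilityMeasure (walkLaw μ) :=
  Measure.isProbabilityMeasure_map measurable_trajectory.aemeasurable

/-- The convolution powers `μ^{(n)}`, with `μ^{(0)} = δ_e`. -/
def convPow (μ : Measure G) : ℕ → Measure G
  | 0 => Measure.dirac 1
  | n + 1 => (convPow μ n).mconv μ

/-- Total variation distance `sup_A |α(A) - β(A)|`. -/
def dTV (α β : Measure G) : ℝ :=
  ⨆ A : {A : Set G // MeasurableSet A}, |α.real A - β.real A|

/-- The support of `μ` generates `G` as a semigroup. -/
def Nondegenerate (μ : Measure G) : Prop :=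
  Subsemigroup.closure μ.support = ⊤

/-- The tail assumption **(T)** on the step distribution. -/
def TailAssumption (μ : Measure G) : Prop :=
  ∃ n : ℕ, ∃ ε : ℝ, 0 < ε ∧ dTV (convPow μ n) (convPow μ (n + 1)) < 1 - ε

end Walk

/-! ### Stationary systems, boundaries, standard systems -/

section Systems

variable {G : Type*} [Group G] [TopologicalSpace G] [IsTopologicalGroup G]
  [SecondCountableTopology G] [MeasurableSpace G] [BorelSpace G]
  {X : Type*} [MeasurableSpace X] [MulAction G X]
  {Y : Type*} [MeasurableSpace Y] [MulAction G Y]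

/-- Furstenberg entropy
`h_μ(X, η) = -∫_G ∫_X log (dg⁻¹η/dη) dη dμ(g) = ∫_G D(η ‖ g⁻¹η) dμ(g)`, a value in `[0, ∞]`. -/
def furstenbergEntropy (μ : Measure G) (η : Measure X) : ℝ≥0∞ :=
  ∫⁻ g, InformationTheory.klDiv η (η.map fun x => g⁻¹ • x) ∂μ

/-- `κ` is a version of `ω ↦ η_ω = lim_n ω_n.η`.  For each measurable `A` the sequence
`(ω_n.η)(A)` is a bounded martingale, and the limit is taken on each `A` almost surely; on a
compact model this is the almost sure weak-* limit. -/
def IsLimitMeasure (μ : Measure G) [IsProbabilityMeasure μ] (η : Measure X)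
    (κ : (ℕ → G) → Measure X) : Prop :=
  ∀ A : Set X, MeasurableSet A → ∀ᵐ ω ∂(walkLaw μ),
    Tendsto (fun n : ℕ => (η.map fun x => ω n • x) A) atTop (𝓝 (κ ω A))

open Classical in
/-- The conditional measures `ω ↦ η_ω`.  They are unique up to `ℙ_μ`-null sets, and exist for
every stationary system on a standard Borel space by the martingale convergence theorem. -/
def limitMeasure (μ : Measure G) [IsProbabilityMeasure μ] (η : Measure X) :
    Kernel (ℕ → G) X :=
  if h : ∃ κ : Kernel (ℕ → G) X, IsMarkovKernel κ ∧ IsLimitMeasure μ η κ then h.choose else 0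

/-- `η ⋎ ℙ_μ = ∫ η_ω × δ_ω dℙ_μ(ω)`, a measure on `X × G^ℕ`. -/
def joining (μ : Measure G) [IsProbabilityMeasure μ] (η : Measure X) :
    Measure (X × (ℕ → G)) :=
  (walkLaw μ ⊗ₘ limitMeasure μ η).map Prod.swap

/-- `β_Y : G^ℕ → Y` witnesses that `(Y, ν)` is a `μ`-boundary (i.e. `μ`-proximal):
`ν_ω = δ_{β_Y(ω)}` for `ℙ_μ`-almost every `ω`. -/
structure IsBoundaryMap (μ : Measure G) [IsProbabilityMeasure μ] (ν : Measure Y)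
    (β : (ℕ → G) → Y) : Prop where
  measurable : Measurable β
  limit : IsLimitMeasure μ ν fun ω => Measure.dirac (β ω)

/-- `(X, η)` is a stationary `(G, μ)`-space: `η` is quasi-invariant and `μ * η = η`. -/
structure IsStationary (μ : Measure G) (η : Measure X) : Prop where
  quasiInvariant : ∀ g : G, η.map (fun x => g • x) ≪ η
  stationary : (μ.prod η).map (fun p : G × X => p.1 • p.2) = η

/-- `π : (X, η) → (Y, ν)` is a `G`-factor map. -/
structure IsFactorMap (G : Type*) [Group G] [MulAction G X] [MulAction G Y]
    (η : Measure X) (ν : Measure Y) (π : X → Y) : Prop where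
  measurable : Measurable π
  equivariant : ∀ (g : G) (x : X), π (g • x) = g • π x
  map_eq : η.map π = ν

/-- The disintegration `y ↦ η^y` of `η` over `π`. -/
def disintegration [StandardBorelSpace X] [Nonempty X] (η : Measure X) [IsFiniteMeasure η]
    (π : X → Y) : Kernel Y X :=
  condDistrib id π η

/-- `(X, η)` is a standard `(G, μ)`-system with structure `π : (X, η) → (Y, ν)`: `π` is a measure
preserving extension (`g.η^y = η^{g.y}`) of the `μ`-boundary `(Y, ν)`, whose boundary map is
`β`. -/
structure IsStandardSystem [StandardBorelSpace X] [Nonempty X] (μ : Measure G)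
    [IsProbabilityMeasure μ] (η : Measure X) [IsProbabilityMeasure η] (ν : Measure Y)
    (π : X → Y) (β : (ℕ → G) → Y) : Prop where
  stationary : IsStationary μ η
  factor : IsFactorMap G η ν π
  measurePreserving : ∀ g : G, ∀ᵐ y ∂ν,
    (disintegration η π y).map (fun x => g • x) = disintegration η π (g • y)
  boundary : IsBoundaryMap μ ν β

end Systems

/-! ### Fields of subgroups, coset trajectories, the Poisson bundle -/

/-- A `G`-equivariant measurable map `L : X → Sub(G)`, `L_{g.x} = g L_x g⁻¹`. -/
structure SubgroupField (G : Type*) [Group G] [TopologicalSpace G]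
    (X : Type*) [MeasurableSpace X] [MulAction G X] where
  /-- the map `x ↦ L_x` -/
  toFun : X → ClosedSubgroup G
  measurable : Measurable toFun
  equivariant : ∀ (g : G) (x : X),
    (toFun (g • x)).toSubgroup = (toFun x).toSubgroup.map (MulAut.conj g).toMonoidHom

/-- The space `H \ G` of right cosets `Hg`, with the quotient Borel structure. -/
abbrev CosetSpace {G : Type*} [Group G] (H : Subgroup G) : Type _ :=
  Quotient (QuotientGroup.rightRel H)

/-- The coset `Hg`. -/
def coset {G : Type*} [Group G] (H : Subgroup G) (g : G) : CosetSpace H :=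
  Quotient.mk (QuotientGroup.rightRel H) g

section Bundle

variable {G : Type*} [Group G] [TopologicalSpace G]
  {X : Type*} [MeasurableSpace X] [MulAction G X]

/-- The group `L_x`. -/
def SubgroupField.group (L : SubgroupField G X) (x : X) : Subgroup G :=
  (L.toFun x).toSubgroup

/-- `W_Ω = ⨆_x {x} × (L_x \ G)^ℕ`. -/
def CosetTrajectories (L : SubgroupField G X) : Type _ :=
  Σ x : X, ℕ → CosetSpace (L.group x)

/-- `ϑ (x, ω) = (x, (L_x ω₁, L_x ω₂, …))`. -/
def toCosets (L : SubgroupField G X) (p : X × (ℕ → G)) : CosetTrajectories L :=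
  ⟨p.1, fun n => coset (L.group p.1) (p.2 n)⟩

/-- The Borel structure of `W_Ω` as the quotient of `X × G^ℕ` under `ϑ`. -/
instance [MeasurableSpace G] (L : SubgroupField G X) : MeasurableSpace (CosetTrajectories L) :=
  MeasurableSpace.map (toCosets L) inferInstance

/-- `L_x a ↦ L_{g.x} g a`. -/
def translateCoset (L : SubgroupField G X) (g : G) (x : X) :
    CosetSpace (L.group x) → CosetSpace (L.group (g • x)) :=
  Quotient.map' (fun a => g * a) (by
    intro a b hab
    have h : b * a⁻¹ ∈ L.group x := QuotientGroup.rightRel_apply.1 hab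
    refine QuotientGroup.rightRel_apply.2 ?_
    have e : L.group (g • x) = (L.group x).map (MulAut.conj g).toMonoidHom := L.equivariant g x
    rw [e]
    exact ⟨b * a⁻¹, h, by simp [mul_assoc]⟩)

/-- The action `g.(x, (L_x ω_n)_n) = (g.x, (L_{g.x} g ω_n)_n)` of `g` on `W_Ω`. -/
def translate (L : SubgroupField G X) (g : G) (w : CosetTrajectories L) : CosetTrajectories L :=
  ⟨g • w.1, fun n => translateCoset L g w.1 (w.2 n)⟩

/-- The time shift `𝒮 (x, (L_x ω₁, L_x ω₂, …)) = (x, (L_x ω₂, L_x ω₃, …))`. -/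
def timeShift (L : SubgroupField G X) (w : CosetTrajectories L) : CosetTrajectories L :=
  ⟨w.1, fun n => w.2 (n + 1)⟩

variable [IsTopologicalGroup G] [SecondCountableTopology G] [MeasurableSpace G] [BorelSpace G]

/-- The measure `ϑ_*(η ⋎ ℙ_μ)` on `W_Ω`. -/
def cosetLaw (μ : Measure G) [IsProbabilityMeasure μ] (η : Measure X) (L : SubgroupField G X) :
    Measure (CosetTrajectories L) :=
  (joining μ η).map (toCosets L)

/-- `θ : W_Ω → (Z, lam)` exhibits `(Z, lam)` as the `(G, μ)`-Poisson bundle over `(X, η)`, i.e. as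
a point realisation of the shift-invariant `σ`-field `ℐ` of `W_Ω` with the measure
`ϑ_*(η ⋎ ℙ_μ)`: `θ` is `ℐ`-measurable, carries this measure to `lam`, is `G`-equivariant
almost everywhere, and every set of `ℐ` is, up to a null set, pulled back from `Z`. -/
structure IsPoissonBundle {Z : Type*} [MeasurableSpace Z] [MulAction G Z]
    (μ : Measure G) [IsProbabilityMeasure μ] (η : Measure X) (L : SubgroupField G X)
    (lam : Measure Z) (θ : CosetTrajectories L → Z) : Prop where
  measurable : Measurable[MeasurableSpace.invariants (timeShift L)] θ
  map_eq : (cosetLaw μ η L).map θ = lam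
  equivariant : ∀ g : G, ∀ᵐ w ∂(cosetLaw μ η L), θ (translate L g w) = g • θ w
  generates : ∀ A : Set (CosetTrajectories L),
    MeasurableSet[MeasurableSpace.invariants (timeShift L)] A →
      ∃ B : Set Z, MeasurableSet B ∧ A =ᵐ[cosetLaw μ η L] θ ⁻¹' B

end Bundle

/-! ### Mutual information and the fiberwise chain -/

/-- The mutual information of a random variable `ξ` and a sub-`σ`-field `m`,
`I(ξ, m) = ∫ D(P(ξ | m) ‖ P(ξ)) dP`, a value in `[0, ∞]`. -/
def mutualInfo {Ω S : Type*} (m : MeasurableSpace Ω) [mΩ : MeasurableSpace Ω]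
    [StandardBorelSpace Ω] [MeasurableSpace S]
    (P : Measure Ω) [IsFiniteMeasure P] (ξ : Ω → S) : ℝ≥0∞ :=
  ∫⁻ ω, InformationTheory.klDiv ((condExpKernel P m ω).map ξ) (P.map ξ) ∂P

/-- The tail `σ`-field `⋂_n σ(ξ_n, ξ_{n+1}, …)` of a sequence of random variables. -/
@[reducible] def tailField {Ω S : Type*} [MeasurableSpace S] (ξ : ℕ → Ω → S) : MeasurableSpace Ω :=
  ⨅ n : ℕ, ⨆ k : ℕ, MeasurableSpace.comap (ξ (n + k)) inferInstance

section Fiber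

variable {G : Type*} [Group G] [TopologicalSpace G] [IsTopologicalGroup G] [PolishSpace G]
  [MeasurableSpace G] [BorelSpace G]
  {X : Type*} [MeasurableSpace X] [MulAction G X] {Y : Type*} [MeasurableSpace Y]

/-- `y ↦ ℙ_μ^y`, the disintegration of `ℙ_μ` over `β_Y : (G^ℕ, ℙ_μ) → (Y, ν)`, that is, the
conditional law of `ω` given `β_Y(ω) = y`: the law of the Doob transformed random walk. -/
def doobLaw (μ : Measure G) [IsProbabilityMeasure μ] (β : (ℕ → G) → Y) : Kernel Y (ℕ → G) :=
  condDistrib id β (walkLaw μ)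

instance (μ : Measure G) [IsProbabilityMeasure μ] (β : (ℕ → G) → Y) :
    IsMarkovKernel (doobLaw μ β) := by
  unfold doobLaw; infer_instance

/-- The fiberwise coset process: `fiberChain L x n` is `ξ^x_{n+1} : ω ↦ L_x ω_{n+1}`. -/
def fiberChain (L : SubgroupField G X) (x : X) (n : ℕ) (ω : ℕ → G) : CosetSpace (L.group x) :=
  coset (L.group x) (ω n)

/-- `I(ξ₁^x, 𝒯_x)`, where the coset process runs under `ℙ_μ^{π(x)}` and `𝒯_x` is its tail
`σ`-field. -/
def fiberInfo (μ : Measure G) [IsProbabilityMeasure μ] (π : X → Y) (β : (ℕ → G) → Y)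
    (L : SubgroupField G X) (x : X) : ℝ≥0∞ :=
  mutualInfo (tailField (fiberChain L x)) (doobLaw μ β (π x)) (fiberChain L x 0)

end Fiber

end PoissonBundle

end

noncomputable section

set_option linter.unusedSectionVars false

namespace PoissonBundle

open InformationTheory

/-! ### Kullback–Leibler divergence of kernels -/

section KL

open MeasurableSpace

variable {A B C : Type*} {mA : MeasurableSpace A} {mB : MeasurableSpace B} {mC : MeasurableSpace C}

/-! Furstenberg entropy is a mutual information. If `g` has law `μ` and `w` is an independent point
with stationary law `ρ`, then `∫ D(gρ ‖ ρ) dμ(g)` is the divergence of the joint law of `(g, g • w)`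
from the product of its marginals. Disintegrated the other way, it is the mean divergence from `μ`
of the law of the first step given the point (`furstenbergEntropy_eq_lintegral`). This applies both
to the boundary and to the bundle.

Since `η_ω = η^{β(ω)}`, the joining is also the law of a pair in which `x` has law `η` and `ω` is
the Doob walk towards `π x` (`joining_eq_compProd`), so the two entropies can be compared over a
fixed `x`. With `z` the bundle point of `(x, ω)`, the compensation identity `lintegral_klDiv_eq_add`
splits the mean divergence of the first step given `z` from `μ` into the divergence of the Doob
first step from `μ`, which integrates to the entropy of the boundary, and the mutual information of
the first step and `z`.

Two facts turn the latter into `I(ξ₁, 𝒯_x)`. By (S) and the Markov property of the Doob walks, the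
law of `z` given the first step depends only on the coset of that step, so passing to cosets loses
no information (`lintegral_klDiv_map`). And conditioning the first step on `𝒯_x` is conditioning it
on `z` (`condExpKernel_tailField`). For the second fact, tail sets on `X × G^ℕ` are shift invariant
up to null sets: by (T) and a zero-two law, `μ^{(N)}` and `μ^{(N+1)}` come arbitrarily close, and
the measures of a tail set and of its shift preimage are averages of one bounded function over these
powers. Then the global tail field is compared with the tail fields of the fibres by Lévy's downward
theorem on both levels. Divergences are only ever added, so everything holds in `[0, ∞]`. -/

theorem klDiv_kernel_eq [CountableOrCountablyGenerated B A] (κ κ' : Kernel B A)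
    [IsFiniteKernel κ] [IsFiniteKernel κ'] {b : B} (h : κ b ≪ κ' b) :
    klDiv (κ b) (κ' b) = ∫⁻ a, ENNReal.ofReal (klFun (κ.rnDeriv κ' b a).toReal) ∂κ' b := by
  rw [klDiv_eq_lintegral_klFun_of_ac h]
  refine lintegral_congr_ae ?_
  filter_upwards [Kernel.rnDeriv_eq_rnDeriv_measure (κ := κ) (η := κ') (a := b)] with a ha
  rw [ha]

theorem measurable_lintegral_klFun [CountableOrCountablyGenerated B A] (κ κ' : Kernel B A)
    [IsFiniteKernel κ] [IsFiniteKernel κ'] :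
    Measurable fun b =>
      ∫⁻ a, ENNReal.ofReal (klFun (κ.rnDeriv κ' b a).toReal) ∂κ' b := by
  have h : Measurable fun p : B × A => ENNReal.ofReal (klFun (κ.rnDeriv κ' p.1 p.2).toReal) :=
    (measurable_klFun.comp (Kernel.measurable_rnDeriv κ κ').ennreal_toReal).ennreal_ofReal
  exact h.lintegral_kernel_prod_right'

theorem measurable_klDiv [CountableOrCountablyGenerated B A] (κ κ' : Kernel B A)
    [IsFiniteKernel κ] [IsFiniteKernel κ'] :
    Measurable fun b => klDiv (κ b) (κ' b) := by
  classical
  have h : (fun b => klDiv (κ b) (κ' b)) = fun b => if b ∈ {b | κ b ≪ κ' b} then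
      ∫⁻ a, ENNReal.ofReal (klFun (κ.rnDeriv κ' b a).toReal) ∂κ' b else ∞ := by
    funext b
    split_ifs with hb
    · exact klDiv_kernel_eq κ κ' hb
    · exact klDiv_of_not_ac hb
  rw [h]
  exact Measurable.ite (Kernel.measurableSet_absolutelyContinuous κ κ')
    (measurable_lintegral_klFun κ κ') measurable_const

/-- Under fibrewise absolute continuity the jointly measurable `κ.rnDeriv κ'` is the density of the
composition-products. Otherwise the fibre divergence is `∞` on a set of positive measure and both
sides are `∞`. -/
theorem klDiv_compProd_right [CountableOrCountablyGenerated B A] (N : Measure B)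
    [IsFiniteMeasure N] (κ κ' : Kernel B A) [IsFiniteKernel κ] [IsFiniteKernel κ'] :
    klDiv (N ⊗ₘ κ) (N ⊗ₘ κ') = ∫⁻ b, klDiv (κ b) (κ' b) ∂N := by
  by_cases hac : ∀ᵐ b ∂N, κ b ≪ κ' b
  · have hac' : N ⊗ₘ κ ≪ N ⊗ₘ κ' := Measure.absolutelyContinuous_compProd_right_iff.2 hac
    have hm := Kernel.measurable_rnDeriv κ κ'
    have hd : N ⊗ₘ κ = (N ⊗ₘ κ').withDensity fun p => κ.rnDeriv κ' p.1 p.2 := by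
      ext s hs
      rw [withDensity_apply _ hs, ← lintegral_indicator hs,
        Measure.lintegral_compProd (hm.indicator hs), Measure.compProd_apply hs]
      refine lintegral_congr_ae ?_
      filter_upwards [hac] with b hb
      rw [← Kernel.setLIntegral_rnDeriv hb (measurable_prodMk_left hs),
        ← lintegral_indicator (measurable_prodMk_left hs)]
      rfl
    have hr : (N ⊗ₘ κ).rnDeriv (N ⊗ₘ κ') =ᵐ[N ⊗ₘ κ'] fun p => κ.rnDeriv κ' p.1 p.2 := by
      conv_lhs => rw [hd]
      exact Measure.rnDeriv_withDensity _ hm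
    rw [klDiv_eq_lintegral_klFun_of_ac hac']
    have h1 : ∫⁻ p, ENNReal.ofReal (klFun ((N ⊗ₘ κ).rnDeriv (N ⊗ₘ κ') p).toReal) ∂(N ⊗ₘ κ') =
        ∫⁻ p, ENNReal.ofReal (klFun (κ.rnDeriv κ' p.1 p.2).toReal) ∂(N ⊗ₘ κ') := by
      refine lintegral_congr_ae ?_
      filter_upwards [hr] with p hp
      rw [hp]
    have h2 : Measurable fun p : B × A => ENNReal.ofReal (klFun (κ.rnDeriv κ' p.1 p.2).toReal) :=
      (measurable_klFun.comp hm.ennreal_toReal).ennreal_ofReal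
    rw [h1, Measure.lintegral_compProd h2]
    refine lintegral_congr_ae ?_
    filter_upwards [hac] with b hb
    rw [klDiv_kernel_eq κ κ' hb]
  · rw [klDiv_of_not_ac (mt Measure.absolutelyContinuous_compProd_right_iff.1 hac)]
    by_contra hne
    refine hac ?_
    filter_upwards [ae_lt_top' (measurable_klDiv κ κ').aemeasurable (Ne.symm hne)] with b hb
    by_contra hb'
    rw [klDiv_of_not_ac hb'] at hb
    exact lt_irrefl _ hb

theorem klDiv_map_measurableEquiv (e : A ≃ᵐ B) (ρ ρ' : Measure A) [IsFiniteMeasure ρ]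
    [IsFiniteMeasure ρ'] : klDiv (ρ.map e) (ρ'.map e) = klDiv ρ ρ' := by
  refine le_antisymm (klDiv_map_le _ _ e.measurable) ?_
  have h := klDiv_map_le (ρ.map e) (ρ'.map e) e.symm.measurable
  simpa using h

theorem klDiv_map_swap (ρ ρ' : Measure (A × B)) [IsFiniteMeasure ρ] [IsFiniteMeasure ρ'] :
    klDiv (ρ.map Prod.swap) (ρ'.map Prod.swap) = klDiv ρ ρ' :=
  klDiv_map_measurableEquiv MeasurableEquiv.prodComm ρ ρ'

/-- When `R` is the mixture of the `κ b`, this is a mutual information, hence symmetric in the two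
variables; the next two lemmas rest on that symmetry. -/
theorem lintegral_klDiv_const [CountablyGenerated A] (N : Measure B) [IsFiniteMeasure N]
    (κ : Kernel B A) [IsFiniteKernel κ] (R : Measure A) [IsFiniteMeasure R] :
    ∫⁻ b, klDiv (κ b) R ∂N = klDiv (N ⊗ₘ κ) (N.prod R) := by
  rw [← Measure.compProd_const, klDiv_compProd_right]
  rfl

/-- The compensation identity: `∫ D(κ_b ‖ μ) dN(b) = D(R ‖ μ) + ∫ D(κ_b ‖ R) dN(b)` where `R` is
the mixture of the `κ_b`. -/
theorem lintegral_klDiv_eq_add [CountablyGenerated A] (N : Measure B) [IsProbabilityMeasure N]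
    (κ : Kernel B A) [IsMarkovKernel κ] (R : Measure A) [IsProbabilityMeasure R]
    (m : Kernel A B) [IsMarkovKernel m] (h : (N ⊗ₘ κ).map Prod.swap = R ⊗ₘ m)
    (μ : Measure A) [IsProbabilityMeasure μ] :
    ∫⁻ b, klDiv (κ b) μ ∂N = klDiv R μ + ∫⁻ b, klDiv (κ b) R ∂N := by
  -- Seen from `A`, the joint law is `R ⊗ₘ m`, compared with `μ ⊗ₘ const N` and with `R ⊗ₘ const N`;
  -- the chain rule relates the two.
  rw [lintegral_klDiv_const, lintegral_klDiv_const, ← klDiv_map_swap, ← klDiv_map_swap _ (N.prod R),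
    h, Measure.prod_swap, Measure.prod_swap, ← Measure.compProd_const, ← Measure.compProd_const]
  exact klDiv_compProd_eq_add R μ m _

/-- If the reverse kernel factors through `q`, then no information is lost by applying `q`. -/
theorem lintegral_klDiv_map [CountablyGenerated A] [CountablyGenerated B] [CountablyGenerated C]
    (N : Measure B) [IsProbabilityMeasure N]
    (κ : Kernel B A) [IsMarkovKernel κ] (R : Measure A) [IsProbabilityMeasure R]
    {q : A → C} (hq : Measurable q)
    (m : Kernel C B) [IsMarkovKernel m] (h : (N ⊗ₘ κ).map Prod.swap = R ⊗ₘ m.comap q hq) :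
    ∫⁻ b, klDiv (κ b) R ∂N = ∫⁻ b, klDiv ((κ b).map q) (R.map q) ∂N := by
  have : IsProbabilityMeasure (R.map q) := Measure.isProbabilityMeasure_map hq.aemeasurable
  have : IsMarkovKernel (κ.map q) := Kernel.IsMarkovKernel.map _ hq
  have h2 : ∫⁻ b, klDiv ((κ b).map q) (R.map q) ∂N =
      ∫⁻ b, klDiv ((κ.map q) b) (R.map q) ∂N := by
    simp_rw [Kernel.map_apply κ hq]
  have h3 : (N ⊗ₘ κ.map q).map Prod.swap = (R.map q) ⊗ₘ m := by
    have e : (Prod.swap ∘ Prod.map id q : B × A → C × B) = Prod.map q id ∘ Prod.swap := rfl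
    rw [Measure.compProd_map hq, Measure.map_map measurable_swap (measurable_id.prodMap hq), e,
      ← Measure.map_map (hq.prodMap measurable_id) measurable_swap, h]
    ext s hs
    rw [Measure.map_apply (hq.prodMap measurable_id) hs, Measure.compProd_apply hs,
      Measure.compProd_apply ((hq.prodMap measurable_id) hs),
      lintegral_map (Kernel.measurable_kernel_prodMk_left hs) hq]
    rfl
  -- Seen from `A`, both sides average `klDiv (m c) N`: one over `c = q a` with `a` of law `R`, the
  -- other over the image of `R` under `q`.
  rw [h2, lintegral_klDiv_const, lintegral_klDiv_const, ← klDiv_map_swap,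
    ← klDiv_map_swap _ (N.prod (R.map q)), h, h3, Measure.prod_swap, Measure.prod_swap,
    ← lintegral_klDiv_const, ← lintegral_klDiv_const,
    lintegral_map (f := fun c => klDiv (m c) N) ?_ hq]
  · rfl
  · exact measurable_klDiv m (Kernel.const C N)

end KL

/-! ### The zero-two law for convolution powers -/

section ZeroTwoRing

/-- The squared ratio of consecutive terms, `((2j+1)/(2j+2))²`, is at most `(2j+1)/(2j+3)`, so the
bound propagates. It gives decay of order `1/√j`. -/
theorem centralBinom_sq_mul_le (j : ℕ) :
    ((j.centralBinom : ℝ) / 4 ^ j) ^ 2 * (2 * j + 1) ≤ 1 := by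
  induction j with
  | zero => simp
  | succ j ih =>
    have h : ((j + 1).centralBinom : ℝ) = 2 * (2 * j + 1) * j.centralBinom / (j + 1) := by
      have h0 : ((j + 1 : ℕ) : ℝ) * ((j + 1).centralBinom : ℝ) =
          ((2 * (2 * j + 1) : ℕ) : ℝ) * j.centralBinom := by
        exact_mod_cast Nat.succ_mul_centralBinom_succ j
      push_cast at h0
      field_simp
      linarith
    set a : ℝ := (j.centralBinom : ℝ) / 4 ^ j with ha
    have h' : ((j + 1).centralBinom : ℝ) / 4 ^ (j + 1) = a * ((2 * j + 1) / (2 * j + 2)) := by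
      rw [h, ha, pow_succ]
      field_simp
      ring
    rw [h', mul_pow]
    push_cast
    have hj : (0 : ℝ) ≤ j := Nat.cast_nonneg j
    have h3 : ((2 * (j : ℝ) + 1) / (2 * j + 2)) ^ 2 * (2 * (j + 1) + 1) ≤ 2 * j + 1 := by
      rw [div_pow, div_mul_eq_mul_div, div_le_iff₀ (by positivity)]
      nlinarith
    calc a ^ 2 * ((2 * (j : ℝ) + 1) / (2 * j + 2)) ^ 2 * (2 * (j + 1) + 1)
        = a ^ 2 * (((2 * (j : ℝ) + 1) / (2 * j + 2)) ^ 2 * (2 * (j + 1) + 1)) := by ring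
      _ ≤ a ^ 2 * (2 * j + 1) := mul_le_mul_of_nonneg_left h3 (sq_nonneg a)
      _ ≤ 1 := ih

theorem tendsto_centralBinom_div_four_pow :
    Tendsto (fun j : ℕ => (j.centralBinom : ℝ) / 4 ^ j) atTop (𝓝 0) := by
  have h : Tendsto (fun j : ℕ => Real.sqrt (1 / (2 * (j : ℝ) + 1))) atTop (𝓝 0) := by
    have h1 : Tendsto (fun j : ℕ => 1 / (2 * (j : ℝ) + 1)) atTop (𝓝 0) := by
      refine Tendsto.div_atTop tendsto_const_nhds ?_
      exact tendsto_atTop_add_const_right _ _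
        (tendsto_natCast_atTop_atTop.const_mul_atTop (by norm_num))
    simpa using h1.sqrt
  refine squeeze_zero (fun j => by positivity) (fun j => ?_) h
  refine Real.le_sqrt_of_sq_le ?_
  rw [le_div_iff₀ (by positivity)]
  exact centralBinom_sq_mul_le j

/-- A row of Pascal's triangle rises to its middle and then falls, so each half telescopes. The last
index `i = 2 * j` brings in a vanishing coefficient. -/
theorem sum_abs_choose_sub_le (j : ℕ) :
    ∑ i ∈ Finset.range (2 * j + 1),
      |((2 * j).choose (i + 1) : ℝ) - (2 * j).choose i| ≤ 2 * j.centralBinom := by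
  have hsplit : ∑ i ∈ Finset.range (2 * j + 1),
        |((2 * j).choose (i + 1) : ℝ) - (2 * j).choose i| =
      (∑ i ∈ Finset.range j, |((2 * j).choose (i + 1) : ℝ) - (2 * j).choose i|) +
      ∑ i ∈ Finset.range (j + 1),
        |((2 * j).choose (j + i + 1) : ℝ) - (2 * j).choose (j + i)| := by
    rw [show 2 * j + 1 = j + (j + 1) by ring, Finset.sum_range_add]
  rw [hsplit]
  have h1 : ∑ i ∈ Finset.range j, |((2 * j).choose (i + 1) : ℝ) - (2 * j).choose i| =
      ∑ i ∈ Finset.range j, (((2 * j).choose (i + 1) : ℝ) - (2 * j).choose i) := by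
    refine Finset.sum_congr rfl fun i hi => abs_of_nonneg ?_
    have hi := Finset.mem_range.1 hi
    have : (2 * j).choose i ≤ (2 * j).choose (i + 1) :=
      Nat.choose_le_succ_of_lt_half_left (by omega)
    exact sub_nonneg.2 (by exact_mod_cast this)
  have h2 : ∑ i ∈ Finset.range (j + 1),
        |((2 * j).choose (j + i + 1) : ℝ) - (2 * j).choose (j + i)| =
      ∑ i ∈ Finset.range (j + 1),
        (((2 * j).choose (j + i) : ℝ) - (2 * j).choose (j + (i + 1))) := by
    refine Finset.sum_congr rfl fun i hi => ?_
    have : (2 * j).choose (j + i + 1) ≤ (2 * j).choose (j + i) := by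
      have h := Nat.choose_succ_right_eq (2 * j) (j + i)
      refine Nat.le_of_mul_le_mul_right ?_ (Nat.succ_pos (j + i))
      rw [Nat.succ_eq_add_one, h]
      exact Nat.mul_le_mul_left _ (by omega)
    rw [abs_sub_comm, abs_of_nonneg (sub_nonneg.2 (by exact_mod_cast this)), ← add_assoc]
  have h4 := Finset.sum_range_sub' (fun i => ((2 * j).choose (j + i) : ℝ)) (j + 1)
  rw [h1, h2, Finset.sum_range_sub (fun i => ((2 * j).choose i : ℝ)), h4]
  simp only [Nat.choose_zero_right, Nat.cast_one, add_zero, Nat.centralBinom]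
  have : (0 : ℝ) ≤ ((2 * j).choose (j + (j + 1)) : ℝ) := Nat.cast_nonneg _
  linarith

variable {𝒜 : Type*} [NormedRing 𝒜] [NormedAlgebra ℝ 𝒜]

theorem norm_pow_le_one {𝒜 : Type*} [NormedRing 𝒜] {T : 𝒜} (h1 : ‖(1 : 𝒜)‖ ≤ 1)
    (hT : ‖T‖ ≤ 1) (k : ℕ) : ‖T ^ k‖ ≤ 1 := by
  induction k with
  | zero => simpa using h1
  | succ k ih =>
    rw [pow_succ]
    exact (norm_mul_le _ _).trans (mul_le_one₀ ih (norm_nonneg _) hT)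

/-- The average `(1 + T) / 2`. -/
def lazyAverage (T : 𝒜) : 𝒜 := (2⁻¹ : ℝ) • (1 + T)

theorem norm_lazyAverage_le {T : 𝒜} (h1 : ‖(1 : 𝒜)‖ ≤ 1) (hT : ‖T‖ ≤ 1) :
    ‖lazyAverage T‖ ≤ 1 := by
  rw [lazyAverage, norm_smul]
  have := (norm_add_le (1 : 𝒜) T).trans (add_le_add h1 hT)
  norm_num
  linarith

theorem commute_lazyAverage (T : 𝒜) : Commute (lazyAverage T) T :=
  ((Commute.one_left T).add_left (Commute.refl T)).smul_left _

/-- Multiplying the binomial expansion by `1 - T` differences its coefficients: the norm is governed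
by the variation of a row of Pascal's triangle instead of its sum `4 ^ j`. -/
theorem lazyAverage_pow_mul_sub (T : 𝒜) (j : ℕ) :
    lazyAverage T ^ (2 * j) * (1 - T) = ((4 : ℝ) ^ j)⁻¹ •
      (1 + ∑ i ∈ Finset.range (2 * j + 1),
        (((2 * j).choose (i + 1) : ℝ) - (2 * j).choose i) • T ^ (i + 1)) := by
  have e : lazyAverage T ^ (2 * j) = ((4 : ℝ) ^ j)⁻¹ •
      ∑ i ∈ Finset.range (2 * j + 1), ((2 * j).choose i : ℝ) • T ^ i := by
    rw [lazyAverage, smul_pow, add_comm, (Commute.one_right T).add_pow]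
    congr 1
    · rw [pow_mul, ← inv_pow]; norm_num
    · refine Finset.sum_congr rfl fun i _ => ?_
      rw [one_pow, mul_one, Nat.cast_smul_eq_nsmul, nsmul_eq_mul, Nat.cast_comm]
  rw [e, smul_mul_assoc, mul_sub, mul_one, Finset.sum_mul]
  congr 1
  have e2 : ∑ i ∈ Finset.range (2 * j + 1), ((2 * j).choose i : ℝ) • T ^ i =
      1 + ∑ i ∈ Finset.range (2 * j + 1), ((2 * j).choose (i + 1) : ℝ) • T ^ (i + 1) := by
    have h := Finset.sum_range_succ (fun i => ((2 * j).choose i : ℝ) • T ^ i) (2 * j + 1)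
    rw [Finset.sum_range_succ'] at h
    simp only [Nat.choose_succ_self, Nat.cast_zero, zero_smul, add_zero, Nat.choose_zero_right,
      Nat.cast_one, one_smul, pow_zero] at h
    rw [← h, add_comm]
  rw [e2, add_sub_assoc, ← Finset.sum_sub_distrib]
  congr 1
  refine Finset.sum_congr rfl fun i _ => ?_
  rw [sub_smul, smul_mul_assoc, pow_succ]

theorem norm_lazyAverage_pow_mul_sub_le {T : 𝒜} (h1 : ‖(1 : 𝒜)‖ ≤ 1) (hT : ‖T‖ ≤ 1) (j : ℕ) :
    ‖lazyAverage T ^ (2 * j) * (1 - T)‖ ≤ 3 * ((j.centralBinom : ℝ) / 4 ^ j) := by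
  rw [lazyAverage_pow_mul_sub, norm_smul, norm_inv, norm_pow]
  have h : ‖1 + ∑ i ∈ Finset.range (2 * j + 1),
      (((2 * j).choose (i + 1) : ℝ) - (2 * j).choose i) • T ^ (i + 1)‖ ≤
      3 * (j.centralBinom : ℝ) := by
    have hs : ‖∑ i ∈ Finset.range (2 * j + 1),
        (((2 * j).choose (i + 1) : ℝ) - (2 * j).choose i) • T ^ (i + 1)‖ ≤
        2 * (j.centralBinom : ℝ) := by
      refine (norm_sum_le _ _).trans (le_trans (Finset.sum_le_sum fun i _ => ?_)
        (sum_abs_choose_sub_le j))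
      rw [norm_smul, Real.norm_eq_abs]
      exact mul_le_of_le_one_right (abs_nonneg _) (norm_pow_le_one h1 hT _)
    have hc : (1 : ℝ) ≤ j.centralBinom := by
      exact_mod_cast Nat.one_le_iff_ne_zero.2 (Nat.centralBinom_ne_zero j)
    refine (norm_add_le _ _).trans ?_
    linarith
  have h4 : ‖(4 : ℝ)‖ = 4 := by norm_num
  rw [h4, mul_div_assoc', div_eq_inv_mul]
  exact mul_le_mul_of_nonneg_left h (by positivity)

/-- `R` plays the part common to `T ^ n` and `T ^ (n + 1)`. The remainder `U = T ^ (n + 1) - R *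
lazyAverage T` is the mean of `(T ^ n - R) * T` and `T ^ (n + 1) - R`, so its norm is at most `1 -
δ`. Iterating `T ^ (n + 1) = R * lazyAverage T + U`, only `U ^ j` is left without a factor
`lazyAverage T`. -/
theorem exists_pow_eq_mul_lazyAverage_add {T R : 𝒜} {δ : ℝ} {n : ℕ} (h1 : ‖(1 : 𝒜)‖ ≤ 1)
    (hT : ‖T‖ ≤ 1) (hR : ‖R‖ ≤ δ) (hn : ‖T ^ n - R‖ ≤ 1 - δ) (hn' : ‖T ^ (n + 1) - R‖ ≤ 1 - δ)
    (j : ℕ) : ∃ V W : 𝒜, T ^ ((n + 1) * j) = V * lazyAverage T + W ∧ ‖V‖ ≤ 1 ∧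
      ‖W‖ ≤ (1 - δ) ^ j := by
  have hδ : 0 ≤ 1 - δ := (norm_nonneg _).trans hn
  set U : 𝒜 := T ^ (n + 1) - R * lazyAverage T with hU
  have hUn : ‖U‖ ≤ 1 - δ := by
    have e : U = (2⁻¹ : ℝ) • ((T ^ n - R) * T + (T ^ (n + 1) - R)) := by
      have e0 : T ^ (n + 1) = (2⁻¹ : ℝ) • (T ^ (n + 1) + T ^ (n + 1)) := by
        rw [← two_smul ℝ, smul_smul]; norm_num
      rw [hU, lazyAverage, mul_smul_comm, mul_add, mul_one]
      nth_rewrite 1 [e0]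
      rw [← smul_sub, sub_mul, ← pow_succ]
      congr 1
      abel
    rw [e, norm_smul]
    have : ‖(T ^ n - R) * T + (T ^ (n + 1) - R)‖ ≤ (1 - δ) + (1 - δ) :=
      (norm_add_le _ _).trans (add_le_add ((norm_mul_le _ _).trans
        ((mul_le_of_le_one_right (norm_nonneg _) hT).trans hn)) hn')
    norm_num
    linarith
  induction j with
  | zero => exact ⟨0, 1, by simp, by simp, by simpa using h1⟩
  | succ j ih =>
    obtain ⟨V, W, hVW, hV, hW⟩ := ih
    refine ⟨R * T ^ ((n + 1) * j) + U * V, U * W, ?_, ?_, ?_⟩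
    · have hc : lazyAverage T * T ^ ((n + 1) * j) = T ^ ((n + 1) * j) * lazyAverage T :=
        (commute_lazyAverage T).pow_right _
      have e : T ^ (n + 1) = R * lazyAverage T + U := by rw [hU]; abel
      calc T ^ ((n + 1) * (j + 1)) = T ^ (n + 1) * T ^ ((n + 1) * j) := by
            rw [← pow_add]; ring_nf
        _ = R * (lazyAverage T * T ^ ((n + 1) * j)) + U * T ^ ((n + 1) * j) := by
            rw [e, add_mul, mul_assoc]
        _ = R * (T ^ ((n + 1) * j) * lazyAverage T) + U * (V * lazyAverage T + W) := by
            rw [hc, ← hVW]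
        _ = (R * T ^ ((n + 1) * j) + U * V) * lazyAverage T + U * W := by noncomm_ring
    · have ha : ‖R * T ^ ((n + 1) * j)‖ ≤ δ := (norm_mul_le _ _).trans
        ((mul_le_of_le_one_right (norm_nonneg _) (norm_pow_le_one h1 hT _)).trans hR)
      have hb : ‖U * V‖ ≤ 1 - δ := (norm_mul_le _ _).trans
        ((mul_le_of_le_one_right (norm_nonneg _) hV).trans hUn)
      refine (norm_add_le _ _).trans ?_
      linarith
    · rw [pow_succ, mul_comm]
      exact (norm_mul_le _ _).trans (mul_le_mul hUn hW (norm_nonneg _) hδ)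

/-- Each block `T ^ M` supplies one more factor `lazyAverage T` at the price of an error `w`; the
errors add up because all other factors have norm at most one. -/
theorem exists_pow_eq_mul_lazyAverage_pow_add {T V W : 𝒜} {w : ℝ} {M : ℕ} (h1 : ‖(1 : 𝒜)‖ ≤ 1)
    (hT : ‖T‖ ≤ 1) (h : T ^ M = V * lazyAverage T + W) (hV : ‖V‖ ≤ 1) (hW : ‖W‖ ≤ w) (k : ℕ) :
    ∃ V' W' : 𝒜, T ^ (M * k) = V' * lazyAverage T ^ k + W' ∧ ‖V'‖ ≤ 1 ∧ ‖W'‖ ≤ k * w := by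
  induction k with
  | zero => exact ⟨1, 0, by simp, h1, by simp⟩
  | succ k ih =>
    obtain ⟨V', W', h', hV', hW'⟩ := ih
    refine ⟨V * V', V * W' * lazyAverage T + W * T ^ (M * k), ?_, ?_, ?_⟩
    · have hc : lazyAverage T * T ^ (M * k) = T ^ (M * k) * lazyAverage T :=
        (commute_lazyAverage T).pow_right _
      calc T ^ (M * (k + 1)) = T ^ M * T ^ (M * k) := by rw [← pow_add]; ring_nf
        _ = V * (lazyAverage T * T ^ (M * k)) + W * T ^ (M * k) := by
            rw [h, add_mul, mul_assoc]
        _ = V * ((V' * lazyAverage T ^ k + W') * lazyAverage T) + W * T ^ (M * k) := by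
            rw [hc, ← h']
        _ = _ := by rw [pow_succ]; noncomm_ring
    · exact (norm_mul_le _ _).trans (mul_le_one₀ hV (norm_nonneg _) hV')
    · have ha : ‖V * W' * lazyAverage T‖ ≤ k * w := (norm_mul_le _ _).trans
        ((mul_le_of_le_one_right (norm_nonneg _) (norm_lazyAverage_le h1 hT)).trans
          ((norm_mul_le _ _).trans ((mul_le_of_le_one_left (norm_nonneg _) hV).trans hW')))
      have hb : ‖W * T ^ (M * k)‖ ≤ w := (norm_mul_le _ _).trans
        ((mul_le_of_le_one_right (norm_nonneg _) (norm_pow_le_one h1 hT _)).trans hW)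
      refine (norm_add_le _ _).trans ?_
      push_cast
      linarith

/-- The zero-two law in a normed algebra. -/
theorem exists_norm_pow_sub_pow_lt {T R : 𝒜} {δ : ℝ} {n : ℕ} (h1 : ‖(1 : 𝒜)‖ ≤ 1)
    (hT : ‖T‖ ≤ 1) (hδ : 0 < δ) (hR : ‖R‖ ≤ δ) (hn : ‖T ^ n - R‖ ≤ 1 - δ)
    (hn' : ‖T ^ (n + 1) - R‖ ≤ 1 - δ) {ε : ℝ} (hε : 0 < ε) :
    ∃ N : ℕ, ‖T ^ N - T ^ (N + 1)‖ < ε := by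
  have hδ1 : 0 ≤ 1 - δ := (norm_nonneg _).trans hn
  have hC : Tendsto (fun j : ℕ => 3 * ((j.centralBinom : ℝ) / 4 ^ j)) atTop (𝓝 0) := by
    simpa using tendsto_centralBinom_div_four_pow.const_mul 3
  -- First `k` makes `lazyAverage T ^ (2 * k) * (1 - T)` small; then `j`, depending on `k`, makes
  -- the accumulated error `2 * k * (1 - δ) ^ j` small, the last factor `2` bounding `‖1 - T‖`.
  obtain ⟨k, hk⟩ := (hC.eventually_lt_const (half_pos hε)).exists
  have hD : Tendsto (fun j : ℕ => ((2 * k : ℕ) : ℝ) * (1 - δ) ^ j * 2) atTop (𝓝 0) := by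
    have h := tendsto_pow_atTop_nhds_zero_of_lt_one hδ1 (by linarith : 1 - δ < 1)
    simpa using (h.const_mul ((2 * k : ℕ) : ℝ)).mul_const 2
  obtain ⟨j, hj⟩ := (hD.eventually_lt_const (half_pos hε)).exists
  obtain ⟨V, W, hVW, hV, hW⟩ := exists_pow_eq_mul_lazyAverage_add h1 hT hR hn hn' j
  obtain ⟨V', W', h', hV', hW'⟩ := exists_pow_eq_mul_lazyAverage_pow_add h1 hT hVW hV hW (2 * k)
  refine ⟨(n + 1) * j * (2 * k), ?_⟩
  have e : T ^ ((n + 1) * j * (2 * k)) - T ^ ((n + 1) * j * (2 * k) + 1) =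
      V' * (lazyAverage T ^ (2 * k) * (1 - T)) + W' * (1 - T) := by
    rw [pow_succ, h']
    noncomm_ring
  have h2 : ‖(1 : 𝒜) - T‖ ≤ 2 := (norm_sub_le _ _).trans (by linarith)
  have ha : ‖V' * (lazyAverage T ^ (2 * k) * (1 - T))‖ < ε / 2 := (norm_mul_le _ _).trans_lt
    ((mul_le_of_le_one_left (norm_nonneg _) hV').trans_lt
      ((norm_lazyAverage_pow_mul_sub_le h1 hT k).trans_lt hk))
  have hb : ‖W' * (1 - T)‖ < ε / 2 := (norm_mul_le _ _).trans_lt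
    ((mul_le_mul hW' h2 (norm_nonneg _) (by positivity)).trans_lt hj)
  rw [e]
  refine (norm_add_le _ _).trans_lt ?_
  linarith

end ZeroTwoRing

/-! ### Convolution operators on bounded measurable functions -/

section ConvolutionOperator

variable (G : Type*) [MeasurableSpace G]

/-- The bounded measurable functions as a subspace of `ℓ^∞`. -/
def boundedMeasurableSubmodule : Submodule ℝ (lp (fun _ : G => ℝ) ∞) where
  carrier := {f | Measurable (f : G → ℝ)}
  add_mem' {f g} hf hg := by
    have h : ((f + g : lp (fun _ : G => ℝ) ∞) : G → ℝ) = fun a => f a + g a := by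
      funext a; simp
    rw [Set.mem_ofPred_eq, h]
    exact Measurable.add hf hg
  zero_mem' := by
    have h : ((0 : lp (fun _ : G => ℝ) ∞) : G → ℝ) = fun _ => 0 := by funext a; simp
    rw [Set.mem_ofPred_eq, h]
    exact measurable_const
  smul_mem' c f hf := by
    have h : ((c • f : lp (fun _ : G => ℝ) ∞) : G → ℝ) = fun a => c * f a := by
      funext a; simp
    rw [Set.mem_ofPred_eq, h]
    exact Measurable.const_mul hf c

/-- The space of bounded measurable functions with the supremum norm. -/
def boundedMeasurable : Type _ := boundedMeasurableSubmodule G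

instance : NormedAddCommGroup (boundedMeasurable G) :=
  inferInstanceAs (NormedAddCommGroup (boundedMeasurableSubmodule G))

instance : NormedSpace ℝ (boundedMeasurable G) :=
  inferInstanceAs (NormedSpace ℝ (boundedMeasurableSubmodule G))

variable {G}

namespace boundedMeasurable

/-- The function underlying an element of `boundedMeasurable G`. -/
def toFun (f : boundedMeasurable G) : G → ℝ := f.1.1

theorem measurable (f : boundedMeasurable G) : Measurable (toFun f) := f.2

theorem norm_toFun_le (f : boundedMeasurable G) (g : G) : ‖toFun f g‖ ≤ ‖f‖ :=
  lp.norm_apply_le_norm (by simp) f.1 g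

/-- A bounded measurable function as an element of `boundedMeasurable G`. -/
def mk (u : G → ℝ) (hu : Measurable u) (C : ℝ) (hC : ∀ g, ‖u g‖ ≤ C) : boundedMeasurable G :=
  Subtype.mk (p := fun f => f ∈ boundedMeasurableSubmodule G)
    ⟨u, memℓp_infty ⟨C, by rintro _ ⟨g, rfl⟩; exact hC g⟩⟩ hu

theorem toFun_mk (u : G → ℝ) (hu : Measurable u) (C : ℝ) (hC : ∀ g, ‖u g‖ ≤ C) :
    toFun (mk u hu C hC) = u := rfl

theorem toFun_injective : Function.Injective (toFun : boundedMeasurable G → G → ℝ) :=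
  fun _ _ h => Subtype.ext (lp.ext h)

theorem toFun_add (f f' : boundedMeasurable G) (g : G) :
    toFun (f + f') g = toFun f g + toFun f' g := rfl

theorem toFun_smul (c : ℝ) (f : boundedMeasurable G) (g : G) :
    toFun (c • f) g = c * toFun f g := rfl

theorem norm_le {f : boundedMeasurable G} {C : ℝ} (hC : 0 ≤ C) (h : ∀ g, ‖toFun f g‖ ≤ C) :
    ‖f‖ ≤ C := lp.norm_le_of_forall_le hC h

variable [Group G] [MeasurableMul G]

theorem integrable_mul (m : Measure G) [IsFiniteMeasure m] (f : boundedMeasurable G) (g : G) :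
    Integrable (fun h => toFun f (g * h)) m :=
  Integrable.of_bound ((measurable f).comp (measurable_const_mul g)).aestronglyMeasurable ‖f‖
    (Eventually.of_forall fun _ => norm_toFun_le f _)

theorem norm_integral_le {G : Type*} [MeasurableSpace G] [Group G] (m : Measure G)
    [IsFiniteMeasure m] (f : boundedMeasurable G) (g : G) :
    ‖∫ h, toFun f (g * h) ∂m‖ ≤ m.real Set.univ * ‖f‖ := by
  rw [mul_comm]
  exact norm_integral_le_of_norm_le_const (Eventually.of_forall fun _ => norm_toFun_le f _)

end boundedMeasurable

open boundedMeasurable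

variable [Group G] [MeasurableMul₂ G]

/-- The operator `f ↦ (g ↦ ∫ f (g h) dm(h))` on bounded measurable functions. -/
def convOperator (m : Measure G) [IsFiniteMeasure m] :
    boundedMeasurable G →L[ℝ] boundedMeasurable G :=
  LinearMap.mkContinuous
    { toFun := fun f => boundedMeasurable.mk (fun g => ∫ h, boundedMeasurable.toFun f (g * h) ∂m)
        (((boundedMeasurable.measurable f).comp measurable_mul).stronglyMeasurable.integral_prod_right'
          (f := fun p : G × G => boundedMeasurable.toFun f (p.1 * p.2))).measurable
        (m.real Set.univ * ‖f‖) (norm_integral_le m f)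
      map_add' := fun f f' => by
        refine toFun_injective (funext fun g => ?_)
        simp only [toFun_add, toFun_mk]
        exact integral_add (integrable_mul m f g) (integrable_mul m f' g)
      map_smul' := fun c f => by
        refine toFun_injective (funext fun g => ?_)
        simp only [toFun_smul, toFun_mk, RingHom.id_apply]
        exact integral_const_mul c _ }
    (m.real Set.univ)
    (fun f => boundedMeasurable.norm_le (by positivity) (norm_integral_le m f))

theorem convOperator_apply (m : Measure G) [IsFiniteMeasure m] (f : boundedMeasurable G) (g : G) :
    boundedMeasurable.toFun (convOperator m f) g = ∫ h, boundedMeasurable.toFun f (g * h) ∂m := rfl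

theorem norm_convOperator_le (m : Measure G) [IsFiniteMeasure m] :
    ‖convOperator m‖ ≤ m.real Set.univ :=
  LinearMap.mkContinuous_norm_le _ measureReal_nonneg _

theorem convOperator_add (m m' : Measure G) [IsFiniteMeasure m] [IsFiniteMeasure m'] :
    convOperator (m + m') = convOperator m + convOperator m' := by
  refine ContinuousLinearMap.ext fun f => toFun_injective (funext fun g => ?_)
  rw [add_apply, toFun_add]
  simp only [convOperator_apply]
  exact integral_add_measure (integrable_mul m f g) (integrable_mul m' f g)

theorem convOperator_mconv (m m' : Measure G) [IsFiniteMeasure m] [IsFiniteMeasure m'] :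
    convOperator (m.mconv m') = convOperator m * convOperator m' := by
  refine ContinuousLinearMap.ext fun f => toFun_injective (funext fun g => ?_)
  change _ = boundedMeasurable.toFun (convOperator m (convOperator m' f)) g
  simp only [convOperator_apply]
  rw [integral_mconv (integrable_mul _ f g)]
  simp only [mul_assoc]

theorem convOperator_dirac_one : convOperator (Measure.dirac (1 : G)) = 1 := by
  refine ContinuousLinearMap.ext fun f => toFun_injective (funext fun g => ?_)
  have h : StronglyMeasurable fun h => toFun f (g * h) :=
    ((boundedMeasurable.measurable f).comp (measurable_const_mul g)).stronglyMeasurable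
  rw [convOperator_apply, integral_dirac' _ _ h]
  simp

end ConvolutionOperator

/-! ### From total variation distance to the zero-two law -/

section ZeroTwo

variable {G : Type*} [Group G] [TopologicalSpace G] [IsTopologicalGroup G]
  [SecondCountableTopology G] [MeasurableSpace G] [BorelSpace G]

instance isProbabilityMeasure_convPow (μ : Measure G) [IsProbabilityMeasure μ] :
    (n : ℕ) → IsProbabilityMeasure (convPow μ n)
  | 0 => by rw [convPow]; infer_instance
  | n + 1 => by
    have := isProbabilityMeasure_convPow μ n
    rw [convPow]; infer_instance

theorem convOperator_convPow (μ : Measure G) [IsProbabilityMeasure μ] (n : ℕ) :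
    convOperator (convPow μ n) = convOperator μ ^ n := by
  induction n with
  | zero => simpa [convPow] using convOperator_dirac_one
  | succ n ih =>
    have h : convOperator (convPow μ (n + 1)) = convOperator ((convPow μ n).mconv μ) := rfl
    rw [h, convOperator_mconv, ih, pow_succ]

theorem bddAbove_dTV {G : Type*} [MeasurableSpace G] (α β : Measure G) [IsProbabilityMeasure α] [IsProbabilityMeasure β] :
    BddAbove (Set.range fun A : {A : Set G // MeasurableSet A} => |α.real A - β.real A|) := by
  refine ⟨1, ?_⟩
  rintro _ ⟨A, rfl⟩
  have h1 := measureReal_nonneg (μ := α) (s := (A : Set G))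
  have h2 := measureReal_nonneg (μ := β) (s := (A : Set G))
  have h3 := measureReal_le_one (μ := α) (s := (A : Set G))
  have h4 := measureReal_le_one (μ := β) (s := (A : Set G))
  exact abs_le.2 ⟨by linarith, by linarith⟩

/-- The witness is the meet of the two measures: `α` on the Hahn set where `α ≤ β`, and `β` off it.
The mass it misses is `β s - α s`. -/
theorem exists_le_le_one_sub_dTV_le {G : Type*} [MeasurableSpace G] (α β : Measure G) [IsProbabilityMeasure α]
    [IsProbabilityMeasure β] :
    ∃ ρ : Measure G, ρ ≤ α ∧ ρ ≤ β ∧ 1 - dTV α β ≤ ρ.real Set.univ := by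
  obtain ⟨s, hs⟩ := exists_isHahnDecomposition α β
  refine ⟨α.restrict s + β.restrict sᶜ, ?_, ?_, ?_⟩
  · conv_rhs => rw [← Measure.restrict_add_restrict_compl (μ := α) hs.measurableSet]
    exact add_le_add le_rfl hs.ge_on_compl
  · conv_rhs => rw [← Measure.restrict_add_restrict_compl (μ := β) hs.measurableSet]
    exact add_le_add hs.le_on le_rfl
  · have h := le_ciSup (bddAbove_dTV α β) ⟨s, hs.measurableSet⟩
    have h' : |α.real s - β.real s| ≤ dTV α β := h
    rw [measureReal_add_apply, measureReal_restrict_apply_univ, measureReal_restrict_apply_univ,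
      probReal_compl_eq_one_sub hs.measurableSet]
    have := neg_abs_le (α.real s - β.real s)
    linarith

theorem norm_convOperator_sub_le {α ρ : Measure G} [IsProbabilityMeasure α] [IsFiniteMeasure ρ]
    (h : ρ ≤ α) : ‖convOperator α - convOperator ρ‖ ≤ 1 - ρ.real Set.univ := by
  have : IsFiniteMeasure (α - ρ) := isFiniteMeasure_of_le α Measure.sub_le
  have e : convOperator α = convOperator (α - ρ) + convOperator ρ := by
    rw [← convOperator_add]
    simp only [Measure.sub_add_cancel_of_le h]
  have e2 : (α - ρ).real Set.univ = 1 - ρ.real Set.univ := by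
    have h3 : (α - ρ + ρ).real Set.univ = 1 := by rw [Measure.sub_add_cancel_of_le h]; simp
    rw [measureReal_add_apply] at h3
    linarith
  rw [e, add_sub_cancel_right, ← e2]
  exact norm_convOperator_le _

/-- The zero-two law for convolution powers. -/
theorem TailAssumption.exists_abs_integral_sub_le {μ : Measure G} [IsProbabilityMeasure μ]
    (hT : TailAssumption μ) {ε : ℝ} (hε : 0 < ε) :
    ∃ N : ℕ, ∀ u : G → ℝ, Measurable u → (∀ g, ‖u g‖ ≤ 1) →
      |∫ g, u g ∂(convPow μ N) - ∫ g, u g ∂(convPow μ (N + 1))| ≤ ε := by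
  obtain ⟨n, ε', hε', h⟩ := hT
  obtain ⟨ρ, hρ, hρ', hd⟩ := exists_le_le_one_sub_dTV_le (convPow μ n) (convPow μ (n + 1))
  have : IsFiniteMeasure ρ := isFiniteMeasure_of_le _ hρ
  have h1 := norm_convOperator_sub_le hρ
  have h2 := norm_convOperator_sub_le hρ'
  rw [convOperator_convPow] at h1 h2
  have hT1 : ‖convOperator μ‖ ≤ 1 := by simpa using norm_convOperator_le μ
  -- Here `T` is convolution by `μ`, `R` is convolution by the common part `ρ` of two consecutive
  -- powers, and `δ` is the mass of `ρ`, positive by (T).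
  obtain ⟨N, hN⟩ := exists_norm_pow_sub_pow_lt (ContinuousLinearMap.norm_id_le)
    hT1 (by linarith) (norm_convOperator_le ρ) h1 h2 hε
  refine ⟨N, fun u hu hu1 => ?_⟩
  set f := boundedMeasurable.mk u hu 1 hu1 with hf
  have hfn : ‖f‖ ≤ 1 := boundedMeasurable.norm_le zero_le_one hu1
  -- Evaluating the operators at the identity of `G` recovers the integrals against the convolution
  -- powers.
  have h3 := boundedMeasurable.norm_toFun_le ((convOperator μ ^ N - convOperator μ ^ (N + 1)) f) 1
  have h4 : boundedMeasurable.toFun ((convOperator μ ^ N - convOperator μ ^ (N + 1)) f) 1 =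
      ∫ g, u g ∂(convPow μ N) - ∫ g, u g ∂(convPow μ (N + 1)) := by
    rw [← convOperator_convPow, ← convOperator_convPow, sub_eq_add_neg,
      add_apply, boundedMeasurable.toFun_add, neg_apply,
      ← neg_one_smul ℝ, boundedMeasurable.toFun_smul]
    simp only [convOperator_apply, one_mul, hf, boundedMeasurable.toFun_mk]
    ring
  rw [h4] at h3
  refine h3.trans ((ContinuousLinearMap.le_opNorm _ _).trans ?_)
  exact (mul_le_mul hN.le hfn (norm_nonneg _) hε.le).trans (by rw [mul_one])

end ZeroTwo

/-! ### Decreasing sequences of conditional expectations -/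

section Reverse

theorem exists_countable_isPiSystem (B : Type*) [mB : MeasurableSpace B]
    [MeasurableSpace.CountablyGenerated B] :
    ∃ C : Set (Set B), C.Countable ∧ IsPiSystem C ∧ mB = MeasurableSpace.generateFrom C := by
  let s : ℕ → Set B := MeasurableSpace.natGeneratingSequence B
  have hs : mB = MeasurableSpace.generateFrom (Set.range s) :=
    (MeasurableSpace.generateFrom_natGeneratingSequence B).symm
  refine ⟨Set.range fun t : Finset ℕ => ⋂ i ∈ t, s i, Set.countable_range _, ?_, ?_⟩
  · rintro _ ⟨t, rfl⟩ _ ⟨t', rfl⟩ _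
    classical
    refine ⟨t ∪ t', ?_⟩
    ext b
    simp only [Finset.mem_union, Set.mem_iInter, Set.mem_inter_iff]
    exact ⟨fun h => ⟨fun i hi => h i (Or.inl hi), fun i hi => h i (Or.inr hi)⟩,
      fun h i hi => hi.elim (h.1 i) (h.2 i)⟩
  · refine le_antisymm ?_ ?_
    · rw [hs]
      refine MeasurableSpace.generateFrom_mono ?_
      rintro _ ⟨i, rfl⟩
      exact ⟨{i}, by simp⟩
    · refine MeasurableSpace.generateFrom_le ?_
      rintro _ ⟨t, rfl⟩
      refine Finset.measurableSet_biInter t fun i _ => ?_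
      exact MeasurableSpace.measurableSet_natGeneratingSequence i

variable {Ω : Type*} {m0 : MeasurableSpace Ω}

/-- Dropping finitely many terms does not change a limsup, so the limsup along the subsequence is
measurable for every `m n`. -/
theorem aestronglyMeasurable_iInf_of_tendsto {P : Measure Ω} {m : ℕ → MeasurableSpace Ω}
    (hanti : Antitone m) {F : ℕ → Ω → ℝ} (hF : ∀ n, StronglyMeasurable[m n] (F n)) {g : Ω → ℝ}
    {ns : ℕ → ℕ} (hns : StrictMono ns)
    (h : ∀ᵐ ω ∂P, Tendsto (fun k => F (ns k) ω) atTop (𝓝 (g ω))) :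
    AEStronglyMeasurable[⨅ n, m n] g P := by
  let g' : Ω → ℝ := fun ω => limsup (fun k => F (ns k) ω) atTop
  have hg' : ∀ n, Measurable[m n] g' := by
    intro n
    have e : g' = fun ω => limsup (fun k => F (ns (k + n)) ω) atTop := by
      funext ω
      exact (limsup_nat_add (fun k => F (ns k) ω) n).symm
    rw [e]
    refine Measurable.limsup fun k => ?_
    refine (hF (ns (k + n))).measurable.mono (hanti ?_) le_rfl
    exact (Nat.le_add_left n k).trans (hns.id_le _)
  have hg'' : Measurable[⨅ n, m n] g' := fun s hs =>
    MeasurableSpace.measurableSet_iInf.2 fun n => hg' n hs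
  refine ⟨g', hg''.stronglyMeasurable, ?_⟩
  filter_upwards [h] with ω hω
  exact hω.limsup_eq.symm

variable {P : Measure Ω} [IsFiniteMeasure P]

/-- On `L²` the conditional expectations are orthogonal projections onto decreasing subspaces. The
orthogonal complements increase, so the projections onto them converge strongly, and subtracting
from `f` gives the limit. -/
theorem exists_tendsto_eLpNorm_condExp {m : ℕ → MeasurableSpace Ω} (hm : ∀ n, m n ≤ m0)
    (hanti : Antitone m) {f : Ω → ℝ} (hf : MemLp f 2 P) :
    ∃ g : Ω → ℝ, MemLp g 2 P ∧ Tendsto (fun n => eLpNorm (P[f|m n] - g) 2 P) atTop (𝓝 0) := by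
  have hfact : ∀ n, Fact (m n ≤ m0) := fun n => ⟨hm n⟩
  let U : ℕ → Submodule ℝ (Lp ℝ 2 P) := fun n => (lpMeas ℝ ℝ (m n) 2 P)ᗮ
  have hU : Monotone U := fun i j hij => Submodule.orthogonal_le fun F hF =>
    AEStronglyMeasurable.mono (hanti hij) hF
  let F : Lp ℝ 2 P := hf.toLp
  have h := Submodule.starProjection_tendsto_closure_iSup U hU F
  set y := (⨆ i, U i).topologicalClosure.starProjection F
  refine ⟨(F - y : Lp ℝ 2 P), Lp.memLp _, ?_⟩
  have h2 : Tendsto (fun n => (condExpL2 ℝ ℝ (hm n) F : Lp ℝ 2 P)) atTop (𝓝 (F - y)) := by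
    refine (tendsto_const_nhds.sub h).congr fun n => ?_
    have e := congrArg (fun A => A F) (Submodule.starProjection_orthogonal' (lpMeas ℝ ℝ (m n) 2 P))
    change (U n).starProjection F = F - (lpMeas ℝ ℝ (m n) 2 P).starProjection F at e
    rw [e, sub_sub_cancel]
    rfl
  rw [Lp.tendsto_Lp_iff_tendsto_eLpNorm'] at h2
  refine h2.congr fun n => eLpNorm_congr_ae ?_
  exact (hf.condExpL2_ae_eq_condExp (𝕜 := ℝ) (hm n)).sub EventuallyEq.rfl

/-- Lévy's downward theorem, in `L¹`, for square integrable functions. -/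
theorem tendsto_eLpNorm_condExp_iInf {m : ℕ → MeasurableSpace Ω} (hm : ∀ n, m n ≤ m0)
    (hanti : Antitone m) {f : Ω → ℝ} (hf : MemLp f 2 P) :
    Tendsto (fun n => eLpNorm (P[f|m n] - P[f|⨅ n, m n]) 1 P) atTop (𝓝 0) := by
  obtain ⟨g, hg, h2⟩ := exists_tendsto_eLpNorm_condExp hm hanti hf
  have hle : ⨅ n, m n ≤ m0 := (iInf_le m 0).trans (hm 0)
  have hF : ∀ n, StronglyMeasurable[m n] (P[f|m n]) := fun n => stronglyMeasurable_condExp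
  have hF' : ∀ n, AEStronglyMeasurable (P[f|m n]) P := fun n =>
    ((hF n).mono (hm n)).aestronglyMeasurable
  have hfi : Integrable f P := hf.integrable (by norm_num)
  have hgi : Integrable g P := hg.integrable (by norm_num)
  have h1 : Tendsto (fun n => eLpNorm (P[f|m n] - g) 1 P) atTop (𝓝 0) := by
    have hC : Tendsto (fun n => eLpNorm (P[f|m n] - g) 2 P *
        P Set.univ ^ (1 / (1 : ℝ≥0∞).toReal - 1 / (2 : ℝ≥0∞).toReal)) atTop (𝓝 0) := by
      have := ENNReal.Tendsto.mul_const (b := P Set.univ ^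
        (1 / (1 : ℝ≥0∞).toReal - 1 / (2 : ℝ≥0∞).toReal)) h2 (Or.inr ?_)
      · simpa using this
      · exact ENNReal.rpow_ne_top_of_nonneg (by norm_num) (measure_ne_top _ _)
    refine tendsto_of_tendsto_of_tendsto_of_le_of_le tendsto_const_nhds hC (fun _ => zero_le)
      fun n => eLpNorm_le_eLpNorm_mul_rpow_measure_univ (by norm_num)
        ((hF' n).sub hg.aestronglyMeasurable)
  -- Over a set lying in every `m n` the integral of the limit is that of `f`, and an almost
  -- everywhere convergent subsequence makes the limit measurable for the intersection.
  have hae : g =ᵐ[P] P[f|⨅ n, m n] := by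
    refine ae_eq_condExp_of_forall_setIntegral_eq hle hfi (fun _ _ _ => hgi.integrableOn)
      (fun s hs _ => ?_) ?_
    · have ht := tendsto_setIntegral_of_L1' (μ := P) g hgi.aestronglyMeasurable (F := fun n => P[f|m n]) (l := atTop)
        (Eventually.of_forall fun _ => integrable_condExp) h1 s
      refine tendsto_nhds_unique ht (tendsto_const_nhds.congr fun n => ?_)
      exact (setIntegral_condExp (hm n) hfi (MeasurableSpace.measurableSet_iInf.1 hs n)).symm
    · obtain ⟨ns, hns, h⟩ := (tendstoInMeasure_of_tendsto_eLpNorm (by norm_num) hF'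
        hg.aestronglyMeasurable h2).exists_seq_tendsto_ae
      exact aestronglyMeasurable_iInf_of_tendsto hanti hF hns h
  exact h1.congr fun n => eLpNorm_congr_ae (EventuallyEq.rfl.sub hae)

end Reverse

/-! ### Conditional expectations on the fibers of a disintegration -/

section Fibers

variable {X Ω S B : Type*} [MeasurableSpace X] [MeasurableSpace Ω] [MeasurableSpace S]
  [MeasurableSpace B] [StandardBorelSpace B] [Nonempty B] [MeasurableSpace.CountablyGenerated S]

/-- `C` remembers the base point through `p`, so a conditional law given `C` on the total space,
read over one `x`, is a conditional law there. Both fibre joint laws have the same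
composition-product with `η`, hence agree for almost every `x`. -/
theorem condDistrib_fiber_ae_eq (η : Measure X) [IsProbabilityMeasure η] (κ : Kernel X Ω)
    [IsMarkovKernel κ] {C : X × Ω → S} (hC : Measurable C) {p : S → X} (hp : Measurable p)
    (hpC : ∀ q, p (C q) = q.1) {Y : Ω → B} (hY : Measurable Y) :
    ∀ᵐ x ∂η, condDistrib Y (fun ω => C (x, ω)) (κ x) =ᵐ[(κ x).map fun ω => C (x, ω)]
      condDistrib (fun q => Y q.2) C (η ⊗ₘ κ) := by
  set cd := condDistrib (fun q => Y q.2) C (η ⊗ₘ κ) with hcd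
  have hY' : Measurable fun q : X × Ω => Y q.2 := hY.comp measurable_snd
  let k0 : Kernel X (X × Ω) := Kernel.id ×ₖ κ
  have hk0 : ∀ x, k0 x = (κ x).map (Prod.mk x) := by
    intro x
    simp only [k0, Kernel.prod_apply, Kernel.id_apply]
    exact Measure.dirac_prod x
  let k1 : Kernel X (S × B) := k0.map fun q => (C q, Y q.2)
  let k2 : Kernel X (S × B) := (k0.map C) ⊗ₖ (Kernel.prodMkLeft X cd)
  have hm1 : Measurable fun q : X × Ω => (C q, Y q.2) := hC.prodMk hY'
  have hk1 : ∀ x, k1 x = (κ x).map fun ω => (C (x, ω), Y ω) := by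
    intro x
    rw [Kernel.map_apply _ hm1, hk0, Measure.map_map hm1 measurable_prodMk_left]
    rfl
  have hk0C : ∀ x, (k0.map C) x = (κ x).map fun ω => C (x, ω) := by
    intro x
    rw [Kernel.map_apply _ hC, hk0, Measure.map_map hC measurable_prodMk_left]
    rfl
  have hk2 : ∀ x, k2 x = ((κ x).map fun ω => C (x, ω)) ⊗ₘ cd := by
    intro x
    rw [← hk0C]
    ext s hs
    rw [Kernel.compProd_apply hs, Measure.compProd_apply hs]
    rfl
  have key : η ⊗ₘ k1 = η ⊗ₘ k2 := by
    have hbase := compProd_map_condDistrib (μ := η ⊗ₘ κ) (mβ := ‹_›) (X := C)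
      hY'.aemeasurable
    ext s hs
    let e : S × B → X × (S × B) := fun q => (p q.1, q)
    have he : Measurable e := (hp.comp measurable_fst).prodMk measurable_id
    have h3 := congrArg (fun ρ => ρ (e ⁻¹' s)) hbase
    rw [Measure.compProd_apply (he hs), Measure.map_apply hm1 (he hs),
      Measure.compProd_apply (hm1 (he hs)), lintegral_map
        (Kernel.measurable_kernel_prodMk_left (he hs)) hC, ← hcd, Measure.lintegral_compProd
        (f := fun q => cd (C q) (Prod.mk (C q) ⁻¹' (e ⁻¹' s)))
        ((Kernel.measurable_kernel_prodMk_left (he hs)).comp hC)] at h3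
    rw [Measure.compProd_apply hs, Measure.compProd_apply hs]
    have hl : ∀ x, k1 x (Prod.mk x ⁻¹' s) =
        κ x (Prod.mk x ⁻¹' ((fun q : X × Ω => (C q, Y q.2)) ⁻¹' (e ⁻¹' s))) := by
      intro x
      have hm : Measurable fun ω => (C (x, ω), Y ω) := hm1.comp measurable_prodMk_left
      rw [hk1, Measure.map_apply hm (measurable_prodMk_left hs)]
      congr 1
      ext ω
      simp [e, hpC]
    have hr : ∀ x, k2 x (Prod.mk x ⁻¹' s) =
        ∫⁻ ω, cd (C (x, ω)) (Prod.mk (C (x, ω)) ⁻¹' (e ⁻¹' s)) ∂κ x := by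
      intro x
      have hm : Measurable fun ω => C (x, ω) := hC.comp measurable_prodMk_left
      rw [hk2, Measure.compProd_apply (measurable_prodMk_left hs), lintegral_map
        (Kernel.measurable_kernel_prodMk_left (measurable_prodMk_left hs)) hm]
      refine lintegral_congr fun ω => ?_
      congr 1
      ext b
      simp [e, hpC]
    simp_rw [hl, hr]
    exact h3.symm
  filter_upwards [Kernel.ae_eq_of_compProd_eq key] with x hx
  rw [hk1, hk2] at hx
  exact condDistrib_ae_eq_of_measure_eq_compProd _ hY.aemeasurable hx

/-- Restriction to fibres need not commute with an infinite intersection of `σ`-fields, so both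
sides are reached as limits. At each stage `n`, the conditional probability on the total space
restricts to the one on almost every fibre. The former converges in `L¹` to `κ' (z q)`, the latter
to the conditional probability given the intersection in the fibre. -/
theorem condExpKernel_map_ae_eq [StandardBorelSpace Ω] (η : Measure X) [IsProbabilityMeasure η]
    (κ : Kernel X Ω) [IsMarkovKernel κ] {C : ℕ → X × Ω → S} (hC : ∀ n, Measurable (C n))
    (hanti : Antitone fun n => MeasurableSpace.comap (C n) inferInstance)
    {p : S → X} (hp : Measurable p) (hpC : ∀ n q, p (C n q) = q.1) {Y : Ω → B} (hY : Measurable Y)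
    {W : Type*} [MeasurableSpace W] (κ' : Kernel W B) [IsMarkovKernel κ'] {z : X × Ω → W}
    (hz : Measurable z)
    (hcond : ∀ A, MeasurableSet A → (η ⊗ₘ κ)⟦(fun q => Y q.2) ⁻¹' A |
      ⨅ n, MeasurableSpace.comap (C n) inferInstance⟧ =ᵐ[η ⊗ₘ κ] fun q => (κ' (z q)).real A) :
    ∀ᵐ x ∂η, ∀ᵐ ω ∂κ x, (condExpKernel (κ x)
      (⨅ n, MeasurableSpace.comap (fun ω => C n (x, ω)) inferInstance) ω).map Y =
        κ' (z (x, ω)) := by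
  obtain ⟨𝒞, h𝒞, hpi, hgen⟩ := exists_countable_isPiSystem B
  have hY' : Measurable fun q : X × Ω => Y q.2 := hY.comp measurable_snd
  have hle : ∀ x, ⨅ n, MeasurableSpace.comap (fun ω => C n (x, ω)) inferInstance ≤
      (inferInstance : MeasurableSpace Ω) := fun x =>
    (iInf_le _ 0).trans ((hC 0).comp measurable_prodMk_left).comap_le
  suffices h : ∀ A ∈ 𝒞, ∀ᵐ x ∂η, ∀ᵐ ω ∂κ x, (condExpKernel (κ x)
      (⨅ n, MeasurableSpace.comap (fun ω => C n (x, ω)) inferInstance) ω).real (Y ⁻¹' A) =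
        (κ' (z (x, ω))).real A by
    filter_upwards [(ae_ball_iff h𝒞).2 h] with x hx
    filter_upwards [(ae_ball_iff h𝒞).2 hx] with ω hω
    have : IsProbabilityMeasure ((condExpKernel (κ x)
      (⨅ n, MeasurableSpace.comap (fun ω => C n (x, ω)) inferInstance) ω).map Y) :=
      Measure.isProbabilityMeasure_map hY.aemeasurable
    refine ext_of_generate_finite 𝒞 hgen hpi (fun A hA => ?_) (by simp)
    have hA' : MeasurableSet A := by
      rw [hgen]; exact MeasurableSpace.measurableSet_generateFrom hA
    rw [Measure.map_apply hY hA']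
    exact (measureReal_eq_measureReal_iff).1 (hω A hA)
  intro A hA
  have hA' : MeasurableSet A := by rw [hgen]; exact MeasurableSpace.measurableSet_generateFrom hA
  set cd : ℕ → Kernel S B := fun n => condDistrib (fun q => Y q.2) (C n) (η ⊗ₘ κ) with hcd
  set F : ℕ → X × Ω → ℝ := fun n q => (cd n (C n q)).real A with hF
  set h : X × Ω → ℝ := fun q => (κ' (z q)).real A with hh
  have hFm : ∀ n, Measurable (F n) := fun n =>
    ((Kernel.measurable_coe (cd n) hA').comp (hC n)).ennreal_toReal
  have hhm : Measurable h := ((Kernel.measurable_coe κ' hA').comp hz).ennreal_toReal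
  have hFQ : ∀ n, F n =ᵐ[η ⊗ₘ κ] (η ⊗ₘ κ)⟦(fun q => Y q.2) ⁻¹' A |
      MeasurableSpace.comap (C n) inferInstance⟧ := fun n =>
    condDistrib_ae_eq_condExp (hC n) hY' hA'
  have hlim := tendsto_eLpNorm_condExp_iInf (P := η ⊗ₘ κ) (fun n => (hC n).comap_le) hanti
    (f := ((fun q : X × Ω => Y q.2) ⁻¹' A).indicator fun _ => (1 : ℝ))
    ((memLp_const 1).indicator (hY' hA'))
  have hlim2 : Tendsto (fun n => ∫⁻ x, ∫⁻ ω, ‖F n (x, ω) - h (x, ω)‖ₑ ∂κ x ∂η) atTop (𝓝 0) := by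
    refine hlim.congr fun n => ?_
    rw [eLpNorm_congr_ae ((hFQ n).symm.sub (hcond A hA')), eLpNorm_one_eq_lintegral_enorm,
      Measure.lintegral_compProd ((hFm n).sub hhm).enorm]
    rfl
  -- Convergence of the mean over `x` does not give convergence for almost every `x`. Fatou's lemma
  -- gives a vanishing liminf, and infinitely many good `n` suffice since the fibre sequence itself
  -- converges.
  have hG : ∀ᵐ x ∂η, liminf (fun n => ∫⁻ ω, ‖F n (x, ω) - h (x, ω)‖ₑ ∂κ x) atTop = 0 := by
    have hm : ∀ n, Measurable fun x => ∫⁻ ω, ‖F n (x, ω) - h (x, ω)‖ₑ ∂κ x := fun n =>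
      Measurable.lintegral_kernel_prod_right' (((hFm n).sub hhm).enorm)
    have h0 := lintegral_liminf_le (μ := η) (u := atTop) hm
    rw [hlim2.liminf_eq, nonpos_iff_eq_zero, lintegral_eq_zero_iff (Measurable.liminf hm)] at h0
    exact h0
  have hfib : ∀ᵐ x ∂η, ∀ n, (fun ω => F n (x, ω)) =ᵐ[κ x] (κ x)⟦Y ⁻¹' A |
      MeasurableSpace.comap (fun ω => C n (x, ω)) inferInstance⟧ := by
    rw [ae_all_iff]
    intro n
    filter_upwards [condDistrib_fiber_ae_eq η κ (hC n) hp (hpC n) hY] with x hx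
    have hCx : Measurable fun ω => C n (x, ω) := (hC n).comp measurable_prodMk_left
    refine EventuallyEq.trans ?_ (condDistrib_ae_eq_condExp hCx hY hA')
    filter_upwards [ae_of_ae_map hCx.aemeasurable hx] with ω hω
    simp only [hF, hcd, hω]
  filter_upwards [hG, hfib] with x hx hx'
  have hCx : ∀ n, Measurable fun ω => C n (x, ω) := fun n => (hC n).comp measurable_prodMk_left
  have hantix : Antitone fun n => MeasurableSpace.comap (fun ω => C n (x, ω)) inferInstance := by
    intro i j hij
    have := MeasurableSpace.comap_mono (g := Prod.mk x) (hanti hij)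
    rw [MeasurableSpace.comap_comp, MeasurableSpace.comap_comp] at this
    exact this
  have hlimx := tendsto_eLpNorm_condExp_iInf (P := κ x) (fun n => (hCx n).comap_le) hantix
    (f := (Y ⁻¹' A).indicator fun _ => (1 : ℝ)) ((memLp_const 1).indicator (hY hA'))
  set E : Ω → ℝ := (κ x)⟦Y ⁻¹' A |
    ⨅ n, MeasurableSpace.comap (fun ω => C n (x, ω)) inferInstance⟧ with hE
  have hEm : Measurable E := (stronglyMeasurable_condExp.mono (hle x)).measurable
  have hbound : ∀ n, ∫⁻ ω, ‖h (x, ω) - E ω‖ₑ ∂κ x ≤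
      ∫⁻ ω, ‖F n (x, ω) - h (x, ω)‖ₑ ∂κ x + eLpNorm ((κ x)⟦Y ⁻¹' A |
        MeasurableSpace.comap (fun ω => C n (x, ω)) inferInstance⟧ - E) 1 (κ x) := by
    intro n
    have hFh : Measurable fun ω => ‖F n (x, ω) - h (x, ω)‖ₑ :=
      (((hFm n).sub hhm).comp measurable_prodMk_left).enorm
    rw [eLpNorm_congr_ae ((hx' n).symm.sub EventuallyEq.rfl), eLpNorm_one_eq_lintegral_enorm,
      ← lintegral_add_left hFh]
    refine lintegral_mono fun ω => ?_
    have e : h (x, ω) - E ω = -(F n (x, ω) - h (x, ω)) + (F n (x, ω) - E ω) := by ring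
    rw [e]
    refine (enorm_add_le _ _).trans_eq ?_
    rw [enorm_neg]
    rfl
  have hzero : ∫⁻ ω, ‖h (x, ω) - E ω‖ₑ ∂κ x = 0 := by
    refine nonpos_iff_eq_zero.1 (ENNReal.le_of_forall_pos_le_add fun ε hε _ => ?_)
    have hε' : (0 : ℝ≥0∞) < ε / 2 := ENNReal.half_pos (by exact_mod_cast hε.ne')
    have h1 : ∃ᶠ n in atTop, ∫⁻ ω, ‖F n (x, ω) - h (x, ω)‖ₑ ∂κ x < ε / 2 :=
      frequently_lt_of_liminf_lt (by isBoundedDefault) (by rwa [hx])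
    obtain ⟨n, hn1, hn2⟩ := (h1.and_eventually (hlimx.eventually_lt_const hε')).exists
    refine (hbound n).trans ?_
    rw [zero_add]
    exact (add_le_add hn1.le hn2.le).trans_eq (ENNReal.add_halves _)
  have hhE : Measurable fun ω => ‖h (x, ω) - E ω‖ₑ :=
    ((hhm.comp measurable_prodMk_left).sub hEm).enorm
  rw [lintegral_eq_zero_iff hhE] at hzero
  filter_upwards [hzero, condExpKernel_ae_eq_condExp (μ := κ x) (hle x) (hY hA')] with ω h1 h2
  rw [h2]
  have h3 : h (x, ω) - E ω = 0 := by simpa using h1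
  exact (sub_eq_zero.1 h3).symm

end Fibers

/-! ### Measurable separation of cosets -/

/-- A saturated Borel set and its complement have disjoint analytic images, and Souslin separation
makes the image of `E` measurable relative to the range of `f`. -/
theorem measurableSet_comap_of_saturated {A S : Type*} [MeasurableSpace A] [StandardBorelSpace A]
    [MeasurableSpace S] [MeasurableSpace.CountablySeparated S] {f : A → S} (hf : Measurable f)
    {E : Set A} (hE : MeasurableSet E) (h : ∀ a a', f a = f a' → a ∈ E → a' ∈ E) :
    MeasurableSet[MeasurableSpace.comap f inferInstance] E := by
  have he : f ⁻¹' (f '' E) = E := by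
    refine Set.Subset.antisymm ?_ (Set.subset_preimage_image f E)
    rintro a ⟨a', ha', haa'⟩
    exact h a' a haa' ha'
  have hsep : MeasurableSpace.CountablySeparated (Set.range f) :=
    MeasurableSpace.Subtype.countablySeparated
  rw [← he, hf.measurableSet_preimage_iff_preimage_val] at hE
  obtain ⟨T, hT, hTE⟩ := hE
  refine ⟨T, hT, ?_⟩
  rw [← he]
  ext a
  exact Set.ext_iff.1 hTE ⟨f a, a, rfl⟩

section Code

variable {G : Type*} [Group G] [TopologicalSpace G] [SecondCountableTopology G]

/-- The basic open sets hit by the coset `H g`. -/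
def cosetCode (H : Subgroup G) (g : G) : TopologicalSpace.countableBasis G → Prop :=
  fun U => ∃ h ∈ H, h * g ∈ U.1

theorem cosetCode_congr {H : Subgroup G} {g g' : G} (h : coset H g = coset H g') :
    cosetCode H g = cosetCode H g' := by
  have h' : g' * g⁻¹ ∈ H := QuotientGroup.rightRel_apply.1 (Quotient.exact h)
  funext U
  refine propext ⟨?_, ?_⟩
  · rintro ⟨k, hk, hkU⟩
    exact ⟨k * (g' * g⁻¹)⁻¹, H.mul_mem hk (H.inv_mem h'), by simpa [mul_assoc] using hkU⟩
  · rintro ⟨k, hk, hkU⟩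
    exact ⟨k * (g' * g⁻¹), H.mul_mem hk h', by simpa [mul_assoc] using hkU⟩

/-- Since `H` is closed, so is the coset of `g`; if `g'` lies outside it, some basic neighbourhood
of `g'` misses it, and the codes differ there. -/
theorem coset_eq_of_cosetCode_eq [IsTopologicalGroup G] {H : Subgroup G}
    (hH : IsClosed (H : Set G)) {g g' : G} (h : cosetCode H g = cosetCode H g') :
    coset H g = coset H g' := by
  refine Quotient.sound (QuotientGroup.rightRel_apply.2 ?_)
  by_contra hn
  have hcl : IsOpen ((fun a => a * g⁻¹) ⁻¹' (H : Set G)ᶜ) :=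
    hH.isOpen_compl.preimage (continuous_mul_const g⁻¹)
  obtain ⟨U, hU, hgU, hUs⟩ := (TopologicalSpace.isBasis_countableBasis G).exists_subset_of_mem_open
    (show g' ∈ (fun a => a * g⁻¹) ⁻¹' (H : Set G)ᶜ from hn) hcl
  have h1 : cosetCode H g' ⟨U, hU⟩ := ⟨1, H.one_mem, by simpa using hgU⟩
  rw [← h] at h1
  obtain ⟨k, hk, hkU⟩ := h1
  have := hUs hkU
  simp only [Set.mem_preimage, Set.mem_compl_iff, SetLike.mem_coe, mul_inv_cancel_right] at this
  exact this hk

variable [IsTopologicalGroup G] {X : Type*} [MeasurableSpace X] [MulAction G X]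

theorem SubgroupField.measurableSet_hit (L : SubgroupField G X) {U : Set G} (hU : IsOpen U) :
    MeasurableSet {x | ((L.group x : Set G) ∩ U).Nonempty} := by
  have h : IsOpen {H : ClosedSubgroup G | ((H : Set G) ∩ U).Nonempty} :=
    TopologicalSpace.isOpen_generateFrom_of_mem (Or.inl ⟨U, hU, rfl⟩)
  have h' : @MeasurableSet _ (borel (ClosedSubgroup G))
      {H : ClosedSubgroup G | ((H : Set G) ∩ U).Nonempty} :=
    MeasurableSpace.measurableSet_generateFrom h
  exact L.measurable h'

theorem SubgroupField.isClosed_group (L : SubgroupField G X) (x : X) :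
    IsClosed (L.group x : Set G) := (L.toFun x).isClosed'

variable [MeasurableSpace G] [BorelSpace G]

/-- By continuity of multiplication, `h * g ∈ U` means `h ∈ V` and `g ∈ W` for some basic `V`, `W`
with product inside `U`. The event is thus a countable union of rectangles whose first sides are
preimages of Chabauty open sets. -/
theorem SubgroupField.measurable_cosetCode (L : SubgroupField G X) :
    Measurable fun p : X × G => cosetCode (L.group p.1) p.2 := by
  refine measurable_pi_lambda _ fun U => ?_
  refine measurableSet_setOfPred.1 ?_
  have hU : IsOpen U.1 :=
    (TopologicalSpace.isBasis_countableBasis G).isOpen U.2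
  have e : {p : X × G | cosetCode (L.group p.1) p.2 U} =
      ⋃ V ∈ TopologicalSpace.countableBasis G, ⋃ W ∈ TopologicalSpace.countableBasis G,
        ⋃ _ : ∀ v ∈ V, ∀ w ∈ W, v * w ∈ U.1,
          {x | ((L.group x : Set G) ∩ V).Nonempty} ×ˢ W := by
    ext ⟨x, g⟩
    simp only [Set.mem_iUnion, Set.mem_prod, exists_prop]
    constructor
    · rintro ⟨k, hk, hkU⟩
      have hc : IsOpen ((fun q : G × G => q.1 * q.2) ⁻¹' U.1) := hU.preimage continuous_mul
      obtain ⟨V', W', hV', hW', hkV, hgW, hVW⟩ := isOpen_prod_iff.1 hc k g hkU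
      obtain ⟨V, hV, hkV2, hVV⟩ :=
        (TopologicalSpace.isBasis_countableBasis G).exists_subset_of_mem_open hkV hV'
      obtain ⟨W, hW, hgW2, hWW⟩ :=
        (TopologicalSpace.isBasis_countableBasis G).exists_subset_of_mem_open hgW hW'
      exact ⟨V, hV, W, hW, fun v hv w hw => hVW (Set.mk_mem_prod (hVV hv) (hWW hw)),
        ⟨k, hk, hkV2⟩, hgW2⟩
    · rintro ⟨V, -, W, -, hVW, ⟨k, hk, hkV⟩, hgW⟩
      exact ⟨k, hk, hVW k hkV g hgW⟩
  rw [e]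
  have hc := TopologicalSpace.countable_countableBasis G
  refine MeasurableSet.biUnion hc fun V hV => MeasurableSet.biUnion hc fun W hW =>
    MeasurableSet.iUnion fun _ => ?_
  exact (L.measurableSet_hit ((TopologicalSpace.isBasis_countableBasis G).isOpen hV)).prod
    ((TopologicalSpace.isBasis_countableBasis G).isOpen hW).measurableSet

/-- The point `x` together with the cosets visited from time `n` on. -/
def futureCode (L : SubgroupField G X) (n : ℕ) (p : X × (ℕ → G)) :
    X × (ℕ → TopologicalSpace.countableBasis G → Prop) :=
  (p.1, fun k => cosetCode (L.group p.1) (p.2 (n + k)))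

theorem measurable_futureCode (L : SubgroupField G X) (n : ℕ) : Measurable (futureCode L n) := by
  refine measurable_fst.prodMk (measurable_pi_lambda _ fun k => ?_)
  exact L.measurable_cosetCode.comp
    (measurable_fst.prodMk ((measurable_pi_apply (n + k)).comp measurable_snd))

theorem antitone_comap_futureCode (L : SubgroupField G X) :
    Antitone fun n => MeasurableSpace.comap (futureCode L n) inferInstance := by
  refine antitone_nat_of_succ_le fun n => ?_
  let φ : X × (ℕ → TopologicalSpace.countableBasis G → Prop) →
      X × (ℕ → TopologicalSpace.countableBasis G → Prop) := fun q => (q.1, fun k => q.2 (k + 1))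
  have hφ : Measurable φ := measurable_fst.prodMk
    (measurable_pi_lambda _ fun k => (measurable_pi_apply (k + 1)).comp measurable_snd)
  have e : futureCode L (n + 1) = φ ∘ futureCode L n := by
    funext p
    simp only [futureCode, φ, Function.comp_apply, add_assoc, add_comm 1]
  change MeasurableSpace.comap (futureCode L (n + 1)) _ ≤ _
  rw [e, ← MeasurableSpace.comap_comp]
  exact MeasurableSpace.comap_mono hφ.comap_le

/-- Together with its converse, this says that the countable code and `toCosets` have the same
fibres, so sets of `W_Ω` can be treated as saturated sets of `X × G^ℕ`. -/
theorem toCosets_eq_of_futureCode_eq (L : SubgroupField G X) {p p' : X × (ℕ → G)}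
    (h : futureCode L 0 p = futureCode L 0 p') : toCosets L p = toCosets L p' := by
  obtain ⟨x, ω⟩ := p
  obtain ⟨x', ω'⟩ := p'
  obtain ⟨hx, hc⟩ := Prod.mk.inj h
  simp only at hx hc
  subst hx
  have : (fun n => coset (L.group x) (ω n)) = fun n => coset (L.group x) (ω' n) := by
    funext n
    have hn := congrFun hc n
    simp only [zero_add] at hn
    exact coset_eq_of_cosetCode_eq (L.isClosed_group x) hn
  exact congrArg (Sigma.mk x) this

theorem futureCode_eq_of_toCosets_eq (L : SubgroupField G X) {p p' : X × (ℕ → G)}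
    (h : toCosets L p = toCosets L p') : futureCode L 0 p = futureCode L 0 p' := by
  obtain ⟨x, ω⟩ := p
  obtain ⟨x', ω'⟩ := p'
  have hx : x = x' := congrArg Sigma.fst h
  subst hx
  have hc : (fun n => coset (L.group x) (ω n)) = fun n => coset (L.group x) (ω' n) :=
    eq_of_heq (Sigma.mk.inj h).2
  refine Prod.ext rfl (funext fun k => ?_)
  exact cosetCode_congr (congrFun hc (0 + k))

section FiberField

variable [T2Space G] [StandardBorelSpace G]

omit [T2Space G] in
-- A measurable set of cosets lifts to a Borel set of `G` saturated for the code, hence comes from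
-- the code. So the quotient `σ`-field is countably generated.
theorem cosetSpace_eq_comap (L : SubgroupField G X) (x : X) :
    (inferInstance : MeasurableSpace (CosetSpace (L.group x))) =
      MeasurableSpace.comap (Quotient.lift (cosetCode (L.group x))
        fun _ _ h => cosetCode_congr (Quotient.sound h)) inferInstance := by
  have hc : Measurable (cosetCode (L.group x)) :=
    L.measurable_cosetCode.comp measurable_prodMk_left
  refine le_antisymm (fun A hA => ?_) ?_
  · have hA' : MeasurableSet (coset (L.group x) ⁻¹' A) := hA
    obtain ⟨T, hT, hTA⟩ := measurableSet_comap_of_saturated hc hA' fun a a' haa' ha => by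
      rw [Set.mem_preimage, ← coset_eq_of_cosetCode_eq (L.isClosed_group x) haa']
      exact ha
    refine ⟨T, hT, ?_⟩
    ext c
    induction c using Quotient.inductionOn with
    | h g => exact Set.ext_iff.1 hTA g
  · exact Measurable.comap_le fun T hT => hc hT

end FiberField

end Code

/-! ### Tail and invariant `σ`-fields -/

section Shift

variable {X G : Type*}

/-- The shift of the trajectory. -/
def pathShift (p : X × (ℕ → G)) : X × (ℕ → G) := (p.1, fun n => p.2 (n + 1))

/-- Prepend a position to a trajectory. -/
def consPath (g : G) (ω : ℕ → G) : ℕ → G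
  | 0 => g
  | n + 1 => ω n

theorem measurable_pathShift [MeasurableSpace X] [MeasurableSpace G] :
    Measurable (pathShift : X × (ℕ → G) → X × (ℕ → G)) :=
  measurable_fst.prodMk
    (measurable_pi_lambda _ fun n => (measurable_pi_apply (n + 1)).comp measurable_snd)

theorem measurable_consPath [MeasurableSpace G] :
    Measurable fun q : G × (ℕ → G) => consPath q.1 q.2 := by
  refine measurable_pi_lambda _ fun n => ?_
  cases n with
  | zero => exact measurable_fst
  | succ n => exact (measurable_pi_apply n).comp measurable_snd

theorem consPath_self (ω : ℕ → G) : consPath (ω 0) (fun n => ω (n + 1)) = ω := by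
  funext n
  cases n <;> rfl

/-- The diagonal action on points and trajectories. -/
def diagAction [Group G] [MulAction G X] (g : G) (p : X × (ℕ → G)) : X × (ℕ → G) :=
  (g • p.1, fun n => g * p.2 n)

end Shift

/-! ### Global and fibrewise tail fields -/

section Tail

variable {G : Type*} [Group G] [TopologicalSpace G] [SecondCountableTopology G]
  [IsTopologicalGroup G] [MeasurableSpace G] [BorelSpace G]
  {X : Type*} [MeasurableSpace X] [MulAction G X]

instance countablyGenerated_cosetSpace [StandardBorelSpace G] (L : SubgroupField G X) (x : X) :
    MeasurableSpace.CountablyGenerated (CosetSpace (L.group x)) := by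
  have h := cosetSpace_eq_comap L x
  have h' := MeasurableSpace.CountablyGenerated.comap
    (m := (inferInstance : MeasurableSpace (TopologicalSpace.countableBasis G → Prop)))
    (f := Quotient.lift (cosetCode (L.group x)) fun _ _ h => cosetCode_congr (Quotient.sound h))
  rw [← h] at h'
  exact h'

theorem measurable_coset (H : Subgroup G) : Measurable (coset H) := fun _ h => h

/-- Over a fixed `x` the base point coordinate of `futureCode` is constant and contributes only the
trivial `σ`-field. -/
theorem tailField_fiberChain [StandardBorelSpace G] (L : SubgroupField G X) (x : X) :
    tailField (fiberChain L x) =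
      ⨅ n, MeasurableSpace.comap (fun ω => futureCode L n (x, ω)) inferInstance := by
  refine iInf_congr fun n => ?_
  have h1 : ∀ k, MeasurableSpace.comap (fiberChain L x (n + k)) inferInstance =
      MeasurableSpace.comap (fun ω : ℕ → G => cosetCode (L.group x) (ω (n + k))) inferInstance := by
    intro k
    conv_lhs => rw [cosetSpace_eq_comap L x, MeasurableSpace.comap_comp]
    rfl
  have h2 : (inferInstance : MeasurableSpace
      (X × (ℕ → TopologicalSpace.countableBasis G → Prop))) =
      MeasurableSpace.comap Prod.fst inferInstance ⊔
        ⨆ k, MeasurableSpace.comap (fun q : X × (ℕ → TopologicalSpace.countableBasis G → Prop) =>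
          q.2 k) inferInstance := by
    change MeasurableSpace.comap Prod.fst _ ⊔ MeasurableSpace.comap Prod.snd
      (⨆ k, MeasurableSpace.comap (fun b : ℕ → TopologicalSpace.countableBasis G → Prop => b k)
        inferInstance) = _
    rw [MeasurableSpace.comap_iSup]
    simp only [MeasurableSpace.comap_comp]
    rfl
  simp_rw [h1]
  conv_rhs => rw [h2, MeasurableSpace.comap_sup, MeasurableSpace.comap_iSup]
  simp only [MeasurableSpace.comap_comp]
  have h3 : MeasurableSpace.comap (Prod.fst ∘ fun ω => futureCode L n (x, ω))
      (inferInstance : MeasurableSpace X) = ⊥ := MeasurableSpace.comap_const x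
  rw [h3, bot_sup_eq]
  rfl

/-- The tail `σ`-field of the coset trajectories, on `X × G^ℕ`. -/
@[reducible] def globalTail (L : SubgroupField G X) : MeasurableSpace (X × (ℕ → G)) :=
  ⨅ n, MeasurableSpace.comap (futureCode L n) inferInstance

theorem globalTail_le (L : SubgroupField G X) :
    globalTail L ≤ (inferInstance : MeasurableSpace (X × (ℕ → G))) :=
  (iInf_le _ 0).trans (measurable_futureCode L 0).comap_le

theorem futureCode_pathShift (L : SubgroupField G X) (n : ℕ) (p : X × (ℕ → G)) :
    futureCode L n (pathShift p) = futureCode L (n + 1) p := by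
  simp only [futureCode, pathShift]
  refine Prod.ext rfl (funext fun k => ?_)
  simp only [add_right_comm]

theorem futureCode_consPath (L : SubgroupField G X) (n : ℕ) (g : G) (p : X × (ℕ → G)) :
    futureCode L (n + 1) (p.1, consPath g p.2) = futureCode L n p := by
  rw [← futureCode_pathShift]
  rfl

theorem measurableSet_globalTail_pathShift (L : SubgroupField G X) {A : Set (X × (ℕ → G))}
    (hA : MeasurableSet[globalTail L] A) : MeasurableSet[globalTail L] (pathShift ⁻¹' A) := by
  refine MeasurableSpace.measurableSet_iInf.2 fun n => ?_
  obtain ⟨D, hD, rfl⟩ := MeasurableSpace.measurableSet_iInf.1 hA n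
  refine antitone_comap_futureCode L (Nat.le_succ n) _ ⟨D, hD, ?_⟩
  ext p
  simp only [Set.mem_preimage, futureCode_pathShift]

/-- A tail set does not see the first position, so a position may be prepended at will; `1` is only
a filler. The resulting set has the given one as its shift preimage. -/
theorem measurableSet_globalTail_consPath (L : SubgroupField G X) {A : Set (X × (ℕ → G))}
    (hA : MeasurableSet[globalTail L] A) :
    MeasurableSet[globalTail L] {p | (p.1, consPath 1 p.2) ∈ A} := by
  refine MeasurableSpace.measurableSet_iInf.2 fun n => ?_
  obtain ⟨D, hD, rfl⟩ := MeasurableSpace.measurableSet_iInf.1 hA (n + 1)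
  refine ⟨D, hD, ?_⟩
  ext p
  simp only [Set.mem_preimage, Set.mem_ofPred_eq, futureCode_consPath]

theorem preimage_pathShift_consPath (L : SubgroupField G X) {A : Set (X × (ℕ → G))}
    (hA : MeasurableSet[globalTail L] A) :
    pathShift ⁻¹' {p | (p.1, consPath 1 p.2) ∈ A} = A := by
  obtain ⟨D, hD, rfl⟩ := MeasurableSpace.measurableSet_iInf.1 hA 1
  ext p
  have h := futureCode_consPath L 0 1 (pathShift p)
  simp only [zero_add] at h
  simp only [Set.mem_preimage, Set.mem_ofPred_eq, h, futureCode_pathShift, zero_add]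

theorem timeShift_toCosets (L : SubgroupField G X) (p : X × (ℕ → G)) :
    timeShift L (toCosets L p) = toCosets L (pathShift p) := rfl

theorem translate_toCosets (L : SubgroupField G X) (g : G) (p : X × (ℕ → G)) :
    translate L g (toCosets L p) = toCosets L (diagAction g p) := rfl

theorem measurable_toCosets (L : SubgroupField G X) : Measurable (toCosets L) := fun _ h => h

theorem toCosets_surjective (L : SubgroupField G X) : Function.Surjective (toCosets L) := by
  rintro ⟨x, c⟩
  refine ⟨(x, fun n => (c n).out), ?_⟩
  have : (fun n => coset (L.group x) (c n).out) = c := funext fun n => Quotient.out_eq (c n)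
  exact congrArg (Sigma.mk x) this

/-- A tail set depends on the cosets only, so it is saturated for `toCosets` and descends to `W_Ω`.
-/
theorem exists_invariant_of_globalTail (L : SubgroupField G X) {A : Set (X × (ℕ → G))}
    (hA : MeasurableSet[globalTail L] A) (hinv : pathShift ⁻¹' A = A) :
    ∃ A' : Set (CosetTrajectories L),
      MeasurableSet[MeasurableSpace.invariants (timeShift L)] A' ∧ toCosets L ⁻¹' A' = A := by
  have he : toCosets L ⁻¹' (toCosets L '' A) = A := by
    refine Set.Subset.antisymm ?_ (Set.subset_preimage_image _ _)
    rintro p ⟨q, hq, hqp⟩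
    obtain ⟨D, hD, rfl⟩ := MeasurableSpace.measurableSet_iInf.1 hA 0
    rw [Set.mem_preimage, futureCode_eq_of_toCosets_eq L hqp] at hq
    exact hq
  refine ⟨toCosets L '' A, ⟨?_, ?_⟩, he⟩
  · change MeasurableSet (toCosets L ⁻¹' (toCosets L '' A))
    rw [he]
    exact globalTail_le L _ hA
  · ext w
    obtain ⟨p, rfl⟩ := toCosets_surjective L w
    have h1 := Set.ext_iff.1 he
    rw [Set.mem_preimage, timeShift_toCosets, ← Set.mem_preimage, h1, ← Set.mem_preimage, hinv,
      ← h1, Set.mem_preimage]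

/-! ### Tail measurability of the bundle map -/

section Realisation

variable [StandardBorelSpace G] [StandardBorelSpace X] {Z : Type*} [MeasurableSpace Z]
  [MeasurableSingletonClass Z] {L : SubgroupField G X} {θ : CosetTrajectories L → Z}

theorem map_toCosets_pathShift
    (hθ : Measurable[MeasurableSpace.invariants (timeShift L)] θ) (p : X × (ℕ → G)) :
    θ (toCosets L (pathShift p)) = θ (toCosets L p) :=
  congrFun (MeasurableSpace.comp_eq_of_measurable_invariants hθ) (toCosets L p)

theorem measurable_map_toCosets
    (hθ : Measurable[MeasurableSpace.invariants (timeShift L)] θ) :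
    Measurable fun p => θ (toCosets L p) :=
  (hθ.mono (MeasurableSpace.invariants_le _) le_rfl).comp (measurable_toCosets L)

/-- By shift invariance the map may be evaluated on the shifted trajectory, so measurability for the
cosets from time `n` on passes to time `n + 1`. -/
theorem measurable_globalTail_map_toCosets
    (hθ : Measurable[MeasurableSpace.invariants (timeShift L)] θ) :
    Measurable[globalTail L] fun p => θ (toCosets L p) := by
  intro B hB
  refine MeasurableSpace.measurableSet_iInf.2 fun n => ?_
  induction n with
  | zero =>
    refine measurableSet_comap_of_saturated (measurable_futureCode L 0)
      (measurable_map_toCosets hθ hB) fun p p' hpp' hp => ?_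
    rw [Set.mem_preimage, ← toCosets_eq_of_futureCode_eq L hpp']
    exact hp
  | succ n ih =>
    obtain ⟨D, hD, hDB⟩ := ih
    refine ⟨D, hD, ?_⟩
    ext p
    have h := Set.ext_iff.1 hDB (pathShift p)
    rw [Set.mem_preimage, futureCode_pathShift, Set.mem_preimage, map_toCosets_pathShift hθ] at h
    exact h

end Realisation

end Tail

/-! ### The first step decomposition of the random walk -/

section FirstStep

theorem map_consPath_infinitePi {G : Type*} [MeasurableSpace G] (μ : Measure G)
    [IsProbabilityMeasure μ] :
    (μ.prod (Measure.infinitePi fun _ : ℕ => μ)).map (fun q => consPath q.1 q.2) =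
      Measure.infinitePi fun _ : ℕ => μ := by
  classical
  refine Measure.eq_infinitePi _ fun s t ht => ?_
  -- Enlarging the index set to an initial segment, with trivial constraints, lets the coordinate
  -- `0` be split off.
  obtain ⟨n, hn⟩ : ∃ n, s ⊆ Finset.range (n + 1) := ⟨s.sup id, fun i hi =>
    Finset.mem_range.2 (Nat.lt_succ_of_le (Finset.le_sup (f := id) hi))⟩
  let t' : ℕ → Set G := fun i => if i ∈ s then t i else Set.univ
  have ht' : ∀ i, MeasurableSet (t' i) := fun i => by
    by_cases h : i ∈ s <;> simp [t', h, ht i]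
  have hpi : (s : Set ℕ).pi t = (Finset.range (n + 1) : Set ℕ).pi t' := by
    ext f
    simp only [Set.mem_pi, Finset.mem_coe]
    constructor
    · intro h i _
      by_cases his : i ∈ s <;> simp [t', his, h]
    · intro h i hi
      simpa [t', hi] using h i (hn hi)
  have hprod : ∏ i ∈ s, μ (t i) = ∏ i ∈ Finset.range (n + 1), μ (t' i) := by
    rw [← Finset.prod_subset hn fun i _ hi => by simp [t', hi]]
    exact Finset.prod_congr rfl fun i hi => by simp [t', hi]
  rw [hpi, hprod, Measure.map_apply measurable_consPath
    (MeasurableSet.pi (Finset.countable_toSet _) fun i _ => ht' i)]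
  have hpre : (fun q : G × (ℕ → G) => consPath q.1 q.2) ⁻¹'
      (Finset.range (n + 1) : Set ℕ).pi t' =
      t' 0 ×ˢ (Finset.range n : Set ℕ).pi fun i => t' (i + 1) := by
    ext q
    simp only [Set.mem_preimage, Set.mem_pi, Finset.mem_coe, Finset.mem_range, Set.mem_prod]
    constructor
    · exact fun h => ⟨h 0 (Nat.succ_pos _), fun i hi => h (i + 1) (Nat.succ_lt_succ hi)⟩
    · rintro ⟨h0, h⟩ i hi
      cases i with
      | zero => exact h0
      | succ i => exact h i (Nat.lt_of_succ_lt_succ hi)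
  rw [hpre, Measure.prod_prod, Measure.infinitePi_pi _ fun i _ => ht' (i + 1),
    Finset.prod_range_succ', mul_comm]

variable {G : Type*} [Group G]

theorem trajectory_consPath (g : G) (s : ℕ → G) :
    trajectory (consPath g s) = consPath g fun n => g * trajectory s n := by
  funext n
  induction n with
  | zero => rfl
  | succ n ih =>
    rw [trajectory, ih]
    cases n with
    | zero => rfl
    | succ n => simp only [consPath, trajectory, mul_assoc]

variable [TopologicalSpace G] [IsTopologicalGroup G] [SecondCountableTopology G]
  [MeasurableSpace G] [BorelSpace G]

theorem measurable_mulPath : Measurable fun q : G × (ℕ → G) => fun n => q.1 * q.2 n :=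
  measurable_pi_lambda _ fun n => measurable_fst.mul ((measurable_pi_apply n).comp measurable_snd)

theorem measurable_consPath_mulPath :
    Measurable fun q : G × (ℕ → G) => consPath q.1 fun n => q.1 * q.2 n :=
  measurable_consPath.comp (measurable_fst.prodMk measurable_mulPath)

/-- The walk makes a first step `h` and then follows the `h`-translate of an independent walk. -/
theorem walkLaw_eq_map (μ : Measure G) [IsProbabilityMeasure μ] :
    walkLaw μ = (μ.prod (walkLaw μ)).map fun q => consPath q.1 fun n => q.1 * q.2 n := by
  have hm : Measurable fun q : G × (ℕ → G) => consPath q.1 fun n => q.1 * q.2 n :=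
    measurable_consPath_mulPath
  have hp : μ.prod (walkLaw μ) =
      (μ.prod (Measure.infinitePi fun _ : ℕ => μ)).map (Prod.map id trajectory) := by
    rw [walkLaw, ← Measure.map_prod_map _ _ measurable_id measurable_trajectory, Measure.map_id]
  rw [hp, Measure.map_map hm (measurable_id.prodMap measurable_trajectory), walkLaw]
  conv_lhs => rw [← map_consPath_infinitePi μ]
  rw [Measure.map_map measurable_trajectory measurable_consPath]
  congr 1
  funext q
  exact trajectory_consPath q.1 q.2

theorem lintegral_walkLaw (μ : Measure G) [IsProbabilityMeasure μ] {f : (ℕ → G) → ℝ≥0∞}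
    (hf : Measurable f) :
    ∫⁻ ω, f ω ∂walkLaw μ =
      ∫⁻ h, ∫⁻ ω, f (consPath h fun n => h * ω n) ∂walkLaw μ ∂μ := by
  have hm : Measurable fun q : G × (ℕ → G) => consPath q.1 fun n => q.1 * q.2 n :=
    measurable_consPath_mulPath
  conv_lhs => rw [walkLaw_eq_map, lintegral_map hf hm]
  exact lintegral_prod _ (hf.comp hm).aemeasurable

theorem ae_walkLaw (μ : Measure G) [IsProbabilityMeasure μ] {p : (ℕ → G) → Prop}
    (h : ∀ᵐ ω ∂walkLaw μ, p ω) :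
    ∀ᵐ g ∂μ, ∀ᵐ ω ∂walkLaw μ, p (consPath g fun n => g * ω n) := by
  rw [walkLaw_eq_map] at h
  have := ae_of_ae_map measurable_consPath_mulPath.aemeasurable h
  exact Measure.ae_ae_of_ae_prod this

end FirstStep

/-! ### The boundary map -/

section Boundary

variable {G : Type*} [Group G] [TopologicalSpace G] [IsTopologicalGroup G]
  [SecondCountableTopology G] [MeasurableSpace G] [BorelSpace G]
  {Y : Type*} [MeasurableSpace Y] [MulAction G Y] [MeasurableSMul₂ G Y]
  {μ : Measure G} [IsProbabilityMeasure μ] {ν : Measure Y} [IsProbabilityMeasure ν]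

theorem map_smul_apply (g : G) {A : Set Y} (hA : MeasurableSet A) :
    (ν.map fun y => g • y) A = ν {y | g • y ∈ A} :=
  Measure.map_apply (measurable_const_smul g) hA

theorem measurable_map_smul_apply {A : Set Y} (hA : MeasurableSet A) :
    Measurable fun g : G => (ν.map fun y => g • y) A := by
  simp_rw [map_smul_apply _ hA]
  exact measurable_measure_prodMk_left (measurable_smul hA)

theorem lintegral_map_smul_apply (hν : (μ.prod ν).map (fun p : G × Y => p.1 • p.2) = ν)
    {A : Set Y} (hA : MeasurableSet A) : ∫⁻ g, (ν.map fun y => g • y) A ∂μ = ν A := by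
  have hs : Measurable fun p : G × Y => p.1 • p.2 := measurable_smul
  conv_rhs => rw [← hν, Measure.map_apply hs hA, Measure.prod_apply (hs hA)]
  refine lintegral_congr fun g => ?_
  rw [map_smul_apply g hA]
  rfl

theorem lintegral_walkLaw_map_smul (hν : (μ.prod ν).map (fun p : G × Y => p.1 • p.2) = ν)
    (n : ℕ) {A : Set Y} (hA : MeasurableSet A) :
    ∫⁻ ω, (ν.map fun y => ω n • y) A ∂walkLaw μ = ν A := by
  have hm : ∀ {A : Set Y}, MeasurableSet A → ∀ n : ℕ,
      Measurable fun ω : ℕ → G => (ν.map fun y => ω n • y) A := fun hA n =>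
    (measurable_map_smul_apply hA).comp (measurable_pi_apply n)
  induction n generalizing A with
  | zero =>
    rw [lintegral_walkLaw μ (hm hA 0)]
    simp only [consPath, lintegral_const, measure_univ, mul_one]
    exact lintegral_map_smul_apply hν hA
  | succ n ih =>
    rw [lintegral_walkLaw μ (hm hA (n + 1))]
    simp only [consPath]
    refine Eq.trans (lintegral_congr fun h => ?_) (lintegral_map_smul_apply hν hA)
    have hA' : MeasurableSet {y : Y | h • y ∈ A} := measurable_const_smul h hA
    rw [map_smul_apply h hA, ← ih hA']
    refine lintegral_congr fun ω => ?_
    rw [map_smul_apply _ hA, map_smul_apply _ hA']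
    simp only [mul_smul, Set.mem_ofPred_eq]

/-- By stationarity `ω n • ν` has mean `ν` for every `n`, and bounded convergence carries this to
the limit `δ_{β(ω)}`. -/
theorem IsBoundaryMap.map_eq {β : (ℕ → G) → Y} (hβ : IsBoundaryMap μ ν β)
    (hν : (μ.prod ν).map (fun p : G × Y => p.1 • p.2) = ν) : (walkLaw μ).map β = ν := by
  ext A hA
  have h := tendsto_lintegral_of_dominated_convergence (μ := walkLaw μ)
    (F := fun n ω => (ν.map fun y => ω n • y) A) (fun _ => 1)
    (fun n => (measurable_map_smul_apply hA).comp (measurable_pi_apply n))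
    (fun n => ae_of_all _ fun ω => by
      exact (map_smul_apply (ω n) hA).trans_le prob_le_one) (by simp) (hβ.limit A hA)
  simp_rw [lintegral_walkLaw_map_smul hν _ hA] at h
  rw [tendsto_nhds_unique tendsto_const_nhds h, Measure.map_apply hβ.measurable hA,
    ← lintegral_indicator_one (hβ.measurable hA)]
  refine lintegral_congr fun ω => ?_
  rw [Measure.dirac_apply' _ hA]
  rfl

/-- Prepending the step `g` translates all later positions by `g`, so both points are read off from
the limit of one sequence of measures. A countable separating family of sets keeps the number of
null sets countable. -/
theorem IsBoundaryMap.ae_consPath [StandardBorelSpace Y] {β : (ℕ → G) → Y}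
    (hβ : IsBoundaryMap μ ν β) :
    ∀ᵐ g ∂μ, ∀ᵐ ω ∂walkLaw μ, β (consPath g fun n => g * ω n) = g • β ω := by
  obtain ⟨C, hC, hCm, hsep⟩ :=
    HasCountableSeparatingOn.exists_countable_separating (α := Y) (p := MeasurableSet)
      (t := Set.univ)
  have h : ∀ᵐ g ∂μ, ∀ A ∈ C, ∀ᵐ ω ∂walkLaw μ, Tendsto
      (fun n => (ν.map fun y => (consPath g fun n => g * ω n) n • y) A) atTop
      (𝓝 (Measure.dirac (β (consPath g fun n => g * ω n)) A)) :=
    (ae_ball_iff hC).2 fun A hA => ae_walkLaw μ (hβ.limit A (hCm A hA))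
  filter_upwards [h] with g hg
  have h' : ∀ᵐ ω ∂walkLaw μ, ∀ A ∈ C, Tendsto (fun n => (ν.map fun y => ω n • y) {y | g • y ∈ A})
      atTop (𝓝 (Measure.dirac (β ω) {y | g • y ∈ A})) :=
    (ae_ball_iff hC).2 fun A hA => hβ.limit _ (measurable_const_smul g (hCm A hA))
  filter_upwards [(ae_ball_iff hC).2 hg, h'] with ω h1 h2
  refine hsep _ (Set.mem_univ _) _ (Set.mem_univ _) fun A hA => ?_
  have hA' : MeasurableSet {y : Y | g • y ∈ A} := measurable_const_smul g (hCm A hA)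
  have h3 := (h1 A hA).comp (tendsto_add_atTop_nat 1)
  have h4 : ((fun n => (ν.map fun y => (consPath g fun n => g * ω n) n • y) A) ∘ fun n => n + 1) =
      fun n => (ν.map fun y => ω n • y) {y | g • y ∈ A} := by
    funext n
    simp only [Function.comp, consPath]
    rw [map_smul_apply _ (hCm A hA), map_smul_apply _ hA']
    simp only [mul_smul, Set.mem_ofPred_eq]
  rw [h4] at h3
  have h5 := tendsto_nhds_unique h3 (h2 A hA)
  rw [Measure.dirac_apply' _ (hCm A hA), Measure.dirac_apply' _ hA'] at h5
  constructor
  · intro k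
    by_contra k'
    rw [Set.indicator_of_mem k, Set.indicator_of_notMem (s := {y | g • y ∈ A}) k'] at h5
    exact one_ne_zero h5
  · intro k
    by_contra k'
    rw [Set.indicator_of_notMem k', Set.indicator_of_mem (s := {y | g • y ∈ A}) k] at h5
    exact zero_ne_one h5

end Boundary

/-! ### The conditional measures of a standard system and the joining -/

/-- Convergence to the boundary point is known set by set, each with its own null set. For one
function, countably many sets with rational endpoints are enough: the mass where `F` is near `F b`
tends to one, and `F` is bounded. -/
theorem tendsto_integral_of_tendsto_measure_Ioo {Y : Type*} [MeasurableSpace Y]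
    {ν : ℕ → Measure Y} (hν : ∀ n, IsProbabilityMeasure (ν n)) {b : Y} {F : Y → ℝ}
    (hF : Measurable F) (h0 : ∀ y, 0 ≤ F y) (h1 : ∀ y, F y ≤ 1)
    (h : ∀ q r : ℚ, Tendsto (fun n => ν n (F ⁻¹' Set.Ioo (q : ℝ) r)) atTop
      (𝓝 (Measure.dirac b (F ⁻¹' Set.Ioo (q : ℝ) r)))) :
    Tendsto (fun n => ∫ y, F y ∂ν n) atTop (𝓝 (F b)) := by
  refine Metric.tendsto_atTop.2 fun ε hε => ?_
  obtain ⟨q, hq1, hq2⟩ := exists_rat_btwn (show F b - ε / 2 < F b by linarith)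
  obtain ⟨r, hr1, hr2⟩ := exists_rat_btwn (show F b < F b + ε / 2 by linarith)
  set E := F ⁻¹' Set.Ioo (q : ℝ) r with hE
  have hEm : MeasurableSet E := hF measurableSet_Ioo
  have hd : Measure.dirac b E = 1 := by
    rw [Measure.dirac_apply' _ hEm, Set.indicator_of_mem (show b ∈ E from ⟨hq2, hr1⟩)]
    rfl
  have h2 : Tendsto (fun n => (ν n).real E) atTop (𝓝 1) := by
    have := (ENNReal.tendsto_toReal (measure_ne_top _ _)).comp (h q r)
    rw [hd, ENNReal.toReal_one] at this
    exact this
  obtain ⟨N, hN⟩ := Metric.tendsto_atTop.1 h2 (ε / 2) (by linarith)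
  refine ⟨N, fun n hn => ?_⟩
  have h3 := hN n hn
  rw [Real.dist_eq] at h3 ⊢
  have h4 : (ν n).real Eᶜ < ε / 2 := by
    rw [probReal_compl_eq_one_sub hEm]
    linarith [neg_abs_le ((ν n).real E - 1)]
  have hFi : Integrable F (ν n) := Integrable.of_bound hF.aestronglyMeasurable 1
    (ae_of_all _ fun y => by rw [Real.norm_eq_abs, abs_of_nonneg (h0 y)]; exact h1 y)
  have hIi : Integrable (Eᶜ.indicator fun _ => (1 : ℝ)) (ν n) :=
    (integrable_const 1).indicator hEm.compl
  have h5 : ∫ y, F y ∂ν n - F b = ∫ y, (F y - F b) ∂ν n := by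
    rw [integral_sub hFi (integrable_const _), integral_const, probReal_univ, one_smul]
  have h6 : ∀ y, |F y - F b| ≤ ε / 2 + Eᶜ.indicator (fun _ => (1 : ℝ)) y := by
    intro y
    by_cases hy : y ∈ E
    · rw [Set.indicator_of_notMem (Set.notMem_compl_iff.2 hy), add_zero, abs_le]
      have hy1 : (q : ℝ) < F y := hy.1
      have hy2 : F y < r := hy.2
      constructor <;> linarith
    · rw [Set.indicator_of_mem hy, abs_le]
      constructor <;> linarith [h0 y, h1 y, h0 b, h1 b]
  calc |∫ y, F y ∂ν n - F b| = |∫ y, (F y - F b) ∂ν n| := by rw [h5]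
    _ ≤ ∫ y, |F y - F b| ∂ν n := abs_integral_le_integral_abs
    _ ≤ ∫ y, (ε / 2 + Eᶜ.indicator (fun _ => (1 : ℝ)) y) ∂ν n :=
        integral_mono (hFi.sub (integrable_const _)).abs ((integrable_const _).add hIi) h6
    _ = ε / 2 + (ν n).real Eᶜ := by
        rw [integral_add (integrable_const _) hIi, integral_const, probReal_univ, one_smul,
          integral_indicator_const _ hEm.compl, smul_eq_mul, mul_one]
    _ < ε := by linarith

section Conditional

variable {G : Type*} [Group G] [TopologicalSpace G] [IsTopologicalGroup G]
  [SecondCountableTopology G] [MeasurableSpace G] [BorelSpace G]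
  {X : Type*} [MeasurableSpace X] [StandardBorelSpace X] [Nonempty X]
  [MulAction G X] [MeasurableSMul₂ G X]
  {Y : Type*} [MeasurableSpace Y] [MulAction G Y] [MeasurableSMul₂ G Y]
  {μ : Measure G} [IsProbabilityMeasure μ] {η : Measure X} [IsProbabilityMeasure η]
  {ν : Measure Y} {π : X → Y} {β : (ℕ → G) → Y}

instance isMarkovKernel_disintegration (η : Measure X) [IsFiniteMeasure η] (π : X → Y) :
    IsMarkovKernel (disintegration η π) := by
  unfold disintegration
  infer_instance

theorem lintegral_disintegration (hπ : IsFactorMap G η ν π) {F : Y × X → ℝ≥0∞}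
    (hF : Measurable F) :
    ∫⁻ x, F (π x, x) ∂η = ∫⁻ y, ∫⁻ x, F (y, x) ∂disintegration η π y ∂ν := by
  have h := compProd_map_condDistrib (X := π) (Y := id) (μ := η)
    (mβ := inferInstance) aemeasurable_id
  have : IsFiniteMeasure ν := hπ.map_eq ▸ inferInstance
  rw [hπ.map_eq] at h
  rw [← Measure.lintegral_compProd hF, disintegration, h,
    lintegral_map hF (hπ.measurable.prodMk measurable_id)]
  rfl

theorem IsStandardSystem.isProbabilityMeasure (h : IsStandardSystem μ η ν π β) :
    IsProbabilityMeasure ν :=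
  h.factor.map_eq ▸ Measure.isProbabilityMeasure_map h.factor.measurable.aemeasurable

/-- In a measure preserving extension, `gη` has the same fibre measures as `η`, now integrated over
`gν`; all dependence on `g` sits on the base. -/
theorem IsStandardSystem.map_smul_apply_eq (h : IsStandardSystem μ η ν π β) (g : G) {A : Set X}
    (hA : MeasurableSet A) :
    (η.map fun x => g • x) A = ∫⁻ y, disintegration η π y A ∂ν.map fun y => g • y := by
  have hg : MeasurableSet {x : X | g • x ∈ A} := measurable_const_smul g hA
  have h1 := lintegral_disintegration h.factor
    (F := fun p => {x : X | g • x ∈ A}.indicator 1 p.2)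
    ((measurable_one.indicator hg).comp measurable_snd)
  simp only [lintegral_indicator_one hg] at h1
  have hgy : Measurable fun y : Y => g • y := measurable_const_smul g
  rw [map_smul_apply g hA, h1, lintegral_map (Kernel.measurable_coe _ hA) hgy]
  refine lintegral_congr_ae ?_
  filter_upwards [h.measurePreserving g] with y hy
  rw [← hy, map_smul_apply g hA]

/-- `(ω_n η)(A)` is the integral of `y ↦ η^y(A)` against `ω_n ν`, and `ω_n ν` tends to the point
mass at `β ω`. -/
theorem IsStandardSystem.isLimitMeasure (h : IsStandardSystem μ η ν π β) :
    IsLimitMeasure μ η ((disintegration η π).comap β h.boundary.measurable) := by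
  intro A hA
  have := h.isProbabilityMeasure
  set F : Y → ℝ := fun y => (disintegration η π y).real A with hFdef
  have hF : Measurable F := (Kernel.measurable_coe _ hA).ennreal_toReal
  have hev : ∀ᵐ ω ∂walkLaw μ, ∀ q r : ℚ,
      Tendsto (fun n : ℕ => (ν.map fun y => ω n • y) (F ⁻¹' Set.Ioo (q : ℝ) r)) atTop
        (𝓝 (Measure.dirac (β ω) (F ⁻¹' Set.Ioo (q : ℝ) r))) :=
    ae_all_iff.2 fun q => ae_all_iff.2 fun r => h.boundary.limit _ (hF measurableSet_Ioo)
  filter_upwards [hev] with ω hω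
  have hp : ∀ n, IsProbabilityMeasure (ν.map fun y => ω n • y) := fun n =>
    Measure.isProbabilityMeasure_map (measurable_const_smul (ω n)).aemeasurable
  have h1 := tendsto_integral_of_tendsto_measure_Ioo hp hF (fun y => measureReal_nonneg)
    (fun y => measureReal_le_one) hω
  have h2 := ENNReal.tendsto_ofReal h1
  rw [Kernel.comap_apply, ← ofReal_measureReal]
  refine h2.congr fun n => ?_
  rw [h.map_smul_apply_eq _ hA, ofReal_integral_eq_lintegral_ofReal
    (Integrable.of_bound hF.aestronglyMeasurable 1 (ae_of_all _ fun y => by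
      rw [Real.norm_eq_abs, abs_of_nonneg measureReal_nonneg]; exact measureReal_le_one))
    (ae_of_all _ fun y => measureReal_nonneg)]
  exact lintegral_congr fun y => ofReal_measureReal

theorem IsLimitMeasure.ae_eq {κ κ' : Kernel (ℕ → G) X} [IsMarkovKernel κ] [IsMarkovKernel κ']
    (h : IsLimitMeasure μ η κ) (h' : IsLimitMeasure μ η κ') : κ =ᵐ[walkLaw μ] κ' := by
  obtain ⟨C, hC, hpi, hgen⟩ := exists_countable_isPiSystem X
  have hm : ∀ A ∈ C, MeasurableSet A := fun A hA => by
    rw [hgen]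
    exact MeasurableSpace.measurableSet_generateFrom hA
  have h1 := (ae_ball_iff hC).2 fun A hA => h A (hm A hA)
  have h2 := (ae_ball_iff hC).2 fun A hA => h' A (hm A hA)
  filter_upwards [h1, h2] with ω hω hω'
  exact ext_of_generate_finite C hgen hpi
    (fun A hA => tendsto_nhds_unique (hω A hA) (hω' A hA)) (by simp)

theorem IsStandardSystem.isMarkovKernel_limitMeasure (h : IsStandardSystem μ η ν π β) :
    IsMarkovKernel (limitMeasure μ η) := by
  have hex : ∃ κ : Kernel (ℕ → G) X, IsMarkovKernel κ ∧ IsLimitMeasure μ η κ :=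
    ⟨_, inferInstance, h.isLimitMeasure⟩
  have hl : limitMeasure μ η = hex.choose := dif_pos hex
  rw [hl]
  exact hex.choose_spec.1

/-- The conditional measure `η_ω` of a standard system is `η^{β(ω)}`. -/
theorem IsStandardSystem.limitMeasure_ae_eq (h : IsStandardSystem μ η ν π β) :
    limitMeasure μ η =ᵐ[walkLaw μ] (disintegration η π).comap β h.boundary.measurable := by
  have hex : ∃ κ : Kernel (ℕ → G) X, IsMarkovKernel κ ∧ IsLimitMeasure μ η κ :=
    ⟨_, inferInstance, h.isLimitMeasure⟩
  have hl : limitMeasure μ η = hex.choose := dif_pos hex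
  have := hex.choose_spec.1
  rw [hl]
  exact hex.choose_spec.2.ae_eq h.isLimitMeasure

theorem IsStandardSystem.joining_eq (h : IsStandardSystem μ η ν π β) :
    joining μ η =
      (walkLaw μ ⊗ₘ (disintegration η π).comap β h.boundary.measurable).map Prod.swap := by
  have := h.isMarkovKernel_limitMeasure
  rw [joining, Measure.compProd_congr h.limitMeasure_ae_eq]

theorem IsStandardSystem.lintegral_joining (h : IsStandardSystem μ η ν π β)
    {f : X × (ℕ → G) → ℝ≥0∞} (hf : Measurable f) :
    ∫⁻ p, f p ∂joining μ η =
      ∫⁻ ω, ∫⁻ x, f (x, ω) ∂disintegration η π (β ω) ∂walkLaw μ := by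
  rw [h.joining_eq, lintegral_map hf measurable_swap]
  exact Measure.lintegral_compProd (hf.comp measurable_swap)

theorem IsStandardSystem.isProbabilityMeasure_joining (h : IsStandardSystem μ η ν π β) :
    IsProbabilityMeasure (joining μ η) := by
  rw [h.joining_eq]
  exact Measure.isProbabilityMeasure_map measurable_swap.aemeasurable

theorem IsStandardSystem.map_boundary (h : IsStandardSystem μ η ν π β) :
    (walkLaw μ).map β = ν := by
  have := h.isProbabilityMeasure
  refine h.boundary.map_eq ?_
  have hs : Measurable fun p : G × Y => p.1 • p.2 := measurable_smul
  have hs' : Measurable fun p : G × X => p.1 • p.2 := measurable_smul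
  conv_rhs => rw [← h.factor.map_eq, ← h.stationary.stationary,
    Measure.map_map h.factor.measurable hs']
  rw [← h.factor.map_eq]
  conv_lhs => rw [← Measure.map_id (μ := μ), Measure.map_prod_map _ _ measurable_id
    h.factor.measurable, Measure.map_map hs (measurable_id.prodMap h.factor.measurable)]
  congr 1
  funext p
  exact (h.factor.equivariant p.1 p.2).symm

end Conditional

/-! ### Doob transformed walks -/

section Doob

variable {G : Type*} [Group G] [TopologicalSpace G] [IsTopologicalGroup G]
  [PolishSpace G] [MeasurableSpace G] [BorelSpace G]
  {X : Type*} [MeasurableSpace X] [StandardBorelSpace X] [Nonempty X]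
  [MulAction G X] [MeasurableSMul₂ G X]
  {Y : Type*} [MeasurableSpace Y] [StandardBorelSpace Y] [MulAction G Y] [MeasurableSMul₂ G Y]
  {μ : Measure G} [IsProbabilityMeasure μ] {η : Measure X} [IsProbabilityMeasure η]
  {ν : Measure Y} {π : X → Y} {β : (ℕ → G) → Y}

theorem IsStandardSystem.lintegral_doobLaw (h : IsStandardSystem μ η ν π β)
    {F : Y × (ℕ → G) → ℝ≥0∞} (hF : Measurable F) :
    ∫⁻ ω, F (β ω, ω) ∂walkLaw μ = ∫⁻ y, ∫⁻ ω, F (y, ω) ∂doobLaw μ β y ∂ν := by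
  have h1 := compProd_map_condDistrib (X := β) (Y := id) (μ := walkLaw μ)
    (mβ := inferInstance) aemeasurable_id
  have := h.isProbabilityMeasure
  rw [h.map_boundary] at h1
  rw [← Measure.lintegral_compProd hF, doobLaw, h1,
    lintegral_map hF (h.boundary.measurable.prodMk measurable_id)]
  rfl

/-- The law of the conditional walk over a point of `X`. -/
theorem IsStandardSystem.joining_eq_compProd (h : IsStandardSystem μ η ν π β) :
    joining μ η = η ⊗ₘ (doobLaw μ β).comap π h.factor.measurable := by
  have := h.isProbabilityMeasure
  refine Measure.ext_of_lintegral _ fun f hf => ?_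
  have h1 : Measurable fun q : Y × (ℕ → G) => ∫⁻ x, f (x, q.2) ∂disintegration η π q.1 :=
    Measurable.lintegral_kernel_prod_right' (κ := (disintegration η π).comap Prod.fst measurable_fst)
      (f := fun r : (Y × (ℕ → G)) × X => f (r.2, r.1.2)) (by fun_prop)
  have h2 : Measurable fun q : Y × X => ∫⁻ ω, f (q.2, ω) ∂doobLaw μ β q.1 :=
    Measurable.lintegral_kernel_prod_right' (κ := (doobLaw μ β).comap Prod.fst measurable_fst)
      (f := fun r : (Y × X) × (ℕ → G) => f (r.1.2, r.2)) (by fun_prop)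
  rw [h.lintegral_joining hf, Measure.lintegral_compProd hf]
  simp only [Kernel.comap_apply]
  rw [h.lintegral_doobLaw h1, lintegral_disintegration h.factor h2]
  refine lintegral_congr fun y => ?_
  -- Given the boundary point `y`, the point of `X` and the trajectory are independent.
  exact lintegral_lintegral_swap (μ := doobLaw μ β y) (ν := disintegration η π y)
    (f := fun ω x => f (x, ω)) (hf.comp measurable_swap).aemeasurable

theorem IsStandardSystem.lintegral_joining_fibre (h : IsStandardSystem μ η ν π β)
    {f : X × (ℕ → G) → ℝ≥0∞} (hf : Measurable f) :
    ∫⁻ p, f p ∂joining μ η = ∫⁻ x, ∫⁻ ω, f (x, ω) ∂doobLaw μ β (π x) ∂η := by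
  rw [h.joining_eq_compProd, Measure.lintegral_compProd hf]
  rfl

/-- The first step decomposition of the joining. -/
theorem IsStandardSystem.lintegral_joining_step (h : IsStandardSystem μ η ν π β)
    {f : G × (X × (ℕ → G)) → ℝ≥0∞} (hf : Measurable f) :
    ∫⁻ p, f (p.2 0, pathShift p) ∂joining μ η =
      ∫⁻ g, ∫⁻ p, f (g, diagAction g p) ∂joining μ η ∂μ := by
  have := h.isProbabilityMeasure
  have hf0 : Measurable fun p : X × (ℕ → G) => f (p.2 0, pathShift p) :=
    hf.comp (((measurable_pi_apply 0).comp measurable_snd).prodMk measurable_pathShift)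
  have hd : ∀ g : G, Measurable (diagAction g : X × (ℕ → G) → _) := fun g =>
    ((measurable_const_smul g).comp measurable_fst).prodMk
      (measurable_pi_lambda _ fun n => measurable_const.mul
        ((measurable_pi_apply n).comp measurable_snd))
  have hm : Measurable fun ω : ℕ → G =>
      ∫⁻ x, f (ω 0, pathShift (x, ω)) ∂disintegration η π (β ω) :=
    Measurable.lintegral_kernel_prod_right' (κ := (disintegration η π).comap β h.boundary.measurable)
      (f := fun r : (ℕ → G) × X => f (r.1 0, pathShift (r.2, r.1))) (hf0.comp measurable_swap)
  rw [h.lintegral_joining hf0, lintegral_walkLaw μ hm]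
  refine lintegral_congr_ae ?_
  filter_upwards [h.boundary.ae_consPath] with g hg
  have hfg : Measurable fun p : X × (ℕ → G) => f (g, diagAction g p) :=
    hf.comp (measurable_const.prodMk (hd g))
  rw [h.lintegral_joining hfg]
  -- After the step `g` the boundary point is `g • β ω`, and the fibre measure there is the
  -- `g`-image of the one at `β ω`; together they produce the diagonal action.
  have h3 := h.measurePreserving g
  rw [← h.map_boundary] at h3
  refine lintegral_congr_ae ?_
  filter_upwards [hg, ae_of_ae_map h.boundary.measurable.aemeasurable h3] with ω h1 h2
  rw [h1, ← h2, lintegral_map _ (measurable_const_smul g)]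
  · rfl
  · exact hf0.comp (measurable_id.prodMk
      (measurable_const (a := consPath g fun n => g * ω n)))

/-- The Markov property of the conditional walks: after a first step `g` the walk conditioned to
converge to `y` is the `g`-translate of the walk conditioned to converge to `g⁻¹ • y`. -/
theorem IsStandardSystem.ae_doobLaw_step (h : IsStandardSystem μ η ν π β) :
    ∀ᵐ y ∂ν, ∀ f : G × (ℕ → G) → ℝ≥0∞, Measurable f →
      ∫⁻ ω, f (ω 0, fun n => ω (n + 1)) ∂doobLaw μ β y =
        ∫⁻ ω, ∫⁻ ω', f (ω 0, fun n => ω 0 * ω' n) ∂doobLaw μ β ((ω 0)⁻¹ • y) ∂doobLaw μ β y := by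
  have := h.isProbabilityMeasure
  have hs : Measurable fun p : Y × (ℕ → G) => (p.2 0)⁻¹ • p.1 :=
    Measurable.smul ((measurable_pi_apply 0).comp measurable_snd).inv measurable_fst
  have hT : Measurable fun ω : ℕ → G => (ω 0, fun n => ω (n + 1)) :=
    (measurable_pi_apply 0).prodMk (measurable_pi_lambda _ fun n => measurable_pi_apply (n + 1))
  have hT' : Measurable fun p : (Y × (ℕ → G)) × (ℕ → G) =>
      (p.1.2 0, fun n => p.1.2 0 * p.2 n) := by fun_prop
  let κ' : Kernel Y (G × (ℕ → G)) :=
    (doobLaw μ β ⊗ₖ (doobLaw μ β).comap _ hs).map fun p => (p.1 0, fun n => p.1 0 * p.2 n)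
  have hT'' : Measurable fun p : (ℕ → G) × (ℕ → G) =>
      (p.1 0, fun n => p.1 0 * p.2 n) := by fun_prop
  have hκ' : IsMarkovKernel κ' := Kernel.IsMarkovKernel.map _ hT''
  -- By uniqueness of disintegrations it suffices to compare the two kernels after integration over
  -- `ν`, where the Doob laws reassemble into the unconditioned walk.
  have key : ν ⊗ₘ (doobLaw μ β).map (fun ω : ℕ → G => (ω 0, fun n => ω (n + 1))) = ν ⊗ₘ κ' := by
    have := Kernel.IsMarkovKernel.map (doobLaw μ β) hT
    refine Measure.ext_of_lintegral _ fun f hf => ?_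
    rw [Measure.lintegral_compProd hf, Measure.lintegral_compProd hf]
    have hl : ∀ y, ∫⁻ q, f (y, q) ∂(doobLaw μ β).map (fun ω => (ω 0, fun n => ω (n + 1))) y =
        ∫⁻ ω, f (y, ω 0, fun n => ω (n + 1)) ∂doobLaw μ β y := fun y =>
      Kernel.lintegral_map _ hT _ (hf.comp measurable_prodMk_left)
    have hr : ∀ y, ∫⁻ q, f (y, q) ∂κ' y =
        ∫⁻ ω, ∫⁻ ω', f (y, ω 0, fun n => ω 0 * ω' n) ∂doobLaw μ β ((ω 0)⁻¹ • y) ∂doobLaw μ β y :=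
      fun y => (Kernel.lintegral_map _ hT'' _ (hf.comp measurable_prodMk_left)).trans
        (Kernel.lintegral_compProd _ _ _ ((hf.comp measurable_prodMk_left).comp hT''))
    simp_rw [hl, hr]
    have hm1 : Measurable fun p : Y × (ℕ → G) => f (p.1, p.2 0, fun n => p.2 (n + 1)) :=
      hf.comp (measurable_fst.prodMk (hT.comp measurable_snd))
    have hm2 : Measurable fun p : Y × (ℕ → G) =>
        ∫⁻ ω', f (p.1, p.2 0, fun n => p.2 0 * ω' n) ∂doobLaw μ β ((p.2 0)⁻¹ • p.1) :=
      Measurable.lintegral_kernel_prod_right' (κ := (doobLaw μ β).comap _ hs)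
        (f := fun r : (Y × (ℕ → G)) × (ℕ → G) => f (r.1.1, r.1.2 0, fun n => r.1.2 0 * r.2 n))
        (hf.comp ((measurable_fst.comp measurable_fst).prodMk hT'))
    have hβ : Measurable fun ω : ℕ → G => (β ω, ω) := h.boundary.measurable.prodMk measurable_id
    rw [← h.lintegral_doobLaw hm1, ← h.lintegral_doobLaw hm2]
    refine (lintegral_walkLaw μ (hm1.comp hβ)).trans
      (Eq.trans ?_ (lintegral_walkLaw μ (hm2.comp hβ)).symm)
    refine lintegral_congr_ae ?_
    filter_upwards [h.boundary.ae_consPath] with g hg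
    have hm3 : Measurable fun p : Y × (ℕ → G) => f (g • p.1, g, fun n => g * p.2 n) := by
      refine hf.comp (((measurable_const_smul g).comp measurable_fst).prodMk ?_)
      fun_prop
    have hm4 : Measurable fun y : Y =>
        ∫⁻ ω', f (g • y, g, fun n => g * ω' n) ∂doobLaw μ β y :=
      Measurable.lintegral_kernel_prod_right' hm3
    calc ∫⁻ ω, f (β (consPath g fun n => g * ω n), g, fun n => g * ω n) ∂walkLaw μ
        = ∫⁻ ω, f (g • β ω, g, fun n => g * ω n) ∂walkLaw μ := by
          refine lintegral_congr_ae ?_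
          filter_upwards [hg] with ω hω
          rw [hω]
      _ = ∫⁻ y, ∫⁻ ω', f (g • y, g, fun n => g * ω' n) ∂doobLaw μ β y ∂ν :=
          h.lintegral_doobLaw hm3
      _ = ∫⁻ ω, ∫⁻ ω', f (g • β ω, g, fun n => g * ω' n) ∂doobLaw μ β (β ω) ∂walkLaw μ := by
          conv_lhs => rw [← h.map_boundary]
          rw [lintegral_map hm4 h.boundary.measurable]
      _ = ∫⁻ ω, ∫⁻ ω', f (β (consPath g fun n => g * ω n), g, fun n => g * ω' n)
            ∂doobLaw μ β (g⁻¹ • β (consPath g fun n => g * ω n)) ∂walkLaw μ := by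
          refine lintegral_congr_ae ?_
          filter_upwards [hg] with ω hω
          rw [hω, inv_smul_smul]
  filter_upwards [Kernel.ae_eq_of_compProd_eq key] with y hy f hf
  have h1 : ∫⁻ q, f q ∂(doobLaw μ β).map (fun ω : ℕ → G => (ω 0, fun n => ω (n + 1))) y =
      ∫⁻ q, f q ∂κ' y := by rw [hy]
  rw [Kernel.lintegral_map _ hT _ hf, Kernel.lintegral_map _ hT'' _ hf] at h1
  exact h1.trans (Kernel.lintegral_compProd _ _ _ (hf.comp hT''))

end Doob

/-! ### Tail sets are invariant modulo null sets -/

section TailInvariant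

variable {G : Type*} [Group G] [TopologicalSpace G] [IsTopologicalGroup G]
  [SecondCountableTopology G] [MeasurableSpace G] [BorelSpace G]
  {X : Type*} [MeasurableSpace X] [MulAction G X] [MeasurableSMul₂ G X]

theorem diagAction_mul (g h : G) (p : X × (ℕ → G)) :
    diagAction (g * h) p = diagAction g (diagAction h p) := by
  simp only [diagAction, mul_smul, mul_assoc]

theorem diagAction_one (p : X × (ℕ → G)) : diagAction (1 : G) p = p := by
  simp only [diagAction, one_smul, one_mul]

theorem measurable_diagAction_uncurry :
    Measurable fun q : G × (X × (ℕ → G)) => diagAction q.1 q.2 := by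
  refine (measurable_fst.smul (measurable_fst.comp measurable_snd)).prodMk ?_
  fun_prop

theorem measurable_diagAction (g : G) :
    Measurable (diagAction g : X × (ℕ → G) → X × (ℕ → G)) :=
  measurable_diagAction_uncurry.comp measurable_prodMk_left

/-- The first step decomposition of a measure on `X × G^ℕ`. -/
def HasFirstStep (μ : Measure G) (Q : Measure (X × (ℕ → G))) : Prop :=
  ∀ f : G × (X × (ℕ → G)) → ℝ≥0∞, Measurable f →
    ∫⁻ p, f (p.2 0, pathShift p) ∂Q = ∫⁻ g, ∫⁻ p, f (g, diagAction g p) ∂Q ∂μ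

variable {μ : Measure G} [IsProbabilityMeasure μ] {Q : Measure (X × (ℕ → G))}
  [IsProbabilityMeasure Q]

theorem measurable_map_diagAction_apply {A : Set (X × (ℕ → G))} (hA : MeasurableSet A) :
    Measurable fun g : G => (Q.map (diagAction g)) A := by
  simp_rw [Measure.map_apply (measurable_diagAction _) hA]
  exact measurable_measure_prodMk_left (measurable_diagAction_uncurry hA)

/-- The translate `g` absorbs the step `h`, while `D` is read on the path with the position `g * h`
put back in front. This form serves the induction over cylinder sets. -/
theorem HasFirstStep.map_apply_inter (hQ : HasFirstStep μ Q) (g : G)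
    {A D : Set (X × (ℕ → G))} (hA : MeasurableSet A) (hD : MeasurableSet D) :
    (Q.map (diagAction g)) (pathShift ⁻¹' A ∩ D) =
      ∫⁻ h, (Q.map (diagAction (g * h))) (A ∩ {p | (p.1, consPath (g * h) p.2) ∈ D}) ∂μ := by
  have hc : Measurable fun q : G × (X × (ℕ → G)) => (q.2.1, consPath (g * q.1) q.2.2) :=
    (measurable_fst.comp measurable_snd).prodMk (measurable_consPath.comp
      ((measurable_const.mul measurable_fst).prodMk (measurable_snd.comp measurable_snd)))
  have hd : Measurable fun q : G × (X × (ℕ → G)) => (q.1, diagAction g q.2) :=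
    measurable_fst.prodMk ((measurable_diagAction g).comp measurable_snd)
  have hE : MeasurableSet {q : G × (X × (ℕ → G)) | diagAction g q.2 ∈ A ∧
      ((diagAction g q.2).1, consPath (g * q.1) (diagAction g q.2).2) ∈ D} :=
    ((measurable_diagAction g).comp measurable_snd hA).inter ((hc.comp hd) hD)
  have h := hQ _ (measurable_one.indicator hE)
  have hl : MeasurableSet (pathShift ⁻¹' A ∩ D) := (measurable_pathShift hA).inter hD
  have hr : ∀ h : G, MeasurableSet (A ∩ {p | (p.1, consPath (g * h) p.2) ∈ D}) := fun h =>
    hA.inter ((hc.comp (measurable_prodMk_left (x := h))) hD)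
  rw [Measure.map_apply (measurable_diagAction g) hl,
    ← lintegral_indicator_one (measurable_diagAction g hl)]
  have hrw : ∀ h : G, (Q.map (diagAction (g * h))) (A ∩ {p | (p.1, consPath (g * h) p.2) ∈ D}) =
      ∫⁻ p, (diagAction (g * h) ⁻¹' (A ∩ {p | (p.1, consPath (g * h) p.2) ∈ D})).indicator 1 p ∂Q :=
    fun h => by
      rw [Measure.map_apply (measurable_diagAction _) (hr h),
        lintegral_indicator_one (measurable_diagAction _ (hr h))]
  simp_rw [hrw]
  refine Eq.trans (lintegral_congr fun p => ?_) (h.trans (lintegral_congr fun h =>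
    lintegral_congr fun p => ?_))
  · have e : diagAction g p = ((diagAction g (pathShift p)).1,
        consPath (g * p.2 0) (diagAction g (pathShift p)).2) :=
      Prod.ext rfl (consPath_self (diagAction g p).2).symm
    refine Set.indicator_eq_indicator ?_ rfl
    change (_ ∧ diagAction g p ∈ D) ↔ _
    rw [e]
    rfl
  · refine Set.indicator_eq_indicator ?_ rfl
    rw [Set.mem_preimage, diagAction_mul]
    exact Iff.rfl

theorem HasFirstStep.map_apply_preimage (hQ : HasFirstStep μ Q) (g : G)
    {A : Set (X × (ℕ → G))} (hA : MeasurableSet A) :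
    (Q.map (diagAction g)) (pathShift ⁻¹' A) = ∫⁻ h, (Q.map (diagAction (g * h))) A ∂μ := by
  have h := hQ.map_apply_inter g hA MeasurableSet.univ
  simpa using h

/-- For every `k` the function being averaged is the same and only the convolution power changes;
this is how (T) comes to bear on tail sets. -/
theorem HasFirstStep.map_apply_preimage_iterate (hQ : HasFirstStep μ Q) (k : ℕ) (g : G)
    {A : Set (X × (ℕ → G))} (hA : MeasurableSet A) :
    (Q.map (diagAction g)) (pathShift^[k] ⁻¹' A) =
      ∫⁻ h, (Q.map (diagAction (g * h))) A ∂convPow μ k := by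
  induction k generalizing A with
  | zero =>
    have hm : Measurable fun h : G => (Q.map (diagAction (g * h))) A :=
      (measurable_map_diagAction_apply hA).comp (measurable_const_mul g)
    rw [convPow, lintegral_dirac' _ hm, mul_one, Function.iterate_zero, Set.preimage_id]
  | succ k ih =>
    have hm : Measurable fun h : G => (Q.map (diagAction (g * h))) A :=
      (measurable_map_diagAction_apply hA).comp (measurable_const_mul g)
    have hAS := measurable_pathShift (X := X) (G := G) hA
    rw [Function.iterate_succ', Set.preimage_comp, ih hAS, convPow, Measure.lintegral_mconv hm]
    refine lintegral_congr fun h => ?_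
    rw [hQ.map_apply_preimage _ hA]
    simp only [mul_assoc]

theorem pathShift_iterate_preimage (L : SubgroupField G X) (k : ℕ) {A : Set (X × (ℕ → G))}
    (hA : MeasurableSet[globalTail L] A) :
    ∃ A', MeasurableSet[globalTail L] A' ∧ pathShift^[k] ⁻¹' A' = A := by
  induction k generalizing A with
  | zero => exact ⟨A, hA, rfl⟩
  | succ k ih =>
    obtain ⟨A', hA', h⟩ := ih hA
    refine ⟨_, measurableSet_globalTail_consPath L hA', ?_⟩
    rw [Function.iterate_succ', Set.preimage_comp, preimage_pathShift_consPath L hA', h]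

variable (L : SubgroupField G X) {A : Set (X × (ℕ → G))}

/-- Write `A` as the `N`-fold shift preimage of a tail set `A'`; its own shift preimage is then the
`(N + 1)`-fold one. The two measures are integrals of one `[0, 1]`-valued function against
consecutive convolution powers, as close as desired for suitable `N`. -/
theorem HasFirstStep.map_pathShift_globalTail (hQ : HasFirstStep μ Q) (hT : TailAssumption μ)
    (hA : MeasurableSet[globalTail L] A) (g : G) :
    (Q.map (diagAction g)) A = (Q.map (diagAction g)) (pathShift ⁻¹' A) := by
  have hp : ∀ g : G, IsProbabilityMeasure (Q.map (diagAction g)) := fun g =>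
    Measure.isProbabilityMeasure_map (measurable_diagAction g).aemeasurable
  rw [← ENNReal.toReal_eq_toReal_iff' (measure_ne_top _ _) (measure_ne_top _ _)]
  refine eq_of_abs_sub_le_all fun ε hε => ?_
  obtain ⟨N, hN⟩ := hT.exists_abs_integral_sub_le hε
  obtain ⟨A', hA', hAA⟩ := pathShift_iterate_preimage L N hA
  have hA'm := globalTail_le L _ hA'
  have hm : Measurable fun h : G => (Q.map (diagAction (g * h))) A' :=
    (measurable_map_diagAction_apply hA'm).comp (measurable_const_mul g)
  have hint : ∀ k, ((Q.map (diagAction g)) (pathShift^[k] ⁻¹' A')).toReal =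
      ∫ h, ((Q.map (diagAction (g * h))) A').toReal ∂convPow μ k := fun k => by
    rw [hQ.map_apply_preimage_iterate k g hA'm, integral_toReal hm.aemeasurable
      (ae_of_all _ fun h => measure_lt_top _ _)]
  have h1 := hint N
  have h2 := hint (N + 1)
  rw [hAA] at h1
  rw [Function.iterate_succ, Set.preimage_comp, hAA] at h2
  rw [h1, h2]
  refine hN _ hm.ennreal_toReal fun h => ?_
  rw [Real.norm_eq_abs, abs_of_nonneg ENNReal.toReal_nonneg]
  exact measureReal_le_one

theorem measurableSet_globalTail_fst {E : Set X} (hE : MeasurableSet E) :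
    MeasurableSet[globalTail L] (Prod.fst ⁻¹' E : Set (X × (ℕ → G))) :=
  MeasurableSpace.measurableSet_iInf.2 fun _ => ⟨Prod.fst ⁻¹' E, measurable_fst hE, rfl⟩

/-- Equal measure does not yet mean equality up to null sets, so the comparison is made inside every
cylinder `D`. The induction is on the number of positions `D` sees, with one step of the walk used
up each time; it needs all translates `g` and all tail sets at once. -/
theorem HasFirstStep.map_inter_globalTail (hQ : HasFirstStep μ Q) (hT : TailAssumption μ) (m : ℕ)
    (hA : MeasurableSet[globalTail L] A) (g : G) {D : Set (X × (ℕ → G))} (hD : MeasurableSet D)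
    (hDm : ∀ p p' : X × (ℕ → G), p.1 = p'.1 → (∀ i < m, p.2 i = p'.2 i) → p ∈ D → p' ∈ D) :
    (Q.map (diagAction g)) (A ∩ D) = (Q.map (diagAction g)) (pathShift ⁻¹' A ∩ D) := by
  induction m generalizing A g D with
  | zero =>
    -- A set seeing no position depends on `x` alone, so it is itself a tail set and shift
    -- invariant; the constant path is a filler.
    have hE : MeasurableSet {x : X | (x, fun _ : ℕ => (1 : G)) ∈ D} :=
      measurable_prodMk_right hD
    have hDE : D = Prod.fst ⁻¹' {x : X | (x, fun _ : ℕ => (1 : G)) ∈ D} := by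
      ext p
      exact ⟨fun h => hDm p (p.1, fun _ => 1) rfl (by simp) h,
        fun h => hDm (p.1, fun _ => 1) p rfl (by simp) h⟩
    have hD' : MeasurableSet[globalTail L] D := hDE ▸ measurableSet_globalTail_fst L hE
    have hDS : pathShift ⁻¹' D = D := by
      conv_lhs => rw [hDE]
      conv_rhs => rw [hDE]
      rfl
    rw [hQ.map_pathShift_globalTail L hT (MeasurableSet.inter hA hD') g, Set.preimage_inter, hDS]
  | succ m ih =>
    have hσ := measurableSet_globalTail_consPath L hA
    have hAm := globalTail_le L _ hA
    rw [hQ.map_apply_inter g hAm hD]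
    -- Writing `A` as the shift preimage of its prepended version makes both sides advance by one
    -- step, leaving that version and its own shift preimage `A` to be compared.
    conv_lhs => rw [← preimage_pathShift_consPath L hA]
    rw [hQ.map_apply_inter g (globalTail_le L _ hσ) hD]
    refine lintegral_congr fun h => ?_
    have hc : Measurable fun p : X × (ℕ → G) => (p.1, consPath (g * h) p.2) :=
      measurable_fst.prodMk (measurable_consPath.comp (measurable_const.prodMk measurable_snd))
    refine (ih hσ (g * h) (hc hD) ?_).trans (by rw [preimage_pathShift_consPath L hA]; rfl)
    intro p p' h1 h2
    refine hDm _ _ h1 fun i hi => ?_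
    cases i with
    | zero => rfl
    | succ i => exact h2 i (Nat.lt_of_succ_lt_succ hi)

/-- Tail sets are invariant under the shift of the trajectory up to null sets. -/
theorem HasFirstStep.preimage_pathShift_ae_eq (hQ : HasFirstStep μ Q) (hT : TailAssumption μ)
    (hA : MeasurableSet[globalTail L] A) : A =ᵐ[Q] pathShift ⁻¹' A := by
  have hAm := globalTail_le L _ hA
  have hAS := measurable_pathShift hAm
  let C : Set (Set (X × (ℕ → G))) := {D | MeasurableSet D ∧ ∃ m : ℕ, ∀ p p' : X × (ℕ → G),
    p.1 = p'.1 → (∀ i < m, p.2 i = p'.2 i) → p ∈ D → p' ∈ D}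
  have hpi : IsPiSystem C := by
    rintro D ⟨hD, m, hm⟩ D' ⟨hD', m', hm'⟩ -
    refine ⟨hD.inter hD', max m m', fun p p' h1 h2 hp => ⟨?_, ?_⟩⟩
    · exact hm p p' h1 (fun i hi => h2 i (lt_max_of_lt_left hi)) hp.1
    · exact hm' p p' h1 (fun i hi => h2 i (lt_max_of_lt_right hi)) hp.2
  have hgen : (inferInstance : MeasurableSpace (X × (ℕ → G))) =
      MeasurableSpace.generateFrom C := by
    refine le_antisymm (sup_le ?_ ?_) (MeasurableSpace.generateFrom_le fun D hD => hD.1)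
    · rintro _ ⟨E, hE, rfl⟩
      refine MeasurableSpace.measurableSet_generateFrom ⟨measurable_fst hE, 0, fun p p' h _ hp => ?_⟩
      rw [Set.mem_preimage] at hp ⊢
      rwa [← h]
    · change MeasurableSpace.comap Prod.snd (⨆ n, MeasurableSpace.comap (fun ω : ℕ → G => ω n) _) ≤ _
      rw [MeasurableSpace.comap_iSup]
      refine iSup_le fun n => ?_
      rw [MeasurableSpace.comap_comp]
      rintro _ ⟨E, hE, rfl⟩
      have hm : Measurable fun p : X × (ℕ → G) => p.2 n :=
        (measurable_pi_apply n).comp measurable_snd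
      refine MeasurableSpace.measurableSet_generateFrom ⟨hm hE, n + 1, fun p p' _ h hp => ?_⟩
      have := h n (Nat.lt_succ_self n)
      simp only [Set.mem_preimage, Function.comp] at hp ⊢
      rwa [← this]
  have hid : Q.map (diagAction (1 : G)) = Q := by
    have : (diagAction (1 : G) : X × (ℕ → G) → _) = id := funext diagAction_one
    rw [this, Measure.map_id]
  -- The two restrictions agree on cylinders, hence everywhere; evaluating them on the differences
  -- of the two sets shows that these are null.
  have hr : Q.restrict A = Q.restrict (pathShift ⁻¹' A) := by
    refine ext_of_generate_finite C hgen hpi (fun D hD => ?_) ?_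
    · have := hQ.map_inter_globalTail L hT hD.2.choose hA 1 hD.1 hD.2.choose_spec
      rw [Measure.restrict_apply hD.1, Measure.restrict_apply hD.1, Set.inter_comm D,
        Set.inter_comm D]
      rwa [hid] at this
    · have := hQ.map_pathShift_globalTail L hT hA 1
      rwa [hid, ← Measure.restrict_apply_univ A, ← Measure.restrict_apply_univ (pathShift ⁻¹' A)]
        at this
  have e : ∀ E E' : Set (X × (ℕ → G)), MeasurableSet E → MeasurableSet E' →
      Q.restrict E = Q.restrict E' → Q (E \ E') = 0 := fun E E' hE hE' h => by
    have h1 : Q.restrict E (E \ E') = Q.restrict E' (E \ E') := by rw [h]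
    rwa [Measure.restrict_apply (hE.diff hE'), Measure.restrict_apply (hE.diff hE'),
      Set.inter_eq_left.2 Set.sdiff_subset, Set.sdiff_inter_self, measure_empty] at h1
  refine ae_eq_set.2 ⟨e _ _ hAm hAS hr, e _ _ hAS hAm hr.symm⟩

theorem measurableSet_globalTail_iterate (hA : MeasurableSet[globalTail L] A) (k : ℕ) :
    MeasurableSet[globalTail L] (pathShift^[k] ⁻¹' A) := by
  induction k generalizing A with
  | zero => exact hA
  | succ k ih =>
    rw [Function.iterate_succ', Set.preimage_comp]
    exact ih (measurableSet_globalTail_pathShift L hA)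

theorem HasFirstStep.exists_invariant_ae_eq (hQ : HasFirstStep μ Q) (hT : TailAssumption μ)
    (hA : MeasurableSet[globalTail L] A) :
    ∃ A', MeasurableSet[globalTail L] A' ∧ pathShift ⁻¹' A' = A' ∧ A =ᵐ[Q] A' := by
  have hk : ∀ k : ℕ, A =ᵐ[Q] pathShift^[k] ⁻¹' A := fun k => by
    induction k with
    | zero => exact Filter.EventuallyEq.rfl
    | succ k ih =>
      have h := hQ.preimage_pathShift_ae_eq L hT (measurableSet_globalTail_iterate L hA k)
      rw [← Set.preimage_comp, ← Function.iterate_succ] at h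
      exact ih.trans h
  -- The limsup of the shift preimages is exactly invariant, and equals `A` up to a null set because
  -- each preimage does.
  refine ⟨⋂ n, ⋃ k, pathShift^[n + k] ⁻¹' A, ?_, ?_, ?_⟩
  · exact MeasurableSet.iInter fun n => MeasurableSet.iUnion fun k =>
      measurableSet_globalTail_iterate L hA (n + k)
  · simp only [Set.preimage_iInter, Set.preimage_iUnion, ← Set.preimage_comp,
      ← Function.iterate_succ]
    ext p
    simp only [Set.mem_iInter, Set.mem_iUnion]
    constructor
    · intro h n
      obtain ⟨k, hk⟩ := h n
      exact ⟨k + 1, hk⟩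
    · intro h n
      obtain ⟨k, hk⟩ := h (n + 1)
      refine ⟨k, ?_⟩
      rwa [Nat.succ_eq_add_one, add_right_comm]
  · have h1 : (⋂ _ : ℕ, ⋃ _ : ℕ, A) = A := by rw [Set.iInter_const, Set.iUnion_const]
    conv_lhs => rw [← h1]
    exact Filter.EventuallyEq.countable_iInter fun n => Filter.EventuallyEq.countable_iUnion fun k => hk (n + k)

end TailInvariant

/-- Every tail set of the coset trajectories is, up to a null set, pulled back from the Poisson
bundle. -/
theorem IsPoissonBundle.exists_ae_eq_preimage {G : Type*} [Group G] [TopologicalSpace G]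
    [IsTopologicalGroup G] [PolishSpace G] [MeasurableSpace G] [BorelSpace G]
    {X : Type*} [MeasurableSpace X] [StandardBorelSpace X] [Nonempty X]
    [MulAction G X] [MeasurableSMul₂ G X]
    {Y : Type*} [MeasurableSpace Y] [StandardBorelSpace Y] [MulAction G Y] [MeasurableSMul₂ G Y]
    {Z : Type*} [MeasurableSpace Z] [MulAction G Z]
    {μ : Measure G} [IsProbabilityMeasure μ] {η : Measure X} [IsProbabilityMeasure η]
    {ν : Measure Y} {π : X → Y} {β : (ℕ → G) → Y} {L : SubgroupField G X} {lam : Measure Z}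
    {θ : CosetTrajectories L → Z} (hZ : IsPoissonBundle μ η L lam θ)
    (h : IsStandardSystem μ η ν π β) (hT : TailAssumption μ)
    {A : Set (X × (ℕ → G))} (hA : MeasurableSet[globalTail L] A) :
    ∃ B : Set Z, MeasurableSet B ∧ A =ᵐ[joining μ η] (fun p => θ (toCosets L p)) ⁻¹' B := by
  have := h.isProbabilityMeasure_joining
  have hQ : HasFirstStep μ (joining μ η) := fun f hf => h.lintegral_joining_step hf
  obtain ⟨A', hA', hinv, hAA⟩ := hQ.exists_invariant_ae_eq L hT hA
  obtain ⟨A'', hA'', hpre⟩ := exists_invariant_of_globalTail L hA' hinv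
  obtain ⟨B, hB, hAB⟩ := hZ.generates A'' hA''
  refine ⟨B, hB, hAA.trans ?_⟩
  have h1 : toCosets L ⁻¹' A'' =ᵐ[joining μ η] toCosets L ⁻¹' (θ ⁻¹' B) :=
    ae_of_ae_map (measurable_toCosets L).aemeasurable hAB
  rw [hpre] at h1
  exact h1

/-! ### Conditional laws of the first step -/

theorem compProd_map_of_condExpKernel_map {Ω B W : Type*} {m : MeasurableSpace Ω}
    [mΩ : MeasurableSpace Ω] [StandardBorelSpace Ω] [MeasurableSpace B] [MeasurableSpace W]
    (P : Measure Ω) [IsProbabilityMeasure P] (hm : m ≤ mΩ) {z : Ω → W} (hz : Measurable[m] z)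
    {Y : Ω → B} (hY : Measurable Y) (κ : Kernel W B) [IsMarkovKernel κ]
    (h : ∀ᵐ ω ∂P, (condExpKernel P m ω).map Y = κ (z ω)) :
    P.map z ⊗ₘ κ = P.map fun ω => (z ω, Y ω) := by
  have hz' : Measurable z := hz.mono hm le_rfl
  have : IsProbabilityMeasure (P.map z) := Measure.isProbabilityMeasure_map hz'.aemeasurable
  refine Measure.ext_prod fun {s t} hs ht => ?_
  have h1 := congrArg (fun M => M ((z ⁻¹' s) ×ˢ (Y ⁻¹' t)))
    (compProd_trim_condExpKernel (μ := P) hm)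
  have hzs : MeasurableSet[m] (z ⁻¹' s) := hz hs
  have hd : @Measurable _ _ mΩ (m.prod mΩ) (Function.diag : Ω → Ω × Ω) :=
    (measurable_id'' hm).prodMk measurable_id
  have h2 : Function.diag ⁻¹' ((z ⁻¹' s) ×ˢ (Y ⁻¹' t)) =
      (fun ω => (z ω, Y ω)) ⁻¹' (s ×ˢ t) := rfl
  have hk : Measurable[m] fun ω => condExpKernel P m ω (Y ⁻¹' t) :=
    measurable_condExpKernel (hY ht)
  rw [Measure.compProd_apply_prod hzs (hY ht), Measure.map_apply hd (hzs.prod (hY ht)), h2,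
    restrict_trim hm P hzs, lintegral_trim hm hk] at h1
  rw [Measure.map_apply (hz'.prodMk hY) (hs.prod ht), ← h1, Measure.compProd_apply_prod hs ht,
    setLIntegral_map hs (Kernel.measurable_coe κ ht) hz']
  refine lintegral_congr_ae (ae_restrict_of_ae ?_)
  filter_upwards [h] with ω hω
  rw [← hω, Measure.map_apply hY ht]

/-- `m` and the `σ`-field of `z` have the same sets up to null sets, hence the same conditional
expectations. -/
theorem condExp_ae_eq_condDistrib_of_le {Ω B W : Type*} {m : MeasurableSpace Ω}
    [mΩ : MeasurableSpace Ω] [MeasurableSpace B] [StandardBorelSpace B] [Nonempty B]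
    [MeasurableSpace W] (P : Measure Ω) [IsProbabilityMeasure P] (hm : m ≤ mΩ) {z : Ω → W}
    (hz : Measurable[m] z)
    (hgen : ∀ A, MeasurableSet[m] A → ∃ B : Set W, MeasurableSet B ∧ A =ᵐ[P] z ⁻¹' B)
    {Y : Ω → B} (hY : Measurable Y) {A : Set B} (hA : MeasurableSet A) :
    P⟦Y ⁻¹' A | m⟧ =ᵐ[P] fun ω => (condDistrib Y z P (z ω)).real A := by
  have hz' : Measurable z := hz.mono hm le_rfl
  have hk : Measurable[m] fun ω => (condDistrib Y z P (z ω)).real A :=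
    ((Kernel.measurable_coe _ hA).comp hz).ennreal_toReal
  have hi : Integrable ((Y ⁻¹' A).indicator fun _ => (1 : ℝ)) P :=
    (integrable_const _).indicator (hY hA)
  have hki := integrable_toReal_condDistrib (Y := Y) (μ := P) hz'.aemeasurable hA
  refine (ae_eq_condExp_of_forall_setIntegral_eq hm hi (fun s _ _ => hki.integrableOn)
    (fun s hs _ => ?_) hk.stronglyMeasurable.aestronglyMeasurable).symm
  obtain ⟨E, hE, hsE⟩ := hgen s hs
  rw [setIntegral_congr_set hsE, setIntegral_congr_set hsE,
    ← setIntegral_condExp hz'.comap_le hi ⟨E, hE, rfl⟩]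
  refine setIntegral_congr_ae (hz' hE) ?_
  filter_upwards [condDistrib_ae_eq_condExp hz' hY hA] with ω hω _ using hω

section Entropy

variable {G : Type*} [Group G] [TopologicalSpace G] [IsTopologicalGroup G]
  [PolishSpace G] [MeasurableSpace G] [BorelSpace G]

/-- Furstenberg entropy as the mean divergence from `μ` of the law of the first step conditioned
on a point of the space. -/
theorem furstenbergEntropy_eq_lintegral {W : Type*} [MeasurableSpace W]
    [MeasurableSpace.CountablyGenerated W] [MulAction G W] [MeasurableSMul₂ G W]
    {μ : Measure G} [IsProbabilityMeasure μ] (ρ : Measure W) [IsProbabilityMeasure ρ]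
    (κ : Kernel W G) [IsMarkovKernel κ]
    (hκ : ∀ f : G × W → ℝ≥0∞, Measurable f →
      ∫⁻ w, ∫⁻ g, f (g, w) ∂κ w ∂ρ = ∫⁻ g, ∫⁻ w, f (g, g • w) ∂ρ ∂μ) :
    furstenbergEntropy μ ρ = ∫⁻ w, klDiv (κ w) μ ∂ρ := by
  let K : Kernel G W := ⟨fun g => ρ.map fun w => g • w,
    Measure.measurable_of_measurable_coe _ fun A hA => measurable_map_smul_apply hA⟩
  have hK : IsMarkovKernel K :=
    ⟨fun g => Measure.isProbabilityMeasure_map (measurable_const_smul g).aemeasurable⟩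
  -- Translation by `g` turns `D(ρ ‖ g⁻¹ρ)` into `D(gρ ‖ ρ)`.
  have h1 : furstenbergEntropy μ ρ = ∫⁻ g, klDiv (K g) ρ ∂μ := by
    refine lintegral_congr fun g => ?_
    have hg : Measurable fun w : W => g • w := measurable_const_smul g
    have hg' : Measurable fun w : W => g⁻¹ • w := measurable_const_smul g⁻¹
    rw [← klDiv_map_measurableEquiv (MeasurableEquiv.smul g)]
    change klDiv (ρ.map fun w => g • w) ((ρ.map fun w => g⁻¹ • w).map fun w => g • w) = _
    rw [Measure.map_map hg hg']
    have : ((fun w : W => g • w) ∘ fun w => g⁻¹ • w) = id := funext fun w => smul_inv_smul g w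
    rw [this, Measure.map_id]
    rfl
  -- `hκ` says that `κ` is the conditional law of `g` given `g • w`, so both averages measure one
  -- joint law against the product of `ρ` and `μ`.
  have h2 : ρ ⊗ₘ κ = (μ ⊗ₘ K).map Prod.swap := by
    refine Measure.ext_of_lintegral _ fun f hf => ?_
    rw [Measure.lintegral_compProd hf, lintegral_map hf measurable_swap]
    refine (hκ (fun p => f p.swap) (hf.comp measurable_swap)).trans ?_
    refine Eq.trans ?_ (Measure.lintegral_compProd (hf.comp measurable_swap)).symm
    refine lintegral_congr fun g => ?_
    have hfg : Measurable fun w : W => f (w, g) := hf.comp measurable_prodMk_right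
    exact (lintegral_map hfg (measurable_const_smul g)).symm
  rw [h1, lintegral_klDiv_const, lintegral_klDiv_const, h2,
    ← klDiv_map_swap (μ ⊗ₘ K) (μ.prod ρ), Measure.prod_swap]

variable {X : Type*} [MeasurableSpace X] [StandardBorelSpace X] [Nonempty X]
  [MulAction G X] [MeasurableSMul₂ G X]
  {Y : Type*} [MeasurableSpace Y] [StandardBorelSpace Y] [MulAction G Y] [MeasurableSMul₂ G Y]
  {μ : Measure G} [IsProbabilityMeasure μ] {η : Measure X} [IsProbabilityMeasure η]
  {ν : Measure Y} {π : X → Y} {β : (ℕ → G) → Y}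

theorem measurable_firstStep : Measurable fun ω : ℕ → G => ω 0 := measurable_pi_apply 0

/-- The law of the first step of the walk conditioned to converge to `y`. -/
def stepLaw (μ : Measure G) [IsProbabilityMeasure μ] (β : (ℕ → G) → Y) : Kernel Y G :=
  (doobLaw μ β).map fun ω => ω 0

instance (μ : Measure G) [IsProbabilityMeasure μ] (β : (ℕ → G) → Y) :
    IsMarkovKernel (stepLaw μ β) :=
  Kernel.IsMarkovKernel.map _ measurable_firstStep

theorem stepLaw_apply (y : Y) : stepLaw μ β y = (doobLaw μ β y).map fun ω => ω 0 :=
  Kernel.map_apply _ measurable_firstStep y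

/-- The entropy of the boundary. -/
theorem IsStandardSystem.furstenbergEntropy_boundary (h : IsStandardSystem μ η ν π β) :
    furstenbergEntropy μ ν = ∫⁻ x, klDiv (stepLaw μ β (π x)) μ ∂η := by
  have := h.isProbabilityMeasure
  have hm : Measurable fun y : Y => klDiv (stepLaw μ β y) μ :=
    measurable_klDiv (stepLaw μ β) (Kernel.const Y μ)
  rw [furstenbergEntropy_eq_lintegral ν (stepLaw μ β) fun f hf => ?_]
  · conv_lhs => rw [← h.factor.map_eq]
    rw [lintegral_map hm h.factor.measurable]
  · have hf1 : Measurable fun p : Y × (ℕ → G) => f (p.2 0, p.1) :=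
      hf.comp ((measurable_firstStep.comp measurable_snd).prodMk measurable_fst)
    have hβ : Measurable fun ω : ℕ → G => (β ω, ω) := h.boundary.measurable.prodMk measurable_id
    calc ∫⁻ y, ∫⁻ g, f (g, y) ∂stepLaw μ β y ∂ν
        = ∫⁻ y, ∫⁻ ω, f (ω 0, y) ∂doobLaw μ β y ∂ν := by
          refine lintegral_congr fun y => ?_
          have hfy : Measurable fun g : G => f (g, y) := hf.comp measurable_prodMk_right
          rw [stepLaw_apply, lintegral_map hfy measurable_firstStep]
      _ = ∫⁻ ω, f (ω 0, β ω) ∂walkLaw μ := (h.lintegral_doobLaw hf1).symm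
      _ = ∫⁻ g, ∫⁻ ω, f (g, β (consPath g fun n => g * ω n)) ∂walkLaw μ ∂μ :=
          lintegral_walkLaw μ (hf1.comp hβ)
      _ = ∫⁻ g, ∫⁻ y, f (g, g • y) ∂ν ∂μ := by
          refine lintegral_congr_ae ?_
          filter_upwards [h.boundary.ae_consPath] with g hg
          have hfg : Measurable fun y : Y => f (g, g • y) :=
            hf.comp (measurable_const.prodMk (measurable_const_smul g))
          conv_rhs => rw [← h.map_boundary]
          rw [lintegral_map hfg h.boundary.measurable]
          refine lintegral_congr_ae ?_
          filter_upwards [hg] with ω hω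
          rw [hω]

variable {Z : Type*} [MeasurableSpace Z] [StandardBorelSpace Z] [MulAction G Z]
  [MeasurableSMul₂ G Z] {L : SubgroupField G X} {lam : Measure Z} {θ : CosetTrajectories L → Z}

theorem IsPoissonBundle.map_joining (hZ : IsPoissonBundle μ η L lam θ) :
    (joining μ η).map (fun p => θ (toCosets L p)) = lam := by
  rw [← hZ.map_eq, cosetLaw, Measure.map_map
    (hZ.measurable.mono (MeasurableSpace.invariants_le _) le_rfl) (measurable_toCosets L)]
  rfl

/-- The law of the first step of the joining conditioned on the Poisson bundle. -/
def bundleStepLaw (μ : Measure G) [IsProbabilityMeasure μ] (η : Measure X)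
    [IsFiniteMeasure (joining μ η)] (L : SubgroupField G X)
    (θ : CosetTrajectories L → Z) : Kernel Z G :=
  condDistrib (fun p : X × (ℕ → G) => p.2 0) (fun p => θ (toCosets L p)) (joining μ η)

instance (μ : Measure G) [IsProbabilityMeasure μ] (η : Measure X)
    [IsFiniteMeasure (joining μ η)] (L : SubgroupField G X)
    (θ : CosetTrajectories L → Z) : IsMarkovKernel (bundleStepLaw μ η L θ) := by
  unfold bundleStepLaw
  infer_instance

theorem measurable_firstStep_snd : Measurable fun p : X × (ℕ → G) => p.2 0 :=
  measurable_firstStep.comp measurable_snd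

/-- The entropy of the Poisson bundle. -/
theorem IsPoissonBundle.furstenbergEntropy_eq (hZ : IsPoissonBundle μ η L lam θ)
    (h : IsStandardSystem μ η ν π β) [IsProbabilityMeasure (joining μ η)] :
    furstenbergEntropy μ lam =
      ∫⁻ p, klDiv (bundleStepLaw μ η L θ (θ (toCosets L p))) μ ∂joining μ η := by
  have hz := measurable_map_toCosets hZ.measurable
  have : IsProbabilityMeasure lam :=
    hZ.map_joining ▸ Measure.isProbabilityMeasure_map hz.aemeasurable
  have hm : Measurable fun w : Z => klDiv (bundleStepLaw μ η L θ w) μ :=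
    measurable_klDiv (bundleStepLaw μ η L θ) (Kernel.const Z μ)
  rw [furstenbergEntropy_eq_lintegral lam (bundleStepLaw μ η L θ) fun f hf => ?_]
  · conv_lhs => rw [← hZ.map_joining]
    rw [lintegral_map hm hz]
  · have h1 := compProd_map_condDistrib (X := fun p => θ (toCosets L p)) (μ := joining μ η)
      (mβ := inferInstance) (measurable_firstStep_snd (G := G) (X := X)).aemeasurable
    have hf' : Measurable fun q : Z × G => f q.swap := hf.comp measurable_swap
    rw [hZ.map_joining] at h1
    calc ∫⁻ w, ∫⁻ g, f (g, w) ∂bundleStepLaw μ η L θ w ∂lam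
        = ∫⁻ q, f q.swap ∂(lam ⊗ₘ bundleStepLaw μ η L θ) := (Measure.lintegral_compProd hf').symm
      _ = ∫⁻ p, f (p.2 0, θ (toCosets L (pathShift p))) ∂joining μ η := by
          rw [bundleStepLaw, h1, lintegral_map hf' (hz.prodMk measurable_firstStep_snd)]
          refine lintegral_congr fun p => ?_
          -- The bundle point is unchanged by the shift, so it can be computed from the shifted
          -- path, to which the first step decomposition applies.
          rw [map_toCosets_pathShift hZ.measurable]
          rfl
      _ = ∫⁻ g, ∫⁻ p, f (g, θ (toCosets L (diagAction g p))) ∂joining μ η ∂μ :=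
          h.lintegral_joining_step (f := fun q => f (q.1, θ (toCosets L q.2)))
            (hf.comp (measurable_fst.prodMk (hz.comp measurable_snd)))
      _ = ∫⁻ g, ∫⁻ w, f (g, g • w) ∂lam ∂μ := by
          refine lintegral_congr fun g => ?_
          have hfg : Measurable fun w : Z => f (g, g • w) :=
            hf.comp (measurable_const.prodMk (measurable_const_smul g))
          conv_rhs => rw [← hZ.map_joining]
          rw [lintegral_map hfg hz]
          refine lintegral_congr_ae ?_
          have he : ∀ᵐ p ∂joining μ η, θ (translate L g (toCosets L p)) = g • θ (toCosets L p) :=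
            ae_of_ae_map (measurable_toCosets L).aemeasurable (hZ.equivariant g)
          filter_upwards [he] with p hp
          rw [← hp, translate_toCosets]

/-- Conditioning the first step of the fibre walk on the tail of the coset process is conditioning
on the Poisson bundle. -/
theorem IsPoissonBundle.condExpKernel_tailField (hZ : IsPoissonBundle μ η L lam θ)
    (h : IsStandardSystem μ η ν π β) (hT : TailAssumption μ)
    [IsProbabilityMeasure (joining μ η)] :
    ∀ᵐ x ∂η, ∀ᵐ ω ∂doobLaw μ β (π x),
      (condExpKernel (doobLaw μ β (π x)) (tailField (fiberChain L x)) ω).map (fun ω => ω 0) =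
        bundleStepLaw μ η L θ (θ (toCosets L (x, ω))) := by
  have hz := measurable_map_toCosets hZ.measurable
  have key := condExpKernel_map_ae_eq η ((doobLaw μ β).comap π h.factor.measurable)
    (measurable_futureCode L) (antitone_comap_futureCode L) measurable_fst (fun n q => rfl)
    (measurable_firstStep (G := G)) (bundleStepLaw μ η L θ) hz fun A hA => by
      rw [← h.joining_eq_compProd]
      exact condExp_ae_eq_condDistrib_of_le (joining μ η) (globalTail_le L)
        (measurable_globalTail_map_toCosets hZ.measurable)
        (fun A hA => hZ.exists_ae_eq_preimage h hT hA) measurable_firstStep_snd hA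
  filter_upwards [key] with x hx
  rw [tailField_fiberChain]
  exact hx

end Entropy

/-! ### The fibrewise chain rule -/

section FibreChain

variable {G : Type*} [Group G] [TopologicalSpace G] [IsTopologicalGroup G]
  [PolishSpace G] [MeasurableSpace G] [BorelSpace G]
  {X : Type*} [MeasurableSpace X] [StandardBorelSpace X] [Nonempty X]
  [MulAction G X] [MeasurableSMul₂ G X]
  {Y : Type*} [MeasurableSpace Y] [StandardBorelSpace Y] [MulAction G Y] [MeasurableSMul₂ G Y]
  {Z : Type*} [MeasurableSpace Z] [StandardBorelSpace Z] [MulAction G Z]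
  {μ : Measure G} [IsProbabilityMeasure μ] {η : Measure X} [IsProbabilityMeasure η]
  {ν : Measure Y} {π : X → Y} {β : (ℕ → G) → Y}
  {L : SubgroupField G X} {lam : Measure Z} {θ : CosetTrajectories L → Z}

theorem toCosets_mulPath_eq (x : X) {g g' : G}
    (h : coset (L.group x) g = coset (L.group x) g') (ω : ℕ → G) :
    toCosets L (x, fun n => g * ω n) = toCosets L (x, fun n => g' * ω n) := by
  have hr : g' * g⁻¹ ∈ L.group x := QuotientGroup.rightRel_apply.1 (Quotient.exact h)
  refine congrArg (Sigma.mk x) (funext fun n => Quotient.sound ?_)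
  refine QuotientGroup.rightRel_apply.2 ?_
  simpa [mul_assoc] using hr

theorem inv_smul_eq_of_coset_eq {x : X} (hS : L.group x ≤ MulAction.stabilizer G (π x)) {g g' : G}
    (h : coset (L.group x) g = coset (L.group x) g') : g⁻¹ • π x = g'⁻¹ • π x := by
  have hr : g' * g⁻¹ ∈ L.group x := QuotientGroup.rightRel_apply.1 (Quotient.exact h)
  have h1 : (g' * g⁻¹) • π x = π x := hS hr
  conv_rhs => rw [← h1]
  rw [smul_smul, inv_mul_cancel_left]

/-- The law of the bundle point over `x`, given the first step `g`. -/
def bundleFibreLaw (μ : Measure G) [IsProbabilityMeasure μ] (π : X → Y) (β : (ℕ → G) → Y)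
    (L : SubgroupField G X) (θ : CosetTrajectories L → Z) (x : X) (g : G) : Measure Z :=
  (doobLaw μ β (g⁻¹ • π x)).map fun ω => θ (toCosets L (x, fun n => g * ω n))

theorem measurable_bundleFibreLaw
    (hθ : Measurable[MeasurableSpace.invariants (timeShift L)] θ) (x : X) :
    Measurable (bundleFibreLaw μ π β L θ x) := by
  have hz := measurable_map_toCosets hθ
  have hx : Measurable fun q : G × (ℕ → G) =>
      θ (toCosets L (x, fun n => q.1 * q.2 n)) :=
    hz.comp (measurable_const.prodMk measurable_mulPath)
  have hg : Measurable fun g : G => g⁻¹ • π x := measurable_inv.smul_const (π x)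
  refine Measure.measurable_of_measurable_coe _ fun B hB => ?_
  have h1 : ∀ g : G, bundleFibreLaw μ π β L θ x g B =
      (doobLaw μ β).comap _ hg g (Prod.mk g ⁻¹' ((fun q : G × (ℕ → G) =>
        θ (toCosets L (x, fun n => q.1 * q.2 n))) ⁻¹' B)) := fun g =>
    Measure.map_apply (hx.comp measurable_prodMk_left) hB
  simp_rw [h1]
  exact Kernel.measurable_kernel_prodMk_left (hx hB)

/-- Over `x`, the law of the bundle point given the coset of the first step.  This is where
`L_x ≤ Stab(π(x))` enters. -/
def cosetFibreLaw (μ : Measure G) [IsProbabilityMeasure μ] (β : (ℕ → G) → Y)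
    (hθ : Measurable[MeasurableSpace.invariants (timeShift L)] θ) (x : X)
    (hS : L.group x ≤ MulAction.stabilizer G (π x)) : Kernel (CosetSpace (L.group x)) Z where
  toFun := Quotient.lift (bundleFibreLaw μ π β L θ x) fun g g' h => by
    have h' : coset (L.group x) g = coset (L.group x) g' := Quotient.sound h
    simp only [bundleFibreLaw, inv_smul_eq_of_coset_eq hS h', toCosets_mulPath_eq x h']
  measurable' := measurable_from_quotient.2 (measurable_bundleFibreLaw hθ x)

theorem isMarkovKernel_cosetFibreLaw
    (hθ : Measurable[MeasurableSpace.invariants (timeShift L)] θ) (x : X)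
    (hS : L.group x ≤ MulAction.stabilizer G (π x)) :
    IsMarkovKernel (cosetFibreLaw μ β hθ x hS) := by
  refine ⟨fun c => ?_⟩
  obtain ⟨g, rfl⟩ := Quotient.exists_rep c
  have hx : Measurable fun ω : ℕ → G => θ (toCosets L (x, fun n => g * ω n)) :=
    (measurable_map_toCosets hθ).comp
      (measurable_const.prodMk (measurable_mulPath.comp measurable_prodMk_left))
  exact Measure.isProbabilityMeasure_map hx.aemeasurable

theorem measurable_section_of_globalTail
    (hθ : Measurable[MeasurableSpace.invariants (timeShift L)] θ) (x : X) :
    Measurable[tailField (fiberChain L x)] fun ω => θ (toCosets L (x, ω)) := by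
  rw [tailField_fiberChain]
  intro B hB
  refine MeasurableSpace.measurableSet_iInf.2 fun n => ?_
  obtain ⟨D, hD, hDB⟩ :=
    MeasurableSpace.measurableSet_iInf.1 (measurable_globalTail_map_toCosets hθ hB) n
  exact ⟨D, hD, congrArg (fun E => Prod.mk x ⁻¹' E) hDB⟩

/-- The chain rule for the divergence of the conditional first step from `μ`, over a point `x`. -/
theorem lintegral_klDiv_bundleStepLaw_fibre
    [IsProbabilityMeasure (joining μ η)]
    (hθ : Measurable[MeasurableSpace.invariants (timeShift L)] θ) (x : X)
    (hS : L.group x ≤ MulAction.stabilizer G (π x))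
    (hkey : ∀ᵐ ω ∂doobLaw μ β (π x),
      (condExpKernel (doobLaw μ β (π x)) (tailField (fiberChain L x)) ω).map (fun ω => ω 0) =
        bundleStepLaw μ η L θ (θ (toCosets L (x, ω))))
    (hstep : ∀ f : G × (ℕ → G) → ℝ≥0∞, Measurable f →
      ∫⁻ ω, f (ω 0, fun n => ω (n + 1)) ∂doobLaw μ β (π x) =
        ∫⁻ ω, ∫⁻ ω', f (ω 0, fun n => ω 0 * ω' n) ∂doobLaw μ β ((ω 0)⁻¹ • π x)
          ∂doobLaw μ β (π x)) :
    ∫⁻ ω, klDiv (bundleStepLaw μ η L θ (θ (toCosets L (x, ω)))) μ ∂doobLaw μ β (π x) =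
      klDiv (stepLaw μ β (π x)) μ + fiberInfo μ π β L x := by
  set P := doobLaw μ β (π x) with hP
  set κ := bundleStepLaw μ η L θ with hκ
  have hzx : Measurable fun ω : ℕ → G => θ (toCosets L (x, ω)) :=
    (measurable_map_toCosets hθ).comp measurable_prodMk_left
  have htail : tailField (fiberChain L x) ≤ (inferInstance : MeasurableSpace (ℕ → G)) := by
    rw [tailField_fiberChain]
    exact (iInf_le _ 0).trans ((measurable_futureCode L 0).comp measurable_prodMk_left).comap_le
  set N := P.map fun ω => θ (toCosets L (x, ω)) with hN
  have hNp : IsProbabilityMeasure N := Measure.isProbabilityMeasure_map hzx.aemeasurable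
  have hq : Measurable (coset (L.group x)) := measurable_coset _
  -- By `hkey` the globally defined `κ` is also the conditional law of the first step given the
  -- bundle point over this single `x`.
  have hlaw : N ⊗ₘ κ = P.map fun ω => (θ (toCosets L (x, ω)), ω 0) :=
    compProd_map_of_condExpKernel_map P htail (measurable_section_of_globalTail hθ x)
      measurable_firstStep κ hkey
  have := isMarkovKernel_cosetFibreLaw (μ := μ) (β := β) hθ x hS
  -- The reverse conditioning: given the first step `g`, the bundle point is that of the
  -- `g`-translate of a walk conditioned to converge to `g⁻¹ • π x`, and its law depends on the
  -- coset of `g` only.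
  have hswap : (N ⊗ₘ κ).map Prod.swap =
      stepLaw μ β (π x) ⊗ₘ (cosetFibreLaw μ β hθ x hS).comap (coset (L.group x)) hq := by
    have hpair : Measurable fun ω : ℕ → G => (θ (toCosets L (x, ω)), ω 0) :=
      hzx.prodMk measurable_firstStep
    refine Measure.ext_of_lintegral _ fun f hf => ?_
    have hf' : Measurable fun q : G × (ℕ → G) => f (q.1, θ (toCosets L (x, q.2))) :=
      hf.comp (measurable_fst.prodMk (hzx.comp measurable_snd))
    have hin : Measurable fun g : G => ∫⁻ w, f (g, w)
        ∂(cosetFibreLaw μ β hθ x hS).comap (coset (L.group x)) hq g :=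
      Measurable.lintegral_kernel_prod_right' hf
    have hfs : Measurable fun q : Z × G => f q.swap := hf.comp measurable_swap
    rw [hlaw, lintegral_map hf measurable_swap, lintegral_map hfs hpair,
      Measure.lintegral_compProd hf, stepLaw_apply, lintegral_map hin measurable_firstStep]
    refine Eq.trans (lintegral_congr fun ω => ?_) ((hstep _ hf').trans
      (lintegral_congr fun ω => ?_))
    · have := map_toCosets_pathShift hθ (x, ω)
      simp only [Prod.swap, ← this]
      rfl
    · have hx : Measurable fun ω' : ℕ → G => θ (toCosets L (x, fun n => ω 0 * ω' n)) :=
        hzx.comp (measurable_mulPath.comp measurable_prodMk_left)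
      have hfw : Measurable fun w : Z => f (ω 0, w) := hf.comp measurable_prodMk_left
      exact (lintegral_map hfw hx).symm
  have hm1 : Measurable fun w : Z => klDiv (κ w) μ := measurable_klDiv κ (Kernel.const Z μ)
  have hm2 : Measurable fun w : Z =>
      klDiv ((κ w).map (coset (L.group x))) ((stepLaw μ β (π x)).map (coset (L.group x))) := by
    have := Kernel.IsMarkovKernel.map κ hq
    have hR : IsProbabilityMeasure ((stepLaw μ β (π x)).map (coset (L.group x))) :=
      Measure.isProbabilityMeasure_map hq.aemeasurable
    have h1 := measurable_klDiv (κ.map (coset (L.group x)))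
      (Kernel.const Z ((stepLaw μ β (π x)).map (coset (L.group x))))
    simpa only [Kernel.map_apply _ hq, Kernel.const_apply] using h1
  have hinfo : fiberInfo μ π β L x = ∫⁻ w, klDiv ((κ w).map (coset (L.group x)))
      ((stepLaw μ β (π x)).map (coset (L.group x))) ∂N := by
    rw [hN, lintegral_map hm2 hzx, fiberInfo, mutualInfo]
    refine lintegral_congr_ae ?_
    filter_upwards [hkey] with ω hω
    rw [← hω, stepLaw_apply, Measure.map_map hq measurable_firstStep,
      Measure.map_map hq measurable_firstStep]
    rfl
  -- The information in the coset equals that in the whole first step, and the compensation identity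
  -- then adds the divergence of the mixture from `μ`.
  rw [hinfo, ← lintegral_klDiv_map N κ (stepLaw μ β (π x)) hq (cosetFibreLaw μ β hθ x hS) hswap,
    ← lintegral_klDiv_eq_add N κ (stepLaw μ β (π x)) _ hswap μ, hN, lintegral_map hm1 hzx]

end FibreChain

end PoissonBundle

end

/-! ### The entropy formula -/

theorem mainTheorem11
    {G : Type*} [Group G] [TopologicalSpace G] [IsTopologicalGroup G]
    [LocallyCompactSpace G] [PolishSpace G] [MeasurableSpace G] [BorelSpace G]
    {X : Type*} [MeasurableSpace X] [StandardBorelSpace X] [Nonempty X]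
    [MulAction G X] [MeasurableSMul₂ G X]
    {Y : Type*} [MeasurableSpace Y] [StandardBorelSpace Y]
    [MulAction G Y] [MeasurableSMul₂ G Y]
    {Z : Type*} [MeasurableSpace Z] [StandardBorelSpace Z]
    [MulAction G Z] [MeasurableSMul₂ G Z]
    (μ : Measure G) [IsProbabilityMeasure μ]
    (hμ : PoissonBundle.Nondegenerate μ) (hT : PoissonBundle.TailAssumption μ)
    (η : Measure X) [IsProbabilityMeasure η] (ν : Measure Y)
    (π : X → Y) (β : (ℕ → G) → Y)
    (hstd : PoissonBundle.IsStandardSystem μ η ν π β)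
    (L : PoissonBundle.SubgroupField G X)
    (hS : ∀ x : X, L.group x ≤ MulAction.stabilizer G (π x))
    (lam : Measure Z) (θ : PoissonBundle.CosetTrajectories L → Z)
    (hZ : PoissonBundle.IsPoissonBundle μ η L lam θ) :
    PoissonBundle.furstenbergEntropy μ lam =
      PoissonBundle.furstenbergEntropy μ ν +
        ∫⁻ x, PoissonBundle.fiberInfo μ π β L x ∂η := by
  have := hstd.isProbabilityMeasure_joining
  have hm : Measurable fun x =>
      InformationTheory.klDiv (PoissonBundle.stepLaw μ β (π x)) μ :=
    (PoissonBundle.measurable_klDiv (PoissonBundle.stepLaw μ β) (Kernel.const Y μ)).comp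
      hstd.factor.measurable
  have hm' : Measurable fun p : X × (ℕ → G) => InformationTheory.klDiv
      (PoissonBundle.bundleStepLaw μ η L θ (θ (PoissonBundle.toCosets L p))) μ :=
    (PoissonBundle.measurable_klDiv (PoissonBundle.bundleStepLaw μ η L θ)
      (Kernel.const Z μ)).comp (PoissonBundle.measurable_map_toCosets hZ.measurable)
  have hstep := hstd.ae_doobLaw_step
  rw [← hstd.factor.map_eq] at hstep
  rw [hZ.furstenbergEntropy_eq hstd, hstd.furstenbergEntropy_boundary, ← lintegral_add_left hm]
  -- Both sides are now integrals over `η`, and the integrands agree for almost every `x`.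
  rw [hstd.lintegral_joining_fibre hm']
  refine lintegral_congr_ae ?_
  filter_upwards [hZ.condExpKernel_tailField hstd hT,
    ae_of_ae_map hstd.factor.measurable.aemeasurable hstep] with x hkey hx
  exact PoissonBundle.lintegral_klDiv_bundleStepLaw_fibre hZ.measurable x (hS x) hkey hx
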